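/- **Setting.** Let $v_0,\dots,v_{m-1}\in N=\mathbb Z^n$ ($n\ge 1$) generate $N$, let $u\in M=N^\vee$ satisfy $\langle u,v_i\rangle=1$ for all $i$, and let $\lambda\in\mathbb R^m$ be such that $\Delta=\{\nu\in M_{\mathbb R}:\langle \nu,v_i\rangle\ge-\lambda_i\ \forall i\}$ has exactly the facets $F_i=\Delta\cap\{\langle\nu,v_i\rangle=-\lambda_i\}$, $i=0,\dots,m-1$, and is smooth (the normals of the facets through any point of $\Delta$ are part of a $\mathbb Z$-basis of $N$). Write $\beta:\mathbb Z^m\to N$, $e_i\mapsto v_i$, and $G=\ker\beta$. Let $$X=X_\Delta=\{z\in\mathbb C^m:\ (|z_i|^2)_i=(\lambda_i+\langle\nu,v_i\rangle)_i\text{ for some }\nu\in M_{\mathbb R}\}\big/(G_{\mathbb R}/G)$$ be the toric Calabi-Yau manifold, with moment map $\mu_\Delta([z])=\nu$, with the symplectic form $\omega$ induced from $\frac1{2\pi}\sum_j d(r_j^2)\wedge d\theta_j$ ($z_j=r_je^{i\theta_j}$), and with $\chi^u([z])=\prod_i z_i$. For $\epsilon\in\mathbb C^\times$ let $$\mu_G=\mu_G^{\epsilon}:X\to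 B=M_{\mathbb R}/\mathbb Ru\times\mathbb R_{\ge0},\qquad \mu_G(x)=([\mu_\Delta(x)],|\chi^u(x)-\epsilon|^2)$$ be the Gross fibration, $\Gamma=\partial B\cup\bigcup_{i\ne j}\big((F_i\cap F_j)/\mathbb Ru\times\{|\epsilon|^2\}\big)$ its discriminant locus, where $\partial B=\{b_2=0\}$, and $B_0=B\setminus\Gamma$. Let $\mathcal M_0$ be the set of pairs $(L_G,\nabla)$, where $L_G=\mu_G^{-1}(b)$ with $b\in B_0$ and $\nabla$ is an isomorphism class of flat $U(1)$-connections on $L_G$. **Semi-flat coordinates.** For a regular fibre $L_G$ the classes $\beta_0,\dots,\beta_{m-1}\in H_2(X,L_G;\mathbb Z)$ are obtained from the basic discs bounded by a moment map fibre (the $j$-th one meets the $j$-th toric divisor once and no other, and its boundary is the $j$-th circle orbit) by moving their boundaries along one common path of regular fibres of the fibrations $\mu_G^{t\epsilon}$, $0\le t\le1$, from a fibre with $t=0$ (a moment map fibre) to $L_G$ (with $t=1$). Put $Z_{\beta_j}(L_G,\nabla)=\exp(-\int_{\beta_j}\omega)\,\mathrm{Hol}_\nabla(\partial\beta_j)$.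 **A-branes.** Let $l^{(1)},\dots,l^{(k)},l_\perp^{(k+1)},\dots,l_\perp^{(m)}\in\mathbb Z^m$ be linearly independent with $l^{(a)}\cdot l_\perp^{(b)}=0$ and $\sum_j l^{(a)}_j=0$ for all $a,b$, and suppose that $\beta(l^{(1)}),\dots,\beta(l^{(k)})$ generate the group $N\cap\mathbb R\langle\beta(l^{(1)}),\dots,\beta(l^{(k)})\rangle$. For real constants $c^{(a)}$ and $\psi^{(b)}$ let $L\subset X$ be the image of the set of those $z=(r_je^{i\theta_j})$ in the level set above with $$\sum_j l^{(a)}_jr_j^2=c^{(a)}\ (a=1,\dots,k),\qquad \sum_j(l_\perp^{(b)})_j\theta_j=\psi^{(b)}\ (b=k+1,\dots,m).$$ The sum $\Phi=\sum_j\theta_j$ takes the same value for all $\theta$ that satisfy the second set of equations; choose $\epsilon\in\mathbb R_{>0}e^{i\Phi}$. Let $\nabla_L$ be an isomorphism class of flat $U(1)$-connections on $L$ whose holonomy along the orbit loops $\beta(l^{(a)})$, i.e. $\theta\mapsto[(e^{i l^{(a)}_j\theta}z_j)_j]$ with $0\le\theta\le2\pi$, is $e^{i\phi^{(a)}}$ for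 $a=1,\dots,k$. **SYZ transformation.** For $b\in B$ let $\mathcal B_b$ be the set of $(L_G,\nabla)\in\mathcal M_0$ such that $L_G=\mu_G^{-1}(b)$ and $\nabla$ twisted by $\nabla_L$ is trivial when restricted to $L\cap L_G$. The semi-flat mirror brane of $(L,\nabla_L)$ is $\mathcal B_0=\bigcup_{b\in\mu_G(L)}\mathcal B_b$. **Theorem.** Every regular Gross fibre carries classes $\beta_0,\dots,\beta_{m-1}$ as above (represented by discs and smooth cylinders), and for every choice of them for all the regular fibres, $$\mathcal B_0=\Big\{(L_G,\nabla)\in\mathcal M_0:\ \prod_{j=0}^{m-1}Z_{\beta_j}(L_G,\nabla)^{-l^{(a)}_j}=e^{c^{(a)}+i\phi^{(a)}},\quad a=1,\dots,k\Big\}.$$ -/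

import Mathlib

open scoped NNReal ContDiff

noncomputable section

/-! ### Flat `U(1)`-connections up to isomorphism -/

/-- A flat `U(1)`-connection on `Y`, given by its parallel transport with respect to a unitary
frame chosen at every point: multiplicative under concatenation, invariant under homotopy of
paths relative to the end points. -/
structure FlatU1 (Y : Type*) [TopologicalSpace Y] where
  tr : ∀ {x y : Y}, Path x y → Circle
  tr_trans : ∀ {x y z : Y} (p : Path x y) (q : Path y z), tr (p.trans q) = tr p * tr q
  tr_homotopic : ∀ {x y : Y} (p q : Path x y), p.Homotopic q → tr p = tr q

namespace FlatU1

variable {Y Y' : Type*} [TopologicalSpace Y] [TopologicalSpace Y']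

/-- Isomorphism (gauge equivalence): a change of the frame at every point. -/
def setoid (Y : Type*) [TopologicalSpace Y] : Setoid (FlatU1 Y) where
  r A A' := ∃ g : Y → Circle, ∀ (x y : Y) (p : Path x y), A'.tr p = g x * A.tr p * (g y)⁻¹
  iseqv :=
    { refl := fun A => ⟨fun _ => 1, fun x y p => by simp⟩
      symm := by
        rintro A A' ⟨g, hg⟩
        refine ⟨fun x => (g x)⁻¹, fun x y p => ?_⟩
        rw [hg x y p]; group
      trans := by
        rintro A A' A'' ⟨g, hg⟩ ⟨g', hg'⟩
        refine ⟨fun x => g' x * g x, fun x y p => ?_⟩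
        rw [hg' x y p, hg x y p]; group }

/-- The trivial connection. -/
def triv (Y : Type*) [TopologicalSpace Y] : FlatU1 Y where
  tr _ := 1
  tr_trans _ _ := by simp
  tr_homotopic _ _ _ := rfl

/-- The twist of one connection by another (tensor product of the flat line bundles). -/
def twist (A A' : FlatU1 Y) : FlatU1 Y where
  tr p := A.tr p * A'.tr p
  tr_trans p q := by rw [A.tr_trans, A'.tr_trans]; exact mul_mul_mul_comm _ _ _ _
  tr_homotopic p q h := by rw [A.tr_homotopic p q h, A'.tr_homotopic p q h]

/-- Pull-back along a continuous map. -/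
def pullback (f : C(Y', Y)) (A : FlatU1 Y) : FlatU1 Y' where
  tr p := A.tr (p.map f.continuous)
  tr_trans p q := by rw [Path.map_trans, A.tr_trans]
  tr_homotopic p q h := A.tr_homotopic _ _ (h.map f)

end FlatU1

/-- Isomorphism classes of flat `U(1)`-connections. -/
def FlatClass (Y : Type*) [TopologicalSpace Y] : Type _ := Quotient (FlatU1.setoid Y)

namespace FlatClass

variable {Y Y' : Type*} [TopologicalSpace Y] [TopologicalSpace Y']

/-- The class of the trivial connection. -/
def triv (Y : Type*) [TopologicalSpace Y] : FlatClass Y :=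
  Quotient.mk (FlatU1.setoid Y) (FlatU1.triv Y)

/-- The twist of a class by another one. -/
def twist : FlatClass Y → FlatClass Y → FlatClass Y :=
  Quotient.map₂ FlatU1.twist (by
    rintro A B ⟨g, hg⟩ A' B' ⟨g', hg'⟩
    refine ⟨fun x => g x * g' x, fun x y p => ?_⟩
    simp only [FlatU1.twist]
    rw [hg x y p, hg' x y p, mul_inv, mul_mul_mul_comm, mul_mul_mul_comm (g x)])

/-- Pull-back of a class along a continuous map. -/
def pullback (f : C(Y', Y)) : FlatClass Y → FlatClass Y' :=
  Quotient.map (FlatU1.pullback f) (by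
    rintro A B ⟨g, hg⟩
    exact ⟨fun x => g (f x), fun x y p => hg _ _ _⟩)

/-- Holonomy along a loop. -/
def hol (A : FlatClass Y) {x : Y} (p : Path x x) : Circle :=
  Quotient.lift (fun A : FlatU1 Y => A.tr p) (by
    rintro A B ⟨g, hg⟩
    show A.tr p = B.tr p
    rw [hg x x p, mul_comm (g x), mul_inv_cancel_right]) A

end FlatClass

/-! ### Toric Calabi-Yau manifolds -/

/-- The affine functions `ν ↦ ⟨ν, v i⟩ + lam i` on `M_ℝ = ℝⁿ`. -/
def facetFun {n m : ℕ} (v : Fin m → Fin n → ℤ) (lam : Fin m → ℝ) (ν : Fin n → ℝ) (i : Fin m) : ℝ :=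
  (∑ a, ν a * (v i a : ℝ)) + lam i

/-- The data of a toric Calabi-Yau manifold of dimension `n`: the primitive generators
`v i ∈ N = ℤⁿ` of the rays, the constants of the polyhedron
`Δ = {ν | ⟨ν, v i⟩ ≥ - lam i for all i}`, and `u ∈ M` with `⟨u, v i⟩ = 1`.  -/
structure ToricCY (n m : ℕ) where
  v : Fin m → Fin n → ℤ
  lam : Fin m → ℝ
  u : Fin n → ℤ
  dim_pos : 0 < n
  /-- The map `β : ℤᵐ → N` is onto. -/
  span_v : Submodule.span ℤ (Set.range v) = ⊤
  calabi_yau : ∀ i, ∑ a, u a * v i a = 1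
  /-- Every `v i` is the normal of a facet of `Δ`. -/
  facet : ∀ j, ∃ ν, facetFun v lam ν j = 0 ∧ ∀ i, i ≠ j → 0 < facetFun v lam ν i
  /-- Smoothness: the normals of the facets through a point of `Δ` are part of a `ℤ`-basis. -/
  delzant : ∀ ν, (∀ i, 0 ≤ facetFun v lam ν i) →
    ∃ b : Module.Basis (Fin n) ℤ (Fin n → ℤ), {w | ∃ i, facetFun v lam ν i = 0 ∧ v i = w} ⊆ Set.range b

namespace ToricCY

variable {n m : ℕ} (T : ToricCY n m)

/-- `ell ν i = ⟨ν, v i⟩ + lam i`. -/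
def ell (ν : Fin n → ℝ) (i : Fin m) : ℝ := facetFun T.v T.lam ν i

/-- The polyhedron `Δ`. -/
def Delta : Set (Fin n → ℝ) := {ν | ∀ i, 0 ≤ T.ell ν i}

/-- The level set of the moment map of the torus `G_ℝ / G`, `G = ker (β : ℤᵐ → N)`, on `ℂᵐ`:
the vectors with `(|z i|²) = lam + β^∨ ν` for some `ν ∈ M_ℝ`. -/
def Level : Set (Fin m → ℂ) := {z | ∃ ν : Fin n → ℝ, ∀ i, ‖z i‖ ^ 2 = T.ell ν i}

end ToricCY

/-- The action of `g ∈ ℝᵐ` on `ℂᵐ` by `z i ↦ exp (2 π i g i) z i`. -/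
def torusAct {m : ℕ} (g : Fin m → ℝ) (z : Fin m → ℂ) : Fin m → ℂ :=
  fun i => Complex.exp (2 * Real.pi * g i * Complex.I) * z i

theorem norm_torusAct {m : ℕ} (g : Fin m → ℝ) (z : Fin m → ℂ) (i : Fin m) :
    ‖torusAct g z i‖ = ‖z i‖ := by
  have h : (2 * Real.pi * g i * Complex.I : ℂ) = ((2 * Real.pi * g i : ℝ) : ℂ) * Complex.I := by
    push_cast; ring
  rw [torusAct, norm_mul, h, Complex.norm_exp_ofReal_mul_I, one_mul]

theorem torusAct_add {m : ℕ} (g h : Fin m → ℝ) (z : Fin m → ℂ) :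
    torusAct (g + h) z = torusAct g (torusAct h z) := by
  funext i
  simp only [torusAct, Pi.add_apply]
  rw [← mul_assoc, ← Complex.exp_add]
  congr 2
  push_cast; ring

theorem torusAct_zero {m : ℕ} (z : Fin m → ℂ) : torusAct 0 z = z := by
  funext i; simp [torusAct]

namespace ToricCY

variable {n m : ℕ} (T : ToricCY n m)

theorem torusAct_mem (g : Fin m → ℝ) {z : Fin m → ℂ} (hz : z ∈ T.Level) :
    torusAct g z ∈ T.Level := by
  obtain ⟨ν, hν⟩ := hz
  exact ⟨ν, fun i => by rw [norm_torusAct]; exact hν i⟩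

/-- Orbits of the torus `G_ℝ / G`: here `G_ℝ` is the kernel of `β_ℝ : ℝᵐ → N_ℝ`. -/
def orbitSetoid : Setoid T.Level where
  r z w := ∃ g : Fin m → ℝ, (∀ a, ∑ i, g i * (T.v i a : ℝ) = 0) ∧ torusAct g z.1 = w.1
  iseqv :=
    { refl := fun z => ⟨0, by simp, torusAct_zero _⟩
      symm := by
        rintro z w ⟨g, hg, h⟩
        refine ⟨-g, fun a => ?_, ?_⟩
        · simp [hg a]
        · rw [← h, ← torusAct_add, neg_add_cancel, torusAct_zero]
      trans := by
        rintro z w y ⟨g, hg, h⟩ ⟨g', hg', h'⟩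
        refine ⟨g' + g, fun a => ?_, ?_⟩
        · simp only [Pi.add_apply, add_mul, Finset.sum_add_distrib, hg a, hg' a, add_zero]
        · rw [torusAct_add, h, h'] }

/-- The toric Calabi-Yau manifold, as the symplectic quotient of `ℂᵐ`. -/
def X : Type := Quotient T.orbitSetoid

instance : TopologicalSpace T.X := inferInstanceAs (TopologicalSpace (Quotient T.orbitSetoid))

/-- The quotient map from the level set. -/
def proj (z : T.Level) : T.X := Quotient.mk T.orbitSetoid z

theorem continuous_proj : Continuous T.proj := continuous_quotient_mk'

/-- The moment map `μ_Δ : X → M_ℝ`, characterised by `|z i|² = ⟨μ_Δ, v i⟩ + lam i`. -/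
def momentMap : T.X → (Fin n → ℝ) :=
  Quotient.lift (fun z : T.Level => Classical.epsilon fun ν : Fin n → ℝ =>
      ∀ i, ‖z.1 i‖ ^ 2 = T.ell ν i) (by
    rintro z w ⟨g, -, h⟩
    simp only [← h, norm_torusAct])

theorem momentMap_spec (z : T.Level) (i : Fin m) :
    ‖z.1 i‖ ^ 2 = T.ell (T.momentMap (T.proj z)) i := by
  have := Classical.epsilon_spec (p := fun ν : Fin n → ℝ => ∀ i, ‖z.1 i‖ ^ 2 = T.ell ν i) z.2
  exact this i

/-- The holomorphic function `χ^u : X → ℂ`, `[z] ↦ ∏ z i`. -/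
def chi : T.X → ℂ :=
  Quotient.lift (fun z : T.Level => ∏ i, z.1 i) (by
    rintro z w ⟨g, hg, h⟩
    show ∏ i, z.1 i = ∏ i, w.1 i
    have hsum : ∑ i, g i = 0 := by
      have h1 : ∀ i, g i = ∑ a, (T.u a : ℝ) * (g i * (T.v i a : ℝ)) := fun i => by
        have := T.calabi_yau i
        have h2 : ∑ a, (T.u a : ℝ) * (T.v i a : ℝ) = 1 := by exact_mod_cast this
        calc g i = g i * ∑ a, (T.u a : ℝ) * (T.v i a : ℝ) := by rw [h2, mul_one]
          _ = _ := by rw [Finset.mul_sum]; exact Finset.sum_congr rfl fun a _ => by ring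
      rw [Finset.sum_congr rfl fun i _ => h1 i, Finset.sum_comm]
      simp only [← Finset.mul_sum, hg, mul_zero, Finset.sum_const_zero]
    rw [← h]
    simp only [torusAct, Finset.prod_mul_distrib]
    rw [← Complex.exp_sum, ← Finset.sum_mul, ← Finset.mul_sum, ← Complex.ofReal_sum, hsum]
    simp)

/-! ### The Gross fibration and the mirror moduli -/

/-- The line `ℝ u` in `M_ℝ`. -/
def uLine : Submodule ℝ (Fin n → ℝ) := Submodule.span ℝ {fun a => (T.u a : ℝ)}

/-- The base `B = M_ℝ / ℝ u × ℝ_{≥ 0}`. -/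
abbrev Base : Type := ((Fin n → ℝ) ⧸ T.uLine) × ℝ≥0

/-- The Gross fibration with parameter `e`, `x ↦ ([μ_Δ x], |χ^u x - e|²)`. -/
def gross (e : ℂ) (x : T.X) : T.Base := (T.uLine.mkQ (T.momentMap x), ‖T.chi x - e‖₊ ^ 2)

/-- The discriminant locus: the boundary of `B`, and the images of the codimension two faces
of `Δ` at height `|e|²`. -/
def discriminant (e : ℂ) : Set T.Base :=
  {b | b.2 = 0} ∪ {b | b.2 = ‖e‖₊ ^ 2 ∧
    ∃ ν ∈ T.Delta, ∃ i j, i ≠ j ∧ T.ell ν i = 0 ∧ T.ell ν j = 0 ∧ T.uLine.mkQ ν = b.1}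

/-- The fibre of the Gross fibration. -/
def fibre (e : ℂ) (b : T.Base) : Set T.X := {x | T.gross e x = b}

/-- `B₀ = B - Γ`. -/
abbrev Base₀ (e : ℂ) : Type := {b : T.Base // b ∉ T.discriminant e}

/-- The semi-flat mirror: pairs of a regular Gross fibre and an isomorphism class of flat
`U(1)`-connections on it. -/
abbrev Mirror₀ (e : ℂ) : Type := Σ b : T.Base₀ e, FlatClass (T.fibre e b.1)

end ToricCY

/-! ### Semi-flat coordinates -/

/-- The integral over the square `[0,1]²` of the pull-back by `F` of the symplectic form
`ω = (1/2π) ∑ d(r_j²) ∧ dθ_j = (1/π) ∑ dx_j ∧ dy_j` of `ℂᵐ`. If `F` takes values in the level set,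
this is the integral of the reduced form over the projection of `F` to the quotient. -/
def symplecticArea {m : ℕ} (F : ℝ → ℝ → Fin m → ℂ) : ℝ :=
  ∫ s in (0 : ℝ)..1, ∫ θ in (0 : ℝ)..1, (1 / Real.pi) *
    ∑ i, ((starRingEnd ℂ) (deriv (fun s' => F s' θ i) s) * deriv (fun θ' => F s θ' i) θ).im

namespace ToricCY

variable {n m : ℕ} (T : ToricCY n m)

/-- The basic disc of index `j` (in polar coordinates `s, θ`) bounded by the moment map fibre
through `z`: the moduli lie over the segment from a point `ν₀` of the `j`-th facet to `μ_Δ (z)`,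
so the disc meets the `j`-th toric divisor once and no other; its boundary is the `j`-th circle
orbit of `z`. -/
def basicDisc (ν₀ : Fin n → ℝ) (z : Fin m → ℂ) (j : Fin m) (s θ : ℝ) : Fin m → ℂ :=
  torusAct (Pi.single j θ)
    (fun i => (Real.sqrt (s ^ 2 + (1 - s ^ 2) * T.ell ν₀ i / ‖z i‖ ^ 2) : ℂ) * z i)

/-- Representatives of the relative classes `β_j ∈ H₂(X, L_b; ℤ)`, `j = 0, …, m - 1`, of a
regular Gross fibre `L_b`. One starts with the basic discs of a moment map fibre, that is, of a
fibre of the Gross fibration with parameter `0`, and moves their boundaries along a common path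
of regular fibres of the Gross fibrations with parameters `t(s) e`, `t` running from `0` to `1`.
`β_j` is the basic disc of index `j` together with the cylinder swept out by its boundary, all
of it given by smooth lifts to the level set. -/
structure DiscClasses (e : ℂ) (b : T.Base) where
  t : ℝ → ℝ
  path : ℝ → T.Base
  t_cont : ContinuousOn t (Set.Icc 0 1)
  path_cont : ContinuousOn path (Set.Icc 0 1)
  t_mem : ∀ s ∈ Set.Icc (0 : ℝ) 1, t s ∈ Set.Icc (0 : ℝ) 1
  t_zero : t 0 = 0
  t_one : t 1 = 1
  path_one : path 1 = b
  regular : ∀ s ∈ Set.Icc (0 : ℝ) 1, path s ∉ T.discriminant (t s * e)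
  /-- A point of the `j`-th facet. -/
  ν₀ : Fin m → Fin n → ℝ
  ν₀_facet : ∀ j, T.ell (ν₀ j) j = 0 ∧ ∀ i, i ≠ j → 0 < T.ell (ν₀ j) i
  /-- A point of the moment map fibre at which the boundary of the `j`-th disc starts. -/
  z₀ : Fin m → Fin m → ℂ
  /-- The cylinders. -/
  cyl : Fin m → ℝ → ℝ → Fin m → ℂ
  cyl_smooth : ∀ j, ContDiffOn ℝ ∞ (fun p : ℝ × ℝ => cyl j p.1 p.2) (Set.Icc 0 1 ×ˢ Set.univ)
  cyl_periodic : ∀ j, ∀ s ∈ Set.Icc (0 : ℝ) 1, ∀ θ, cyl j s (θ + 1) = cyl j s θ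
  cyl_zero : ∀ j θ, cyl j 0 θ = torusAct (Pi.single j θ) (z₀ j)
  cyl_level : ∀ j, ∀ s ∈ Set.Icc (0 : ℝ) 1, ∀ θ, cyl j s θ ∈ T.Level
  cyl_fibre : ∀ j, ∀ s, ∀ hs : s ∈ Set.Icc (0 : ℝ) 1, ∀ θ,
    T.proj ⟨cyl j s θ, cyl_level j s hs θ⟩ ∈ T.fibre (t s * e) (path s)

namespace DiscClasses

variable {T} {e : ℂ} {b : T.Base} (β : T.DiscClasses e b)

/-- `∫_{β_j} ω`. -/
def area (j : Fin m) : ℝ :=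
  symplecticArea (T.basicDisc (β.ν₀ j) (β.z₀ j) j) + symplecticArea (β.cyl j)

/-- The points of the boundary of `β_j`. -/
def bdryPt (j : Fin m) (θ : ℝ) : T.fibre e b :=
  ⟨T.proj ⟨β.cyl j 1 θ, β.cyl_level j 1 (Set.right_mem_Icc.2 zero_le_one) θ⟩, by
    have h := β.cyl_fibre j 1 (Set.right_mem_Icc.2 zero_le_one) θ
    rwa [β.t_one, Complex.ofReal_one, one_mul, β.path_one] at h⟩

theorem continuous_bdryPt (j : Fin m) : Continuous (β.bdryPt j) := by
  refine Continuous.subtype_mk (T.continuous_proj.comp (Continuous.subtype_mk ?_ _)) _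
  exact (β.cyl_smooth j).continuousOn.comp_continuous (f := fun θ : ℝ => ((1 : ℝ), θ))
    (by fun_prop) (fun θ => ⟨Set.right_mem_Icc.2 zero_le_one, Set.mem_univ _⟩)

/-- The loop `∂β_j` in the Gross fibre. -/
def bdry (j : Fin m) : Path (β.bdryPt j 0) (β.bdryPt j 0) where
  toFun τ := β.bdryPt j τ
  continuous_toFun := (β.continuous_bdryPt j).comp continuous_subtype_val
  source' := rfl
  target' := by
    have h := β.cyl_periodic j 1 (Set.right_mem_Icc.2 zero_le_one) 0
    rw [zero_add] at h
    exact Subtype.ext (congrArg T.proj (Subtype.ext h))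

/-- The semi-flat coordinate `Z_{β_j}(L_b, ∇) = exp (- ∫_{β_j} ω) Hol_∇ (∂β_j)`. -/
def Z (j : Fin m) (A : FlatClass (T.fibre e b)) : ℂ :=
  (Real.exp (-β.area j) : ℂ) * (A.hol (β.bdry j) : ℂ)

end DiscClasses

end ToricCY

/-! ### A-branes and their semi-flat mirrors -/

/-- The charges and the constants which define a special Lagrangian in `ℂᵐ`. -/
structure Charges (m k k' : ℕ) where
  l : Fin k → Fin m → ℤ
  lperp : Fin k' → Fin m → ℤ
  c : Fin k → ℝ
  phase : Fin k' → ℝ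
  card_eq : k + k' = m
  indep : LinearIndependent ℤ l
  indep_perp : LinearIndependent ℤ lperp
  orth : ∀ a b, ∑ j, l a j * lperp b j = 0
  /-- The Lagrangian is special. -/
  special : ∀ a, ∑ j, l a j = 0

namespace Charges

variable {m k k' : ℕ} (C : Charges m k k')

/-- The angles allowed in the Lagrangian. -/
def angles : Set (Fin m → ℝ) := {θ | ∀ b, ∑ j, (C.lperp b j : ℝ) * θ j = C.phase b}

/-- The Lagrangian in `ℂᵐ`. -/
def lagTilde : Set (Fin m → ℂ) :=
  {z | (∀ a, ∑ j, (C.l a j : ℝ) * ‖z j‖ ^ 2 = C.c a) ∧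
    ∃ θ ∈ C.angles, ∀ j, z j = ‖z j‖ * Complex.exp (θ j * Complex.I)}

end Charges

namespace ToricCY

variable {n m k k' : ℕ} (T : ToricCY n m) (C : Charges m k k')

/-- The Lagrangian `L ⊆ X`. -/
def lag : Set T.X := T.proj '' {z | z.1 ∈ C.lagTilde}

/-- `β : ℤᵐ → N`. -/
def beta (l : Fin m → ℤ) : Fin n → ℤ := fun a => ∑ i, l i * T.v i a

/-- `p` is the loop `β(l)` through `[z]`, the orbit of `[z]` under the circle of direction `l`. -/
def IsOrbitLoop (l : Fin m → ℤ) (z : T.Level) {S : Set T.X} {x : S} (p : Path x x) : Prop :=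
  ∀ τ : unitInterval, (p τ : T.X) =
    T.proj ⟨torusAct (fun i => (τ : ℝ) * (l i : ℝ)) z.1, T.torusAct_mem _ z.2⟩

/-- The fibrewise SYZ dual at `b`: the `(L_G, ∇)` with `L_G` the Gross fibre over `b` such that
`∇` twisted by `∇_L` is trivial when restricted to `L ∩ L_G`. -/
def fibreDual (e : ℂ) (S : Set T.X) (A : FlatClass S) (b : T.Base) : Set (T.Mirror₀ e) :=
  {P | P.1.1 = b ∧
    (P.2.pullback (ContinuousMap.inclusion
        (Set.inter_subset_right : S ∩ T.fibre e P.1.1 ⊆ T.fibre e P.1.1))).twist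
      (A.pullback (ContinuousMap.inclusion
        (Set.inter_subset_left : S ∩ T.fibre e P.1.1 ⊆ S))) =
      FlatClass.triv _}

/-- The semi-flat mirror brane of `(S, A)`: the fibrewise duals glued over the image of `S` under
the Gross fibration. -/
def semiFlatBrane (e : ℂ) (S : Set T.X) (A : FlatClass S) : Set (T.Mirror₀ e) :=
  ⋃ b ∈ T.gross e '' S, T.fibreDual e S A b

end ToricCY

end

/-! Fix `ν` over a regular value `b` and an index `i` minimising `T.ell ν`. A point of the preimage
of the fibre in the level set is determined by `χ` on the circle `|χ - ε|² = b₂` and by the phases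
of the coordinates other than the `i`-th. Indeed the square moduli are `T.ell ν k + h`, where `h`
(`height`) depends only on `|χ|`; regularity forces `z k ≠ 0` for `k ≠ i`; and `z i` is recovered
from the product. So the fibre is the image of a vector space whose integral vectors are periods
(`cover`), and holonomies can be read off from winding numbers.

The loops `∂β_j` depend on the chosen path, but only through integers `c k` common to all `j`: the
coordinate `z k`, `k ≠ i`, winds `δ_{jk} + c k` times along `∂β_j` (`windingsAt`). This survives a
change of `i` because `χ - tε` winds once along every cylinder, so that `χ`, where it has no zero,
winds equally often along all of them. By Stokes the area of `β_j` is the Liouville integral of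
`∂β_j` (`area_eq`), that is, `∑ (ell k - ell i) * winding k` plus a term that does not depend on `j`
(`integral_liouville`). Since `∑ l j = 0`, everything independent of `j` cancels: the product of the
holonomies with exponents `l j` is the holonomy along the orbit loop `β(l)` (`prod_hol_bdry`), and
the areas combine to `∑ l j * ell ν j` (`sum_area`).

Hence the modulus of each mirror equation says `∑ l j * ell ν j = c`, and together these say that
`L` meets the fibre (`sum_ell_of_mem_lag`, `exists_mem_lag`). The phases say that the twisted
connection has trivial holonomy along the orbit loops. These loops suffice
(`tr_eq_one_of_orbitLoop`): `ε` has the phase of `χ` on `L`, so `χ` takes at most two values on `L ∩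
L_G`; points with equal `χ` lie in one torus orbit; and primitivity lets paths in an orbit lift and
makes closed ones combinations of the orbit loops.

The classes exist because a path with `b₂` constant can be chosen to cross the wall `b₂ = |tε|²`
over the relative interior of a facet (`exists_isWallIndex`); explicit formulas then give the
cylinders. -/

noncomputable section

/-! ### Holonomy of flat connections and pull-back to vector spaces -/

namespace FlatU1
variable {Y : Type*} [TopologicalSpace Y]

theorem tr_congr (A : FlatU1 Y) {x y x' y' : Y} (p : Path x y) (p' : Path x' y')
    (h : ∀ t, p t = p' t) : A.tr p = A.tr p' := by
  obtain rfl : x = x' := by simpa using h 0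
  obtain rfl : y = y' := by simpa using h 1
  congr 1
  exact Path.ext (funext h)

theorem tr_refl (A : FlatU1 Y) (x : Y) : A.tr (Path.refl x) = 1 := by
  have h := A.tr_trans (Path.refl x) (Path.refl x)
  rw [Path.refl_trans_refl] at h
  exact left_eq_mul.1 h

theorem tr_const (A : FlatU1 Y) {x y : Y} (p : Path x y) (h : ∀ t, p t = x) : A.tr p = 1 := by
  rw [← A.tr_refl x]
  exact A.tr_congr _ _ h

theorem tr_symm (A : FlatU1 Y) {x y : Y} (p : Path x y) : A.tr p.symm = (A.tr p)⁻¹ := by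
  rw [eq_inv_iff_mul_eq_one, ← A.tr_trans, ← A.tr_refl y]
  exact A.tr_homotopic _ _ ⟨(Path.Homotopy.reflSymmTrans p).symm⟩

/-- With trivial holonomy, parallel transport from a base point chosen in each path component is
independent of the path and serves as the gauge transformation. No connectedness of `Y` is needed,
which matters since `L ∩ L_G` may have two components. -/
theorem mk_eq_triv_iff (A : FlatU1 Y) :
    (Quotient.mk (FlatU1.setoid Y) A : FlatClass Y) = FlatClass.triv Y ↔
      ∀ (x : Y) (p : Path x x), A.tr p = 1 := by
  rw [FlatClass.triv, Quotient.eq]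
  constructor
  · rintro ⟨g, hg⟩ x p
    have := hg x x p
    rw [mul_comm (g x), mul_inv_cancel_right] at this
    exact this.symm
  · intro h
    let base : Y → Y := fun x => (Quotient.mk (pathSetoid Y) x).out
    have hb : ∀ x, Joined (base x) x := fun x => Quotient.exact (Quotient.out_eq (Quotient.mk (pathSetoid Y) x))
    have hbb : ∀ x y, Joined x y → base x = base y := fun x y hxy => by
      have : (Quotient.mk (pathSetoid Y) x) = Quotient.mk (pathSetoid Y) y := Quotient.sound hxy
      simp only [base, this]
    let g : Y → Circle := fun x => A.tr (hb x).somePath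
    refine ⟨fun x => g x, fun x y p => ?_⟩
    have h1 := h (base x) ((((hb x).somePath.trans p).trans
      ((hb y).somePath.symm)).cast rfl (hbb x y ⟨p⟩))
    have h2 : A.tr ((((hb x).somePath.trans p).trans
      ((hb y).somePath.symm)).cast rfl (hbb x y ⟨p⟩)) = A.tr (((hb x).somePath.trans p).trans
      ((hb y).somePath.symm)) := A.tr_congr _ _ fun t => rfl
    rw [h2, A.tr_trans, A.tr_trans, A.tr_symm] at h1
    exact h1.symm

section Pullback
variable {E : Type*} [AddCommGroup E] [Module ℝ E] [TopologicalSpace E] [IsTopologicalAddGroup E]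
  [ContinuousSMul ℝ E]

/-- The straight path between two points. -/
def segPath (x y : E) : Path x y where
  toFun t := x + (t : ℝ) • (y - x)
  continuous_toFun := by fun_prop
  source' := by simp
  target' := by simp

theorem segPath_apply (x y : E) (t : unitInterval) : segPath x y t = x + (t : ℝ) • (y - x) := rfl

/-- Two paths in a vector space with the same end points are homotopic. -/
theorem homotopic_of_vectorSpace {x y : E} (p q : Path x y) : p.Homotopic q :=
  haveI : ContractibleSpace E := inferInstance
  SimplyConnectedSpace.paths_homotopic p q

/-- The frame of the pull-back of a flat connection to a vector space which is parallel along the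
straight lines from the origin. -/
def frame (A : FlatU1 Y) (f : C(E, Y)) (x : E) : Circle :=
  A.tr ((segPath 0 x).map f.continuous)

theorem frame_zero (A : FlatU1 Y) (f : C(E, Y)) : A.frame f 0 = 1 :=
  A.tr_const _ fun t => by simp [segPath_apply]

theorem frame_mul_tr_map (A : FlatU1 Y) (f : C(E, Y)) {x y : E} (q : Path x y) :
    A.frame f x * A.tr (q.map f.continuous) = A.frame f y := by
  rw [frame, frame, ← A.tr_trans, ← Path.map_trans]
  exact A.tr_homotopic _ _ ((homotopic_of_vectorSpace _ _).map f)

theorem tr_eq_frame (A : FlatU1 Y) (f : C(E, Y)) {x y : E} (q : Path x y) {x' y' : Y}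
    (p : Path x' y') (h : ∀ t, p t = f (q t)) : A.tr p = A.frame f y * (A.frame f x)⁻¹ := by
  rw [← A.frame_mul_tr_map f q, mul_comm (A.frame f x), mul_inv_cancel_right]
  exact A.tr_congr _ _ h

/-- The segment from `w` to `x + w` has the same image as the one from `0` to `x`. Hence the frame
is a character on the periods of `f`, and the holonomy of a closed image path is the value at the
period by which its lift moves. -/
theorem frame_add_period (A : FlatU1 Y) (f : C(E, Y)) {w : E} (hw : ∀ x, f (x + w) = f x) (x : E) :
    A.frame f (x + w) = A.frame f x * A.frame f w := by
  have h := A.frame_mul_tr_map f (segPath w (x + w))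
  rw [← h, mul_comm, frame, frame]
  congr 1
  refine A.tr_congr _ _ fun t => ?_
  simp only [Path.map_coe, Function.comp_apply, segPath_apply]
  rw [← hw (0 + (t : ℝ) • (x - 0))]
  congr 1
  simp [add_comm]

/-- The subgroup of periods of a map. -/
def periods (f : C(E, Y)) : AddSubgroup E where
  carrier := {w | ∀ x, f (x + w) = f x}
  add_mem' := fun {a b} ha hb x => by rw [← add_assoc, hb, ha]
  zero_mem' := by simp
  neg_mem' := fun {a} ha x => by rw [← ha (x + -a)]; simp

/-- The holonomy of a flat connection on the periods of a map. -/
def periodHom (A : FlatU1 Y) (f : C(E, Y)) : Multiplicative (periods f) →* Circle where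
  toFun w := A.frame f (Multiplicative.toAdd w : periods f)
  map_one' := A.frame_zero f
  map_mul' _ w' := A.frame_add_period f (Multiplicative.toAdd w').2 _

theorem frame_sum_zsmul (A : FlatU1 Y) (f : C(E, Y)) {ι : Type*} (s : Finset ι) (w : ι → E) (d : ι → ℤ)
    (hw : ∀ i ∈ s, w i ∈ periods f) :
    A.frame f (∑ i ∈ s, d i • w i) = ∏ i ∈ s, A.frame f (w i) ^ d i := by
  classical
  induction s using Finset.induction_on with
  | empty => simp [frame_zero]
  | insert a s ha ih =>
    rw [Finset.sum_insert ha, Finset.prod_insert ha]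
    have h1 := hw a (Finset.mem_insert_self a s)
    have h2 : ∀ i ∈ s, w i ∈ periods f := fun i hi => hw i (Finset.mem_insert_of_mem hi)
    rw [A.frame_add_period f ((periods f).sum_mem fun i hi => (periods f).zsmul_mem (h2 i hi) (d i)),
      ih h2]
    congr 1
    exact map_zpow (A.periodHom f) (Multiplicative.ofAdd ⟨w a, h1⟩) (d a)

end Pullback
end FlatU1

/-! ### The height function -/

/-- The product is strictly increasing in `h` as long as all factors are nonnegative, even from a
point where some factor vanishes. -/
theorem height_unique {m : ℕ} (a : Fin m → ℝ) {h h' : ℝ} [NeZero m]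
    (hh : ∀ k, 0 ≤ a k + h) (hh' : ∀ k, 0 ≤ a k + h') (he : ∏ k, (a k + h) = ∏ k, (a k + h')) :
    h = h' := by
  have key : ∀ {h h' : ℝ}, (∀ k, 0 ≤ a k + h) → h < h' → ∏ k, (a k + h) < ∏ k, (a k + h') := by
    intro h h' hh hlt
    by_cases h0 : ∃ k, a k + h = 0
    · obtain ⟨k, hk⟩ := h0
      rw [Finset.prod_eq_zero (Finset.mem_univ k) hk]
      exact Finset.prod_pos fun j _ => by linarith [hh j]
    · push Not at h0
      exact Finset.prod_lt_prod_of_nonempty (fun j _ => lt_of_le_of_ne (hh j) (h0 j).symm)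
        (fun j _ => by linarith) Finset.univ_nonempty
  rcases lt_trichotomy h h' with hlt | rfl | hlt
  · exact absurd he (key hh hlt).ne
  · rfl
  · exact absurd he (key hh' hlt).ne'

theorem exists_height {m : ℕ} [NeZero m] (a : Fin m → ℝ) {q : ℝ} (hq : 0 ≤ q) :
    ∃ h, (∀ k, 0 ≤ a k + h) ∧ ∏ k, (a k + h) = q := by
  obtain ⟨i, -, hi⟩ := Finset.exists_min_image Finset.univ a Finset.univ_nonempty
  have hm : 1 ≤ m := Nat.one_le_iff_ne_zero.2 (NeZero.ne m)
  have hcont : ContinuousOn (fun h : ℝ => ∏ k, (a k + h)) (Set.Icc (-a i) (-a i + (q + 1))) := by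
    fun_prop
  -- At `h = -min a` the product is `0`; at `h = -min a + q + 1` every factor is at least `q + 1`,
  -- so the product is at least `q`.
  have hmem : q ∈ Set.Icc (∏ k, (a k + -a i)) (∏ k, (a k + (-a i + (q + 1)))) := by
    constructor
    · rw [Finset.prod_eq_zero (Finset.mem_univ i) (by simp)]
      exact hq
    · calc q ≤ (q + 1) ^ 1 := by linarith
        _ ≤ (q + 1) ^ m := pow_le_pow_right₀ (by linarith) hm
        _ = ∏ _k : Fin m, (q + 1) := by simp
        _ ≤ _ := Finset.prod_le_prod (fun _ _ => by linarith) fun k _ => by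
          linarith [hi k (Finset.mem_univ k)]
  obtain ⟨h, hh, he⟩ := intermediate_value_Icc (by linarith) hcont hmem
  exact ⟨h, fun k => by linarith [hh.1, hi k (Finset.mem_univ k)], he⟩

/-- The number `h` with `a k + h ≥ 0` for all `k` and `∏ (a k + h) = q`. -/
def height {m : ℕ} (a : Fin m → ℝ) (q : ℝ) : ℝ :=
  Classical.epsilon fun h => (∀ k, 0 ≤ a k + h) ∧ ∏ k, (a k + h) = q

section
variable {m : ℕ} [NeZero m] (a : Fin m → ℝ) {q : ℝ}

theorem height_nonneg (hq : 0 ≤ q) (k : Fin m) : 0 ≤ a k + height a q :=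
  (Classical.epsilon_spec (p := fun h => (∀ k, 0 ≤ a k + h) ∧ ∏ k, (a k + h) = q)
    (exists_height a hq)).1 k

theorem prod_height (hq : 0 ≤ q) : ∏ k, (a k + height a q) = q :=
  (Classical.epsilon_spec (p := fun h => (∀ k, 0 ≤ a k + h) ∧ ∏ k, (a k + h) = q)
    (exists_height a hq)).2

theorem eq_height {h : ℝ} (hh : ∀ k, 0 ≤ a k + h) (he : ∏ k, (a k + h) = q) : h = height a q := by
  have hq : 0 ≤ q := he ▸ Finset.prod_nonneg fun k _ => hh k
  exact height_unique a hh (height_nonneg a hq) (he.trans (prod_height a hq).symm)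

/-- Implicit function theorem for `∏ (a k + h) = q`. The `h`-derivative is the sum of the products
with one factor omitted, and the one that omits the `i`-th factor is positive. The `i`-th factor
itself may vanish, so smoothness holds across the walls too. -/
theorem contDiffAt_height_comp {E : Type*} [NormedAddCommGroup E] [NormedSpace ℝ E]
    {a : E → Fin m → ℝ} {q : E → ℝ} {x : E} (ha : ContDiffAt ℝ ∞ a x) (hq : ContDiffAt ℝ ∞ q x)
    (hq0 : ∀ y, 0 ≤ q y) {i : Fin m} (hpos : ∀ k, k ≠ i → 0 < a x k + height (a x) (q x)) :
    ContDiffAt ℝ ∞ (fun y => height (a y) (q y)) x := by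
  let F : ((Fin m → ℝ) × ℝ) × ℝ → ℝ := fun p => ∏ k, (p.1.1 k + p.2) - p.1.2
  let u : ((Fin m → ℝ) × ℝ) × ℝ := ((a x, q x), height (a x) (q x))
  have hF : ContDiffAt ℝ ∞ F u := by
    refine ContDiffAt.sub (contDiffAt_prod fun k _ => ?_) (by fun_prop)
    exact ((contDiffAt_apply (𝕜 := ℝ) (E := ℝ) k u.1.1).comp u
      (contDiffAt_fst.comp u contDiffAt_fst)).add contDiffAt_snd
  have hFu : F u = 0 := by simp [F, u, prod_height (a x) (hq0 x)]
  have hFd : HasFDerivAt F (fderiv ℝ F u) u :=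
    (hF.differentiableAt (by simp)).hasFDerivAt
  have hder : HasDerivAt (fun h => ∏ k, (a x k + h))
      (∑ k, ∏ j ∈ Finset.univ.erase k, (a x j + height (a x) (q x))) (height (a x) (q x)) := by
    have := HasDerivAt.fun_finsetProd (u := Finset.univ) (f := fun k h => a x k + h)
      (f' := fun _ => 1) (x := height (a x) (q x)) fun k _ => by
        simpa using (hasDerivAt_id (height (a x) (q x))).const_add (a x k)
    simpa using this
  have hval : fderiv ℝ F u (0, 1) =
      ∑ k, ∏ j ∈ Finset.univ.erase k, (a x j + height (a x) (q x)) := by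
    have h1 : HasDerivAt (fun h : ℝ => (((a x, q x), h) : ((Fin m → ℝ) × ℝ) × ℝ)) (0, 1)
        (height (a x) (q x)) := (hasDerivAt_const _ _).prodMk (hasDerivAt_id _)
    have h2 := HasFDerivAt.comp_hasDerivAt (height (a x) (q x)) hFd h1
    have h3 : HasDerivAt (F ∘ fun h : ℝ => (((a x, q x), h) : ((Fin m → ℝ) × ℝ) × ℝ))
        (∑ k, ∏ j ∈ Finset.univ.erase k, (a x j + height (a x) (q x))) (height (a x) (q x)) :=
      hder.sub_const (q x)
    exact h2.unique h3
  have hne : fderiv ℝ F u (0, 1) ≠ 0 := by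
    rw [hval]
    refine ne_of_gt (Finset.sum_pos' (fun k _ => Finset.prod_nonneg fun j _ =>
      height_nonneg _ (hq0 x) j) ⟨i, Finset.mem_univ i, Finset.prod_pos fun j hj => ?_⟩)
    exact hpos j (Finset.ne_of_mem_erase hj)
  have hinv : (fderiv ℝ F u ∘L .inr ℝ ((Fin m → ℝ) × ℝ) ℝ).IsInvertible := by
    refine ⟨ContinuousLinearEquiv.unitsEquivAut ℝ (Units.mk0 _ hne), ?_⟩
    ext
    simp
  have hpn : (∞ : WithTop ℕ∞) ≠ 0 := by simp
  let H := hF.implicitFunction hpn hinv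
  have hH : ContDiffAt ℝ ∞ H u.1 := hF.contDiffAt_implicitFunction hpn hinv
  have hH0 : H u.1 = height (a x) (q x) := hF.implicitFunction_apply_self hpn hinv
  have hHe := hF.eventually_apply_implicitFunction hpn hinv
  have hpair : ContDiffAt ℝ ∞ (fun y => (a y, q y)) x := ha.prodMk hq
  have hcomp : ContDiffAt ℝ ∞ (fun y => H (a y, q y)) x := ContDiffAt.comp x hH hpair
  refine hcomp.congr_of_eventuallyEq ?_
  have e1 : ∀ᶠ y in nhds x, F ((a y, q y), H (a y, q y)) = 0 := by
    have := hpair.continuousAt.eventually hHe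
    simpa only [hFu] using this
  have e2 : ∀ᶠ y in nhds x, ∀ k, k ≠ i → 0 < a y k + H (a y, q y) := by
    rw [Filter.eventually_all]
    intro k
    by_cases hk : k = i
    · simp [hk]
    have hc : ContinuousAt (fun y => a y k + H (a y, q y)) x :=
      ((continuous_apply k).continuousAt.comp ha.continuousAt).add hcomp.continuousAt
    have : 0 < a x k + H (a x, q x) := by
      rw [show H (a x, q x) = _ from hH0]; exact hpos k hk
    filter_upwards [hc.eventually (lt_mem_nhds this)] with y hy _ using hy
  filter_upwards [e1, e2] with y h1 h2
  have h1' : ∏ k, (a y k + H (a y, q y)) = q y := sub_eq_zero.1 h1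
  refine (eq_height (a y) (fun k => ?_) h1').symm
  -- The implicit solution must still be shown to be the height. The other factors stay positive
  -- nearby, and the `i`-th one is nonnegative because the whole product is `q y ≥ 0`.
  by_cases hk : k = i
  · subst hk
    have hprod := Finset.mul_prod_erase Finset.univ (fun k => a y k + H (a y, q y)) (Finset.mem_univ k)
    have hprod' := hprod.trans h1'
    have hp : 0 < ∏ j ∈ Finset.univ.erase k, (a y j + H (a y, q y)) :=
      Finset.prod_pos fun j hj => h2 j (Finset.ne_of_mem_erase hj)
    exact nonneg_of_mul_nonneg_left (le_of_le_of_eq (hq0 y) hprod'.symm) hp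
  · exact (h2 k hk).le

end

/-! ### Winding numbers -/

theorem exp_two_pi_int (d : ℤ) : Complex.exp (2 * Real.pi * (d : ℝ) * Complex.I) = 1 :=
  Complex.exp_eq_one_iff.2 ⟨d, by push_cast; ring⟩

theorem norm_exp_two_pi (x : ℝ) : ‖Complex.exp (2 * Real.pi * x * Complex.I)‖ = 1 := by
  have h : (2 * Real.pi * x * Complex.I : ℂ) = ((2 * Real.pi * x : ℝ) : ℂ) * Complex.I := by
    push_cast; ring
  rw [h, Complex.norm_exp_ofReal_mul_I]

theorem exists_eq_norm_mul_exp (z : ℂ) :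
    ∃ x : ℝ, z = ‖z‖ * Complex.exp (2 * Real.pi * x * Complex.I) := by
  refine ⟨z.arg / (2 * Real.pi), ?_⟩
  conv_lhs => rw [← Complex.norm_mul_exp_arg_mul_I z]
  congr 3
  push_cast
  field_simp

/-- `x` is a continuous choice of the argument of `f` in units of `2 π`, and increases by `w` over
a period of `f`. -/
def IsArgLift (f : ℝ → ℂ) (x : ℝ → ℝ) (w : ℤ) : Prop :=
  Continuous x ∧ (∀ θ, f θ = ‖f θ‖ * Complex.exp (2 * Real.pi * x θ * Complex.I)) ∧
    ∀ θ, x (θ + 1) = x θ + w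

/-- The loop `f : ℝ / ℤ → ℂ` has winding number `w` around the origin. -/
def HasWinding (f : ℝ → ℂ) (w : ℤ) : Prop := ∃ x, IsArgLift f x w

theorem hasWinding_exp_mul (z : ℂ) (w : ℤ) :
    HasWinding (fun θ => Complex.exp (2 * Real.pi * (w * θ : ℝ) * Complex.I) * z) w := by
  obtain ⟨x, hx⟩ := exists_eq_norm_mul_exp z
  refine ⟨fun θ => w * θ + x, by fun_prop, fun θ => ?_, fun θ => by ring⟩
  rw [norm_mul, norm_exp_two_pi, one_mul]
  beta_reduce
  conv_lhs => rw [hx]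
  rw [mul_left_comm, ← Complex.exp_add]
  congr 2
  push_cast; ring

theorem HasWinding.mul {f g : ℝ → ℂ} {w w' : ℤ} (hf : HasWinding f w) (hg : HasWinding g w') :
    HasWinding (fun θ => f θ * g θ) (w + w') := by
  obtain ⟨x, hx, hfx, hxw⟩ := hf
  obtain ⟨y, hy, hgy, hyw⟩ := hg
  refine ⟨fun θ => x θ + y θ, hx.add hy, fun θ => ?_, fun θ => ?_⟩
  · rw [norm_mul]
    beta_reduce
    conv_lhs => rw [hfx, hgy]
    rw [mul_mul_mul_comm, ← Complex.exp_add]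
    push_cast
    congr 2
    ring
  · beta_reduce; rw [hxw, hyw]; push_cast; ring

theorem HasWinding.prod {ι : Type*} (s : Finset ι) {f : ι → ℝ → ℂ} {w : ι → ℤ}
    (hf : ∀ i ∈ s, HasWinding (f i) (w i)) :
    HasWinding (fun θ => ∏ i ∈ s, f i θ) (∑ i ∈ s, w i) := by
  classical
  induction s using Finset.induction_on with
  | empty => exact ⟨fun _ => 0, continuous_const, by simp, by simp⟩
  | insert a s ha ih =>
    simp only [Finset.prod_insert ha, Finset.sum_insert ha]
    exact (hf a (Finset.mem_insert_self a s)).mul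
      (ih fun i hi => hf i (Finset.mem_insert_of_mem hi))

theorem HasWinding.inv {f : ℝ → ℂ} {w : ℤ} (hf : HasWinding f w) :
    HasWinding (fun θ => (f θ)⁻¹) (-w) := by
  obtain ⟨x, hx, hfx, hxw⟩ := hf
  refine ⟨fun θ => -x θ, hx.neg, fun θ => ?_, fun θ => ?_⟩
  · beta_reduce
    conv_lhs => rw [hfx]
    rw [norm_inv, mul_inv, ← Complex.exp_neg]
    push_cast
    congr 2
    ring
  · beta_reduce; rw [hxw]; push_cast; ring

theorem HasWinding.of_mul_eq {f g h : ℝ → ℂ} {w w' : ℤ} (hh : HasWinding h w)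
    (hg : HasWinding g w') (hg0 : ∀ θ, g θ ≠ 0) (he : ∀ θ, f θ * g θ = h θ) :
    HasWinding f (w - w') := by
  have := hh.mul hg.inv
  rw [← sub_eq_add_neg] at this
  convert this using 2 with θ
  rw [← he, mul_assoc, mul_inv_cancel₀ (hg0 θ), mul_one]

theorem hasWinding_zero_of_re_pos {f : ℝ → ℂ} (hf : Continuous f) (hp : ∀ θ, f (θ + 1) = f θ)
    (hre : ∀ θ, 0 < (f θ).re) : HasWinding f 0 := by
  refine ⟨fun θ => (f θ).arg / (2 * Real.pi), ?_, fun θ => ?_, fun θ => by simp [hp]⟩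
  · refine Continuous.div_const (continuous_iff_continuousAt.2 fun θ => ?_) _
    exact (Complex.continuousAt_arg (Or.inl (hre θ))).comp hf.continuousAt
  · conv_lhs => rw [← Complex.norm_mul_exp_arg_mul_I (f θ)]
    congr 3
    push_cast
    field_simp

/-- Rouché's argument: `g / f` stays in the disc of radius `1` around `1`, hence in the right half
plane, and has winding number `0`. -/
theorem hasWinding_iff_of_close {f g : ℝ → ℂ} (hf : Continuous f) (hg : Continuous g)
    (hfp : ∀ θ, f (θ + 1) = f θ) (hgp : ∀ θ, g (θ + 1) = g θ)
    (hc : ∀ θ, ‖g θ - f θ‖ < ‖f θ‖) (w : ℤ) : HasWinding g w ↔ HasWinding f w := by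
  have hf0 : ∀ θ, f θ ≠ 0 := fun θ h => by
    have := hc θ
    rw [h, norm_zero] at this
    exact absurd this (norm_nonneg _).not_gt
  have hq : HasWinding (fun θ => g θ / f θ) 0 := by
    refine hasWinding_zero_of_re_pos (hg.div hf hf0) (fun θ => by rw [hfp, hgp]) fun θ => ?_
    have h1 : ‖g θ / f θ - 1‖ < 1 := by
      rw [div_sub_one (hf0 θ), norm_div, div_lt_one (norm_pos_iff.2 (hf0 θ))]
      exact hc θ
    have h2 := (Complex.abs_re_le_norm _).trans_lt h1
    have h3 := (abs_lt.1 h2).1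
    simp only [Complex.sub_re, Complex.one_re] at h3
    linarith
  have hg0 : ∀ θ, g θ ≠ 0 := fun θ h => by
    have := hc θ
    rw [h, zero_sub, norm_neg] at this
    exact lt_irrefl _ this
  constructor
  · intro h
    simpa using h.of_mul_eq hq (fun θ => div_ne_zero (hg0 θ) (hf0 θ))
      (fun θ => mul_div_cancel₀ (g θ) (hf0 θ))
  · intro h
    have := h.mul hq
    rw [add_zero] at this
    convert this using 2 with θ
    rw [mul_div_cancel₀ (g θ) (hf0 θ)]

theorem eventually_hasWinding_iff {S : Type*} [TopologicalSpace S] {f : S → ℝ → ℂ}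
    (hf : Continuous fun p : S × ℝ => f p.1 p.2) (hp : ∀ s θ, f s (θ + 1) = f s θ) (s₀ : S)
    (h0 : ∀ θ, f s₀ θ ≠ 0) :
    ∀ᶠ s in nhds s₀, (∀ θ, f s θ ≠ 0) ∧ ∀ w, HasWinding (f s) w ↔ HasWinding (f s₀) w := by
  have h1 : ∀ᶠ s in nhds s₀, ∀ θ ∈ Set.Icc (0 : ℝ) 1, ‖f s θ - f s₀ θ‖ < ‖f s₀ θ‖ := by
    refine isCompact_Icc.eventually_forall_of_forall_eventually fun θ _ => ?_
    have hl : Continuous fun p : S × ℝ => ‖f p.1 p.2 - f s₀ p.2‖ := by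
      have : Continuous fun p : S × ℝ => f s₀ p.2 := hf.comp (continuous_const.prodMk continuous_snd)
      exact (hf.sub this).norm
    have hr : Continuous fun p : S × ℝ => ‖f s₀ p.2‖ :=
      (hf.comp (continuous_const.prodMk continuous_snd)).norm
    exact hl.continuousAt.eventually_lt hr.continuousAt (by simpa using h0 θ)
  -- Periodicity extends the estimate from the compact interval, where it is uniform in `s`, to all
  -- of `ℝ`.
  have hfract : ∀ s θ, f s θ = f s (Int.fract θ) := fun s θ => by
    have : Function.Periodic (f s) 1 := hp s
    exact (this.sub_int_mul_eq ⌊θ⌋).symm.trans (by rw [mul_one]; rfl)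
  filter_upwards [h1] with s hs
  have hs' : ∀ θ, ‖f s θ - f s₀ θ‖ < ‖f s₀ θ‖ := fun θ => by
    rw [hfract s, hfract s₀]
    exact hs _ ⟨Int.fract_nonneg θ, (Int.fract_lt_one θ).le⟩
  refine ⟨fun θ h => ?_, hasWinding_iff_of_close (hf.comp (continuous_const.prodMk continuous_id))
    (hf.comp (continuous_const.prodMk continuous_id)) (hp s₀) (hp s) hs'⟩
  have := hs' θ
  rw [h, zero_sub, norm_neg] at this
  exact lt_irrefl _ this

/-- A nonvanishing family of loops over a connected space has constant winding number. -/
theorem HasWinding.of_connected {S : Type*} [TopologicalSpace S] [PreconnectedSpace S]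
    {f : S → ℝ → ℂ} (hf : Continuous fun p : S × ℝ => f p.1 p.2)
    (hp : ∀ s θ, f s (θ + 1) = f s θ) (h0 : ∀ s θ, f s θ ≠ 0) {s₀ s : S} {w : ℤ}
    (h : HasWinding (f s₀) w) : HasWinding (f s) w := by
  have hl : IsLocallyConstant fun s => HasWinding (f s) w := by
    rw [IsLocallyConstant.iff_eventually_eq]
    intro s₀
    filter_upwards [eventually_hasWinding_iff hf hp s₀ (h0 s₀)] with s hs
    exact propext (hs.2 w)
  exact (hl.apply_eq_of_preconnectedSpace s₀ s).mp h

/-- Near `θ` the quotient `f t / f θ` is close to `1`, so the principal logarithm computes the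
increment of the argument. By continuity of `x` the increment stays below half a turn, which
excludes a jump by an integer. -/
theorem IsArgLift.hasDerivAt {f : ℝ → ℂ} {x : ℝ → ℝ} {w : ℤ} (hx : IsArgLift f x w) {f' : ℂ}
    {θ : ℝ} (hf : HasDerivAt f f' θ) (h0 : f θ ≠ 0) :
    HasDerivAt x ((f' / f θ).im / (2 * Real.pi)) θ := by
  obtain ⟨hxc, hfx, -⟩ := hx
  have h1 : HasDerivAt (fun t => Complex.log (f t / f θ)) (f' / f θ) θ := by
    have := (hf.div_const (f θ)).clog_real (by simp [div_self h0])
    simpa [div_self h0] using this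
  have h2 : HasDerivAt (fun t => (Complex.log (f t / f θ)).im) (f' / f θ).im θ := by
    have := Complex.imCLM.hasFDerivAt.comp_hasDerivAt θ h1
    exact this
  have h3 := (h2.div_const (2 * Real.pi)).add_const (x θ)
  refine h3.congr_of_eventuallyEq ?_
  have e1 : ∀ᶠ t in nhds θ, f t ≠ 0 := hf.continuousAt.eventually_ne h0
  have e2 : ∀ᶠ t in nhds θ, |x t - x θ| < 1 / 2 := by
    have : ContinuousAt (fun t => |x t - x θ|) θ := by fun_prop
    exact this.eventually (gt_mem_nhds (by simp))
  filter_upwards [e1, e2] with t ht0 ht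
  have hq : f t / f θ = (‖f t‖ / ‖f θ‖ : ℝ) * Complex.exp ((2 * Real.pi * (x t - x θ) : ℝ) * Complex.I) := by
    conv_lhs => rw [hfx t, hfx θ]
    rw [mul_div_mul_comm, ← Complex.exp_sub]
    push_cast
    congr 2
    ring
  rw [Complex.log_im, hq, Complex.arg_real_mul _ (by positivity), Complex.arg_exp_mul_I,
    (toIocMod_eq_self _).2]
  · field_simp
    ring
  · rw [abs_lt] at ht
    constructor <;> nlinarith [Real.pi_pos, ht.1, ht.2]

theorem IsArgLift.integral_im_div {f f' : ℝ → ℂ} {x : ℝ → ℝ} {w : ℤ} (hx : IsArgLift f x w)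
    (hf : ∀ θ, HasDerivAt f (f' θ) θ) (hf' : Continuous f') (h0 : ∀ θ, f θ ≠ 0) :
    ∫ θ in (0 : ℝ)..1, (f' θ / f θ).im = 2 * Real.pi * w := by
  have hc : Continuous f := continuous_iff_continuousAt.2 fun θ => (hf θ).continuousAt
  have h1 := intervalIntegral.integral_eq_sub_of_hasDerivAt (a := 0) (b := 1)
    (fun θ _ => hx.hasDerivAt (hf θ) (h0 θ))
    (((Complex.continuous_im.comp (hf'.div hc h0)).div_const _).intervalIntegrable _ _)
  have h2 := hx.2.2 0
  rw [zero_add] at h2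
  rw [intervalIntegral.integral_div, h2] at h1
  field_simp at h1
  linarith

/-! ### A section of the product of the coordinates -/

section StdLift
variable {m : ℕ}

/-- The vector with square norms `a k + h` and product of the coordinates `χ`, all of whose
coordinates other than the `i`-th one are positive. -/
def stdLift (a : Fin m → ℝ) (i : Fin m) (χ : ℂ) : Fin m → ℂ := fun k =>
  if k = i then χ / ∏ j ∈ Finset.univ.erase i, (Real.sqrt (a j + height a (‖χ‖ ^ 2)) : ℂ)
  else (Real.sqrt (a k + height a (‖χ‖ ^ 2)) : ℂ)

theorem stdLift_self (a : Fin m → ℝ) (i : Fin m) (χ : ℂ) : stdLift a i χ i =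
    χ / ∏ j ∈ Finset.univ.erase i, (Real.sqrt (a j + height a (‖χ‖ ^ 2)) : ℂ) := if_pos rfl

theorem stdLift_of_ne (a : Fin m → ℝ) {i k : Fin m} (hk : k ≠ i) (χ : ℂ) :
    stdLift a i χ k = (Real.sqrt (a k + height a (‖χ‖ ^ 2)) : ℂ) := if_neg hk

variable {a : Fin m → ℝ} {i : Fin m} {χ : ℂ}

theorem prod_sqrt_ne_zero (hpos : ∀ k, k ≠ i → 0 < a k + height a (‖χ‖ ^ 2)) :
    ∏ j ∈ Finset.univ.erase i, (Real.sqrt (a j + height a (‖χ‖ ^ 2)) : ℂ) ≠ 0 :=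
  Finset.prod_ne_zero_iff.2 fun j hj => Complex.ofReal_ne_zero.2
    (Real.sqrt_pos.2 (hpos j (Finset.ne_of_mem_erase hj))).ne'

theorem prod_stdLift (hpos : ∀ k, k ≠ i → 0 < a k + height a (‖χ‖ ^ 2)) :
    ∏ k, stdLift a i χ k = χ := by
  rw [← Finset.mul_prod_erase _ _ (Finset.mem_univ i), stdLift_self,
    Finset.prod_congr rfl fun k hk => stdLift_of_ne a (Finset.ne_of_mem_erase hk) χ,
    div_mul_cancel₀ _ (prod_sqrt_ne_zero hpos)]

/-- For the `i`-th coordinate compare `∏ (a k + h) = |χ|²`, which defines the height, with the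
square norm of the product of the coordinates, and cancel the other factors. -/
theorem norm_sq_stdLift [NeZero m] (hpos : ∀ k, k ≠ i → 0 < a k + height a (‖χ‖ ^ 2)) (k : Fin m) :
    ‖stdLift a i χ k‖ ^ 2 = a k + height a (‖χ‖ ^ 2) := by
  have hne : ∀ k, k ≠ i → ‖stdLift a i χ k‖ ^ 2 = a k + height a (‖χ‖ ^ 2) := fun k hk => by
    rw [stdLift_of_ne a hk, Complex.norm_real, Real.norm_eq_abs, sq_abs, Real.sq_sqrt (hpos k hk).le]
  by_cases hk : k = i
  · subst hk
    have h1 := prod_height a (sq_nonneg ‖χ‖)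
    have h2 := congrArg (fun z : ℂ => ‖z‖ ^ 2) (prod_stdLift hpos)
    simp only [norm_prod, ← Finset.prod_pow] at h2
    rw [← Finset.mul_prod_erase _ _ (Finset.mem_univ k)] at h1 h2
    rw [Finset.prod_congr rfl fun j hj => hne j (Finset.ne_of_mem_erase hj)] at h2
    exact mul_right_cancel₀ (Finset.prod_pos fun j hj => hpos j (Finset.ne_of_mem_erase hj)).ne'
      (h2.trans h1.symm)
  · exact hne k hk

theorem contDiffAt_stdLift [NeZero m] {E : Type*} [NormedAddCommGroup E] [NormedSpace ℝ E]
    {a : E → Fin m → ℝ} {χ : E → ℂ} {y : E} (ha : ContDiffAt ℝ ∞ a y) (hχ : ContDiffAt ℝ ∞ χ y)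
    (hpos : ∀ k, k ≠ i → 0 < a y k + height (a y) (‖χ y‖ ^ 2)) :
    ContDiffAt ℝ ∞ (fun y => stdLift (a y) i (χ y)) y := by
  have hh : ContDiffAt ℝ ∞ (fun y => height (a y) (‖χ y‖ ^ 2)) y :=
    contDiffAt_height_comp ha (hχ.norm_sq ℝ) (fun _ => sq_nonneg _) hpos
  have hs : ∀ k, k ≠ i → ContDiffAt ℝ ∞
      (fun y => (Real.sqrt (a y k + height (a y) (‖χ y‖ ^ 2)) : ℂ)) y := fun k hk => by
    have h1 : ContDiffAt ℝ ∞ (fun y => a y k) y := contDiffAt_pi.1 ha k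
    exact Complex.ofRealCLM.contDiff.contDiffAt.comp y ((h1.add hh).sqrt (hpos k hk).ne')
  refine contDiffAt_pi.2 fun k => ?_
  by_cases hk : k = i
  · subst hk
    simp only [stdLift_self]
    simp only [div_eq_mul_inv]
    exact hχ.mul (ContDiffAt.inv (contDiffAt_prod fun j hj => hs j (Finset.ne_of_mem_erase hj))
      (prod_sqrt_ne_zero hpos))
  · simp only [stdLift_of_ne _ hk]
    exact hs k hk

theorem prod_torusAct (g : Fin m → ℝ) (z : Fin m → ℂ) :
    ∏ k, torusAct g z k = Complex.exp (2 * Real.pi * (∑ k, g k : ℝ) * Complex.I) * ∏ k, z k := by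
  simp only [torusAct, Finset.prod_mul_distrib, ← Complex.exp_sum]
  congr 2
  push_cast
  rw [Finset.mul_sum, Finset.sum_mul]

theorem torusAct_int (d : Fin m → ℤ) (z : Fin m → ℂ) : torusAct (fun k => (d k : ℝ)) z = z := by
  funext k
  rw [torusAct, exp_two_pi_int, one_mul]

/-- The projection of `ℝᵐ` to the vectors with sum zero along the `i`-th axis. -/
def shear (i : Fin m) : (Fin m → ℝ) →ₗ[ℝ] Fin m → ℝ where
  toFun x := x - Pi.single i (∑ k, x k)
  map_add' x y := by
    simp only [Pi.add_apply, Finset.sum_add_distrib, Pi.single_add]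
    abel
  map_smul' c x := by
    simp only [Pi.smul_apply, ← Finset.smul_sum, RingHom.id_apply, smul_sub, Pi.single_smul]

theorem shear_apply (i : Fin m) (x : Fin m → ℝ) : shear i x = x - Pi.single i (∑ k, x k) := rfl

theorem shear_of_ne {k : Fin m} (hk : k ≠ i) (x : Fin m → ℝ) : shear i x k = x k := by
  simp [shear_apply, hk]

theorem sum_shear (i : Fin m) (x : Fin m → ℝ) : ∑ k, shear i x k = 0 := by
  simp [shear_apply, Finset.sum_sub_distrib]

theorem shear_int (i : Fin m) (d : Fin m → ℤ) : ∃ d' : Fin m → ℤ,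
    shear i (fun k => (d k : ℝ)) = fun k => (d' k : ℝ) :=
  ⟨d - Pi.single i (∑ k, d k), by
    funext k
    by_cases hk : k = i
    · subst hk; simp [shear_apply]
    · simp [shear_apply, hk]⟩

/-- The coordinates other than the `i`-th agree in modulus and phase. Subtracting the total angle in
the `i`-th direction keeps the product equal to `χ`, which then determines the `i`-th coordinate. No
phase of `z i` is needed, so `z i = 0` is allowed. -/
theorem eq_torusAct_stdLift [NeZero m] {z : Fin m → ℂ}
    (hz : ∀ k, ‖z k‖ ^ 2 = a k + height a (‖∏ k, z k‖ ^ 2)) (h0 : ∀ k, k ≠ i → z k ≠ 0)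
    {x : Fin m → ℝ} (hx : ∀ k, k ≠ i → z k = ‖z k‖ * Complex.exp (2 * Real.pi * x k * Complex.I)) :
    z = torusAct (shear i x) (stdLift a i (∏ k, z k)) := by
  have hpos : ∀ k, k ≠ i → 0 < a k + height a (‖∏ k, z k‖ ^ 2) := fun k hk => by
    rw [← hz]; exact pow_pos (norm_pos_iff.2 (h0 k hk)) 2
  have hne : ∀ k, k ≠ i → z k = torusAct (shear i x) (stdLift a i (∏ k, z k)) k := fun k hk => by
    rw [torusAct, stdLift_of_ne a hk, ← hz, Real.sqrt_sq (norm_nonneg _), shear_of_ne hk, mul_comm]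
    exact hx k hk
  funext k
  by_cases hk : k = i
  · subst hk
    have h1 : ∏ j, torusAct (shear k x) (stdLift a k (∏ j, z j)) j = ∏ j, z j := by
      rw [prod_torusAct, sum_shear, prod_stdLift hpos]
      simp
    generalize torusAct (shear k x) (stdLift a k (∏ j, z j)) = w at h1 hne ⊢
    rw [← Finset.mul_prod_erase _ w (Finset.mem_univ k),
      ← Finset.prod_congr rfl fun j hj => hne j (Finset.ne_of_mem_erase hj),
      ← Finset.mul_prod_erase _ z (Finset.mem_univ k)] at h1
    exact (mul_right_cancel₀ (Finset.prod_ne_zero_iff.2 fun j hj =>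
      h0 j (Finset.ne_of_mem_erase hj)) h1).symm
  · exact hne k hk

end StdLift

/-! ### The fibres of the Gross fibration -/

namespace ToricCY

variable {n m : ℕ} (T : ToricCY n m)

theorem neZero {n m : ℕ} (T : ToricCY n m) : NeZero m := by
  refine ⟨?_⟩
  rintro rfl
  have h := T.span_v
  rw [Set.range_eq_empty, Submodule.span_empty] at h
  have : Nonempty (Fin n) := ⟨⟨0, T.dim_pos⟩⟩
  exact bot_ne_top h

theorem sum_u_mul_v (i : Fin m) : ∑ a, (T.u a : ℝ) * (T.v i a : ℝ) = 1 := by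
  exact_mod_cast T.calabi_yau i

theorem ell_add_smul_u (ν : Fin n → ℝ) (h : ℝ) (i : Fin m) :
    T.ell (ν + h • fun a => (T.u a : ℝ)) i = T.ell ν i + h := by
  have := T.sum_u_mul_v i
  simp only [ell, facetFun, Pi.add_apply, Pi.smul_apply, smul_eq_mul, add_mul,
    Finset.sum_add_distrib, mul_assoc, ← Finset.mul_sum, this]
  ring

theorem ell_injective {ν ν' : Fin n → ℝ} (h : ∀ i, T.ell ν i = T.ell ν' i) : ν = ν' := by
  let f : (Fin n → ℤ) →+ ℝ :=
    { toFun := fun w => ∑ a, (ν a - ν' a) * (w a : ℝ)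
      map_zero' := by simp
      map_add' := fun x y => by simp [mul_add, Finset.sum_add_distrib] }
  have hf : ∀ w, f w = 0 := fun w => by
    have hw : w ∈ Submodule.span ℤ (Set.range T.v) := T.span_v ▸ Submodule.mem_top
    have hle : Submodule.span ℤ (Set.range T.v) ≤ LinearMap.ker f.toIntLinearMap := by
      rw [Submodule.span_le]
      rintro _ ⟨i, rfl⟩
      have := h i
      simp only [ell, facetFun, add_left_inj] at this
      show ∑ a, (ν a - ν' a) * (T.v i a : ℝ) = 0
      simp only [sub_mul, Finset.sum_sub_distrib, this, sub_self]
    exact hle hw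
  funext a
  have := hf (Pi.single a 1)
  simp only [f, AddMonoidHom.coe_mk, ZeroHom.coe_mk] at this
  rw [Finset.sum_eq_single a (fun b _ hb => by simp [hb]) (by simp)] at this
  simpa [sub_eq_zero] using this

theorem momentMap_eq (z : T.Level) {ν : Fin n → ℝ} (h : ∀ i, ‖z.1 i‖ ^ 2 = T.ell ν i) :
    T.momentMap (T.proj z) = ν :=
  T.ell_injective fun i => (T.momentMap_spec z i).symm.trans (h i)

theorem chi_proj (z : T.Level) : T.chi (T.proj z) = ∏ i, z.1 i := rfl

theorem continuous_chi : Continuous T.chi :=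
  Continuous.quotient_lift (by fun_prop) _

theorem mkQ_eq_iff {ν ν' : Fin n → ℝ} : T.uLine.mkQ ν' = T.uLine.mkQ ν ↔
    ∃ h : ℝ, ν' = ν + h • fun a => (T.u a : ℝ) := by
  rw [Submodule.mkQ_apply, Submodule.mkQ_apply, Submodule.Quotient.eq, uLine,
    Submodule.mem_span_singleton]
  exact exists_congr fun h => ⟨fun hh => by rw [hh]; abel, fun hh => by rw [hh]; abel⟩

theorem exists_rep (b : T.Base) : ∃ ν, T.uLine.mkQ ν = b.1 := T.uLine.mkQ_surjective b.1

theorem exists_min (ν : Fin n → ℝ) : ∃ i, ∀ k, T.ell ν i ≤ T.ell ν k := by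
  have := T.neZero
  obtain ⟨i, -, hi⟩ := Finset.exists_min_image Finset.univ (T.ell ν) Finset.univ_nonempty
  exact ⟨i, fun k => hi k (Finset.mem_univ k)⟩

variable {T} {e : ℂ} {b : T.Base} {ν : Fin n → ℝ}

theorem mem_level_of_norm {z : Fin m → ℂ} {h : ℝ} (hz : ∀ k, ‖z k‖ ^ 2 = T.ell ν k + h) :
    z ∈ T.Level := ⟨_, fun k => (hz k).trans (T.ell_add_smul_u ν h k).symm⟩

theorem mem_fibre_iff (hν : T.uLine.mkQ ν = b.1) (z : T.Level) : T.proj z ∈ T.fibre e b ↔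
    (∃ h, ∀ k, ‖z.1 k‖ ^ 2 = T.ell ν k + h) ∧ ‖∏ k, z.1 k - e‖ ^ 2 = b.2 := by
  have h1 : T.proj z ∈ T.fibre e b ↔ T.uLine.mkQ (T.momentMap (T.proj z)) = b.1 ∧
      ‖∏ k, z.1 k - e‖₊ ^ 2 = b.2 := by
    rw [fibre, Set.mem_ofPred_eq, gross, Prod.ext_iff, chi_proj]
  have h2 : ‖∏ k, z.1 k - e‖₊ ^ 2 = b.2 ↔ ‖∏ k, z.1 k - e‖ ^ 2 = b.2 := by
    rw [← NNReal.coe_inj]; simp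
  rw [h1, h2, ← hν, mkQ_eq_iff]
  refine and_congr_left' (exists_congr fun h => ?_)
  simp only [← T.ell_add_smul_u ν h]
  constructor
  · intro hh k
    rw [← hh, T.momentMap_spec]
  · exact T.momentMap_eq z

/-- Moving along `u` shifts all the square moduli by one common number, and their product `|χ|²`
fixes that number. -/
theorem norm_sq_eq_height (hν : T.uLine.mkQ ν = b.1) {z : T.Level} (hz : T.proj z ∈ T.fibre e b)
    (k : Fin m) : ‖z.1 k‖ ^ 2 = T.ell ν k + height (T.ell ν) (‖∏ k, z.1 k‖ ^ 2) := by
  have := T.neZero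
  obtain ⟨⟨h, hh⟩, -⟩ := (mem_fibre_iff hν z).1 hz
  rw [← eq_height (T.ell ν) (h := h) (fun k => by rw [← hh]; positivity)]
  · exact hh k
  · simp only [← hh, norm_prod, Finset.prod_pow]

theorem snd_ne_zero_of_regular (hb : b ∉ T.discriminant e) : (b.2 : ℝ) ≠ 0 := fun h =>
  hb (Or.inl (NNReal.coe_eq_zero.1 h))

/-- If the `k`-th square modulus vanished, so would the smaller `i`-th one. Then `χ = 0`, so `b₂ =
|e|²`, and `b` would lie in the image of the face `F_i ∩ F_k`, which belongs to the discriminant. -/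
theorem ell_add_height_pos (hb : b ∉ T.discriminant e) (hν : T.uLine.mkQ ν = b.1) {i : Fin m}
    (hi : ∀ k, T.ell ν i ≤ T.ell ν k) {χ : ℂ} (hχ : ‖χ - e‖ ^ 2 = b.2) {k : Fin m} (hk : k ≠ i) :
    0 < T.ell ν k + height (T.ell ν) (‖χ‖ ^ 2) := by
  have := T.neZero
  have h1 := height_nonneg (T.ell ν) (sq_nonneg ‖χ‖)
  refine lt_of_le_of_ne (h1 k) fun h0 => hb (Or.inr ?_)
  have hi0 : T.ell ν i + height (T.ell ν) (‖χ‖ ^ 2) = 0 :=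
    le_antisymm (by linarith [hi k]) (h1 i)
  have h2 := prod_height (T.ell ν) (sq_nonneg ‖χ‖)
  rw [Finset.prod_eq_zero (Finset.mem_univ i) hi0, eq_comm, sq_eq_zero_iff, norm_eq_zero] at h2
  refine ⟨?_, ν + height (T.ell ν) (‖χ‖ ^ 2) • fun a => (T.u a : ℝ), fun j => ?_, i, k, hk.symm,
    ?_, ?_, ?_⟩
  · rw [h2, zero_sub, norm_neg] at hχ
    rw [← NNReal.coe_inj, ← hχ]
    simp
  · rw [ell_add_smul_u]; exact h1 j
  · rw [ell_add_smul_u]; exact hi0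
  · rw [ell_add_smul_u]; exact h0.symm
  · rw [← hν, mkQ_eq_iff]; exact ⟨_, rfl⟩

theorem coord_ne_zero (hb : b ∉ T.discriminant e) (hν : T.uLine.mkQ ν = b.1) {i : Fin m}
    (hi : ∀ k, T.ell ν i ≤ T.ell ν k) {z : T.Level} (hz : T.proj z ∈ T.fibre e b) {k : Fin m}
    (hk : k ≠ i) : z.1 k ≠ 0 := by
  have h1 := ell_add_height_pos hb hν hi ((mem_fibre_iff hν z).1 hz).2 hk
  rw [← norm_sq_eq_height hν hz] at h1
  intro h
  simp [h] at h1

end ToricCY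

namespace ToricCY
namespace DiscClasses

variable {n m : ℕ} {T : ToricCY n m} {e : ℂ} {b : T.Base} (β : T.DiscClasses e b)

/-! ### Winding numbers of the cylinders -/

theorem continuous_cyl (j : Fin m) :
    Continuous fun p : unitInterval × ℝ => β.cyl j p.1 p.2 :=
  (β.cyl_smooth j).continuousOn.comp_continuous
    (f := fun p : unitInterval × ℝ => ((p.1 : ℝ), p.2)) (by fun_prop)
    fun p => ⟨p.1.2, Set.mem_univ _⟩

theorem continuous_cyl_apply (j k : Fin m) :
    Continuous fun p : unitInterval × ℝ => β.cyl j p.1 p.2 k :=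
  (continuous_apply k).comp (β.continuous_cyl j)

theorem norm_sq_chi_sub (j : Fin m) (s : unitInterval) (θ : ℝ) :
    ‖∏ k, β.cyl j s θ k - β.t s * e‖ ^ 2 = (β.path s).2 :=
  ((mem_fibre_iff (T.exists_rep _).choose_spec _).1 (β.cyl_fibre j s s.2 θ)).2

/-- The modulus of `χ - t e` is the square root of the second base coordinate, which never vanishes
along a regular path. So the winding number is the one at `s = 0`, where `t = 0` and the `j`-th
circle rotates `χ` once. -/
theorem hasWinding_chi_sub (j : Fin m) (s : unitInterval) :
    HasWinding (fun θ => ∏ k, β.cyl j s θ k - β.t s * e) 1 := by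
  have h0 : HasWinding (fun θ => ∏ k, β.cyl j (0 : unitInterval) θ k - β.t (0 : unitInterval) * e) 1 := by
    have := hasWinding_exp_mul (∏ k, β.z₀ j k) 1
    convert this using 2 with θ
    rw [Set.Icc.coe_zero, β.t_zero, β.cyl_zero, prod_torusAct]
    simp
  refine HasWinding.of_connected
    (f := fun (s : unitInterval) θ => ∏ k, β.cyl j s θ k - β.t s * e) ?_ ?_ ?_ h0
  · refine Continuous.sub (continuous_finsetProd _ fun k _ => β.continuous_cyl_apply j k) ?_
    refine Continuous.mul (Complex.continuous_ofReal.comp ?_) continuous_const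
    exact β.t_cont.comp_continuous (by fun_prop) fun p => p.1.2
  · intro s θ
    simp only [β.cyl_periodic j s s.2]
  · intro s θ h
    have := β.norm_sq_chi_sub j s θ
    rw [h, norm_zero, zero_pow two_ne_zero] at this
    exact snd_ne_zero_of_regular (β.regular s s.2) this.symm

/-- Away from the walls the function `χ` has the same winding number along all cylinders. -/
theorem exists_hasWinding_chi (s : unitInterval) (h0 : ∀ j θ, ∏ k, β.cyl j s θ k ≠ 0) :
    ∃ D : ℤ, ∀ j, HasWinding (fun θ => ∏ k, β.cyl j s θ k) D := by
  have hr : ∀ j θ, ‖∏ k, β.cyl j s θ k - β.t s * e‖ = Real.sqrt (β.path s).2 := fun j θ => by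
    rw [← β.norm_sq_chi_sub j s θ, Real.sqrt_sq (norm_nonneg _)]
  have hc : ∀ j, Continuous fun θ => ∏ k, β.cyl j s θ k := fun j =>
    continuous_finsetProd _ fun k _ =>
      (β.continuous_cyl_apply j k).comp (continuous_const.prodMk continuous_id)
  have hp : ∀ j θ, ∏ k, β.cyl j s (θ + 1) k = ∏ k, β.cyl j s θ k := fun j θ => by
    rw [β.cyl_periodic j s s.2]
  -- The loop `χ` runs on a circle around `t e`. If the origin is inside, the winding number is that
  -- of `χ - t e`; if it is outside, the number is `0`. If it is on the circle, a loop that winds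
  -- once around `t e` must pass through it, contrary to `h0`.
  rcases lt_trichotomy ‖(β.t s * e : ℂ)‖ (Real.sqrt (β.path s).2) with h | h | h
  · refine ⟨1, fun j => (hasWinding_iff_of_close
      (f := fun θ => ∏ k, β.cyl j s θ k - β.t s * e) ((hc j).sub continuous_const) (hc j)
      (fun θ => by rw [hp]) (hp j) (fun θ => ?_) 1).2 (β.hasWinding_chi_sub j s)⟩
    rw [hr, sub_sub_cancel]
    exact h
  · refine ⟨0, fun j => absurd ?_ (not_exists.2 (h0 j))⟩
    obtain ⟨x, hxc, hx, hx1⟩ := β.hasWinding_chi_sub j s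
    obtain ⟨y, hy⟩ := exists_eq_norm_mul_exp (-(β.t s * e : ℂ))
    have hxz : ∀ d : ℤ, x d = x 0 + d := fun d => by
      have hper : Function.Periodic (fun θ => x θ - θ) 1 := fun θ => by
        simp only [hx1]; push_cast; ring
      have := hper.int_mul_eq d
      simp only [mul_one, sub_zero] at this
      linarith
    obtain ⟨θ, hθ⟩ := mem_range_of_exists_le_of_exists_ge hxc
      (c := y) ⟨⌊y - x 0⌋, by rw [hxz]; linarith [Int.floor_le (y - x 0)]⟩
      ⟨⌈y - x 0⌉, by rw [hxz]; linarith [Int.le_ceil (y - x 0)]⟩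
    refine ⟨θ, ?_⟩
    have h1 := hx θ
    rw [hr, hθ, ← h, ← norm_neg, ← hy] at h1
    linear_combination h1
  · refine ⟨0, fun j => (hasWinding_iff_of_close continuous_const (hc j) (fun θ => rfl) (hp j)
      (fun θ => ?_) 0).2 (by simpa using hasWinding_exp_mul (β.t s * e) 0)⟩
    rw [hr]
    exact h

/-- No coordinate except possibly the `i`-th one vanishes on the cylinders over `s`. -/
def Valid (s : unitInterval) (i : Fin m) : Prop := ∀ k, k ≠ i → ∀ j θ, β.cyl j s θ k ≠ 0

/-- The winding numbers over `s` of the coordinates other than the `i`-th one are those of the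
circle orbits up to corrections that are the same for all cylinders. -/
def WindingsAt (s : unitInterval) (i : Fin m) : Prop :=
  ∃ c : Fin m → ℤ, ∀ k, k ≠ i → ∀ j,
    HasWinding (fun θ => β.cyl j s θ k) ((Pi.single j 1 : Fin m → ℤ) k + c k)

theorem valid_of_min (s : unitInterval) {ν : Fin n → ℝ} (hν : T.uLine.mkQ ν = (β.path s).1)
    {i : Fin m} (hi : ∀ k, T.ell ν i ≤ T.ell ν k) : β.Valid s i := fun _ hk j θ =>
  coord_ne_zero (β.regular s s.2) hν hi (β.cyl_fibre j s s.2 θ) hk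

variable {β} in
-- When both indices are valid no coordinate vanishes, so the winding number of the `i`-th
-- coordinate is that of `χ` minus those of the others. As `χ` winds equally often for all `j` and
-- `∑ k, δ_{jk} = 1`, it is again `δ_{ji}` plus a correction independent of `j`.
theorem WindingsAt.change {s : unitInterval} {i i' : Fin m} (hi : β.Valid s i)
    (hi' : β.Valid s i') (h : β.WindingsAt s i) : β.WindingsAt s i' := by
  by_cases hii : i = i'
  · exact hii ▸ h
  have h0 : ∀ k j θ, β.cyl j s θ k ≠ 0 := fun k => by
    by_cases hk : k = i
    · exact hi' k (hk ▸ hii)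
    · exact hi k hk
  obtain ⟨D, hD⟩ := β.exists_hasWinding_chi s fun j θ =>
    Finset.prod_ne_zero_iff.2 fun k _ => h0 k j θ
  obtain ⟨c, hc⟩ := h
  refine ⟨Function.update c i (D - 1 - ∑ k ∈ Finset.univ.erase i, c k), fun k _ j => ?_⟩
  by_cases hk : k = i
  · subst hk
    have h1 := HasWinding.prod (Finset.univ.erase k) fun l hl => hc l (Finset.ne_of_mem_erase hl) j
    have h2 := HasWinding.of_mul_eq (f := fun θ => β.cyl j s θ k) (hD j) h1
      (fun θ => Finset.prod_ne_zero_iff.2 fun l _ => h0 l j θ)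
      (fun θ => Finset.mul_prod_erase _ (fun l => β.cyl j s θ l) (Finset.mem_univ k))
    convert h2 using 1
    have h3 := Finset.add_sum_erase Finset.univ (fun l => (Pi.single j 1 : Fin m → ℤ) l)
      (Finset.mem_univ k)
    rw [Finset.sum_pi_single' j (1 : ℤ) Finset.univ] at h3
    simp only [Finset.mem_univ, if_true] at h3
    rw [Finset.sum_add_distrib, Function.update_self]
    linarith
  · rw [Function.update_of_ne hk]
    exact hc k hk j

/-- Continuation along the path. Near `s₀` an index that is minimal at `s₀` remains valid and the
winding numbers of the other coordinates do not change; `WindingsAt.change` passes to any other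
valid index. At `s = 0` the corrections are `0`. -/
theorem windingsAt {s : unitInterval} {i : Fin m} (hi : β.Valid s i) : β.WindingsAt s i := by
  let P : unitInterval → Prop := fun s => ∀ i, β.Valid s i → β.WindingsAt s i
  suffices hl : IsLocallyConstant P by
    have h0 : P 0 := fun i _ => ⟨0, fun k _ j => by
      have := hasWinding_exp_mul (β.z₀ j k) ((Pi.single j 1 : Fin m → ℤ) k)
      rw [Pi.zero_apply, add_zero]
      convert this using 2 with θ
      rw [Set.Icc.coe_zero, β.cyl_zero, torusAct]
      congr 4
      by_cases hk : k = j
      · subst hk; simp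
      · simp [hk]⟩
    exact (hl.apply_eq_of_preconnectedSpace 0 s).mp h0 i hi
  rw [IsLocallyConstant.iff_eventually_eq]
  intro s₀
  obtain ⟨ν, hν⟩ := T.exists_rep (β.path s₀)
  obtain ⟨i₀, hi₀⟩ := T.exists_min ν
  have hv := β.valid_of_min s₀ hν hi₀
  have hev : ∀ᶠ s : unitInterval in nhds s₀, ∀ k j, k ≠ i₀ → (∀ θ, β.cyl j s θ k ≠ 0) ∧
      ∀ w, HasWinding (fun θ => β.cyl j s θ k) w ↔ HasWinding (fun θ => β.cyl j s₀ θ k) w := by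
    rw [Filter.eventually_all]; intro k
    rw [Filter.eventually_all]; intro j
    by_cases hk : k = i₀
    · simp [hk]
    filter_upwards [eventually_hasWinding_iff
      (f := fun (s : unitInterval) θ => β.cyl j s θ k) (β.continuous_cyl_apply j k)
      (fun s θ => by rw [β.cyl_periodic j s s.2]) s₀ (hv k hk j)] with s hs _ using hs
  filter_upwards [hev] with s hs
  have hvs : β.Valid s i₀ := fun k hk j => (hs k j hk).1
  have hiff : β.WindingsAt s i₀ ↔ β.WindingsAt s₀ i₀ := by
    refine exists_congr fun c => forall_congr' fun k => ?_
    exact imp_congr_right fun hk => forall_congr' fun j => (hs k j hk).2 _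
  exact propext ⟨fun h i hi => (hiff.1 (h i₀ hvs)).change hv hi,
    fun h i hi => (hiff.2 (h i₀ hv)).change hvs hi⟩

theorem exists_boundary_lifts {ν : Fin n → ℝ} (hν : T.uLine.mkQ ν = b.1)
    {i : Fin m} (hi : ∀ k, T.ell ν i ≤ T.ell ν k) :
    ∃ c : Fin m → ℤ, ∀ j, ∃ x : Fin m → ℝ → ℝ, ∃ σ : ℝ → ℝ,
      (∀ k, k ≠ i → IsArgLift (fun θ => β.cyl j 1 θ k) (x k) ((Pi.single j 1 : Fin m → ℤ) k + c k)) ∧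
      (∀ k, Continuous (x k)) ∧
      (∀ k θ, x k (θ + 1) = x k θ + ((Pi.single j 1 : Fin m → ℤ) k + c k : ℤ)) ∧
      IsArgLift (fun θ => ∏ k, β.cyl j 1 θ k - e) σ 1 := by
  obtain ⟨c, hc⟩ := β.windingsAt (β.valid_of_min 1 (by simpa [β.path_one] using hν) hi)
  refine ⟨c, fun j => ?_⟩
  have hx : ∀ k, ∃ x : ℝ → ℝ,
      (k ≠ i → IsArgLift (fun θ => β.cyl j 1 θ k) x ((Pi.single j 1 : Fin m → ℤ) k + c k)) ∧
      Continuous x ∧ ∀ θ, x (θ + 1) = x θ + ((Pi.single j 1 : Fin m → ℤ) k + c k : ℤ) := fun k => by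
    by_cases hk : k = i
    -- The `i`-th angle is a dummy: the shear in `coverLift` makes it irrelevant, and a linear
    -- function has the required increment.
    · exact ⟨fun θ => ((Pi.single j 1 : Fin m → ℤ) k + c k : ℤ) * θ, fun h => absurd hk h,
        by fun_prop, fun θ => by ring⟩
    · obtain ⟨x, hx⟩ := hc k hk j
      exact ⟨x, fun _ => by simpa using hx, hx.1, hx.2.2⟩
  choose x hx1 hx2 hx3 using hx
  obtain ⟨σ, hσ⟩ := β.hasWinding_chi_sub j 1
  exact ⟨x, σ, hx1, hx2, hx3, by simpa [β.t_one] using hσ⟩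

end DiscClasses
end ToricCY

namespace ToricCY

variable {n m : ℕ} (T : ToricCY n m) {e : ℂ} {b : T.Base} {ν : Fin n → ℝ} {i : Fin m}

/-! ### The universal cover of a regular fibre -/

/-- The circle `|χ - e|² = b₂`. -/
def circ (e : ℂ) (b : T.Base) (σ : ℝ) : ℂ :=
  e + Real.sqrt b.2 * Complex.exp (2 * Real.pi * σ * Complex.I)

/-- The parametrization of the preimage in the level set of the fibre over `b`. -/
def coverLift (e : ℂ) (b : T.Base) (ν : Fin n → ℝ) (i : Fin m) (p : (Fin m → ℝ) × ℝ) : Fin m → ℂ :=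
  torusAct (shear i p.1) (stdLift (T.ell ν) i (T.circ e b p.2))

variable {T}

theorem norm_sq_circ_sub (σ : ℝ) : ‖T.circ e b σ - e‖ ^ 2 = b.2 := by
  rw [circ, add_sub_cancel_left, norm_mul, norm_exp_two_pi, mul_one, Complex.norm_real,
    Real.norm_eq_abs, sq_abs, Real.sq_sqrt b.2.coe_nonneg]

theorem circ_add_int (σ : ℝ) (d : ℤ) : T.circ e b (σ + d) = T.circ e b σ := by
  have h := exp_two_pi_int d
  rw [circ, circ]
  congr 2
  rw [← mul_one (Complex.exp (2 * Real.pi * σ * Complex.I)), ← h, ← Complex.exp_add]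
  congr 1
  push_cast; ring

theorem contDiff_circ : ContDiff ℝ ∞ (T.circ e b) := by
  have h : ContDiff ℝ ∞ fun σ : ℝ => (2 * Real.pi * σ * Complex.I : ℂ) :=
    (contDiff_const.mul Complex.ofRealCLM.contDiff).mul contDiff_const
  exact contDiff_const.add (contDiff_const.mul h.cexp)

theorem contDiff_stdLift_circ (hb : b ∉ T.discriminant e) (hν : T.uLine.mkQ ν = b.1)
    (hi : ∀ k, T.ell ν i ≤ T.ell ν k) :
    ContDiff ℝ ∞ fun σ => stdLift (T.ell ν) i (T.circ e b σ) := by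
  have := T.neZero
  exact contDiff_iff_contDiffAt.2 fun σ => contDiffAt_stdLift contDiffAt_const
    contDiff_circ.contDiffAt fun k hk => ell_add_height_pos hb hν hi (norm_sq_circ_sub σ) hk

theorem continuous_torusAct : Continuous fun p : (Fin m → ℝ) × (Fin m → ℂ) => torusAct p.1 p.2 := by
  refine continuous_pi fun k => Continuous.mul (Complex.continuous_exp.comp ?_) (by fun_prop)
  exact (continuous_const.mul (Complex.continuous_ofReal.comp (by fun_prop))).mul continuous_const

theorem continuous_coverLift (hb : b ∉ T.discriminant e) (hν : T.uLine.mkQ ν = b.1)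
    (hi : ∀ k, T.ell ν i ≤ T.ell ν k) : Continuous (T.coverLift e b ν i) := by
  have h1 : Continuous (shear i) := (shear i).continuous_of_finiteDimensional
  have h2 : Continuous fun p : (Fin m → ℝ) × ℝ => stdLift (T.ell ν) i (T.circ e b p.2) :=
    (contDiff_stdLift_circ hb hν hi).continuous.comp continuous_snd
  have h3 : Continuous fun p : (Fin m → ℝ) × ℝ => shear i p.1 := h1.comp continuous_fst
  unfold coverLift
  have h4 := h3.prodMk h2
  have h5 := (continuous_torusAct (m := m)).comp h4
  exact h5

theorem norm_sq_coverLift (hb : b ∉ T.discriminant e) (hν : T.uLine.mkQ ν = b.1)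
    (hi : ∀ k, T.ell ν i ≤ T.ell ν k) (p : (Fin m → ℝ) × ℝ) (k : Fin m) :
    ‖T.coverLift e b ν i p k‖ ^ 2 =
      T.ell ν k + height (T.ell ν) (‖T.circ e b p.2‖ ^ 2) := by
  have := T.neZero
  rw [coverLift, norm_torusAct, norm_sq_stdLift fun k hk =>
    ell_add_height_pos hb hν hi (norm_sq_circ_sub p.2) hk]

theorem prod_coverLift (hb : b ∉ T.discriminant e) (hν : T.uLine.mkQ ν = b.1)
    (hi : ∀ k, T.ell ν i ≤ T.ell ν k) (p : (Fin m → ℝ) × ℝ) :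
    ∏ k, T.coverLift e b ν i p k = T.circ e b p.2 := by
  rw [coverLift, prod_torusAct, sum_shear, prod_stdLift fun k hk =>
    ell_add_height_pos hb hν hi (norm_sq_circ_sub p.2) hk]
  simp

theorem coverLift_mem_level (hb : b ∉ T.discriminant e) (hν : T.uLine.mkQ ν = b.1)
    (hi : ∀ k, T.ell ν i ≤ T.ell ν k) (p : (Fin m → ℝ) × ℝ) : T.coverLift e b ν i p ∈ T.Level :=
  mem_level_of_norm (norm_sq_coverLift hb hν hi p)

/-- The universal cover of a regular fibre, composed with the projection of `ℝᵐ` to the quotient by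
`G_ℝ`. -/
def cover (hb : b ∉ T.discriminant e) (hν : T.uLine.mkQ ν = b.1)
    (hi : ∀ k, T.ell ν i ≤ T.ell ν k) : C((Fin m → ℝ) × ℝ, T.fibre e b) where
  toFun p := ⟨T.proj ⟨T.coverLift e b ν i p, coverLift_mem_level hb hν hi p⟩,
    (mem_fibre_iff hν _).2 ⟨⟨_, norm_sq_coverLift hb hν hi p⟩, by
      simp only [prod_coverLift hb hν hi, norm_sq_circ_sub]⟩⟩
  continuous_toFun := Continuous.subtype_mk (T.continuous_proj.comp
    (Continuous.subtype_mk (continuous_coverLift hb hν hi) _)) _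

/-- The shear maps integral vectors to integral vectors, which act trivially on `ℂᵐ`. -/
theorem cover_period (hb : b ∉ T.discriminant e) (hν : T.uLine.mkQ ν = b.1)
    (hi : ∀ k, T.ell ν i ≤ T.ell ν k) (w : Fin m → ℤ) (d : ℤ) :
    ((fun k => (w k : ℝ), (d : ℝ)) : (Fin m → ℝ) × ℝ) ∈ FlatU1.periods (cover hb hν hi) := by
  intro p
  refine Subtype.ext (congrArg T.proj (Subtype.ext ?_))
  obtain ⟨w', hw'⟩ := shear_int i w
  show T.coverLift e b ν i _ = T.coverLift e b ν i _
  rw [coverLift, coverLift, Prod.fst_add, Prod.snd_add, circ_add_int, map_add, torusAct_add, hw',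
    torusAct_int]

theorem eq_coverLift (hb : b ∉ T.discriminant e) (hν : T.uLine.mkQ ν = b.1)
    (hi : ∀ k, T.ell ν i ≤ T.ell ν k) {z : T.Level} (hz : T.proj z ∈ T.fibre e b)
    {x : Fin m → ℝ} {σ : ℝ}
    (hx : ∀ k, k ≠ i → z.1 k = ‖z.1 k‖ * Complex.exp (2 * Real.pi * x k * Complex.I))
    (hσ : ∏ k, z.1 k - e = ‖∏ k, z.1 k - e‖ * Complex.exp (2 * Real.pi * σ * Complex.I)) :
    z.1 = T.coverLift e b ν i (x, σ) := by
  have := T.neZero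
  have h1 : ∏ k, z.1 k = T.circ e b σ := by
    rw [circ, ← ((mem_fibre_iff hν z).1 hz).2, Real.sqrt_sq (norm_nonneg _), ← hσ]
    ring
  rw [coverLift, ← h1]
  exact eq_torusAct_stdLift (norm_sq_eq_height hν hz) (fun k hk => coord_ne_zero hb hν hi hz hk) hx

/-- The argument functions of a loop are a lift of it to the vector space covering the fibre, and
their increments over one turn form the period whose frame value is the holonomy. -/
theorem tr_eq_frame_cover (hb : b ∉ T.discriminant e) (hν : T.uLine.mkQ ν = b.1)
    (hi : ∀ k, T.ell ν i ≤ T.ell ν k) (A : FlatU1 (T.fibre e b)) {y : T.fibre e b} (p : Path y y)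
    (γ : ℝ → T.Level) (hγ : ∀ τ : unitInterval, (p τ : T.X) = T.proj (γ τ))
    {x : ℝ → Fin m → ℝ} {σ : ℝ → ℝ} (hxc : Continuous x) (hσc : Continuous σ)
    (hx : ∀ τ k, k ≠ i →
      (γ τ).1 k = ‖(γ τ).1 k‖ * Complex.exp (2 * Real.pi * x τ k * Complex.I))
    (hσ : ∀ τ, ∏ k, (γ τ).1 k - e =
      ‖∏ k, (γ τ).1 k - e‖ * Complex.exp (2 * Real.pi * σ τ * Complex.I))
    {w : Fin m → ℤ} {d : ℤ} (hw : x 1 = x 0 + fun k => (w k : ℝ)) (hd : σ 1 = σ 0 + d) :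
    A.tr p = A.frame (cover hb hν hi) (fun k => (w k : ℝ), (d : ℝ)) := by
  let q : Path (x 0, σ 0) ((x 0, σ 0) + ((fun k => (w k : ℝ), (d : ℝ)) : (Fin m → ℝ) × ℝ)) :=
    { toFun := fun τ => (x τ, σ τ)
      continuous_toFun := by fun_prop
      source' := by simp
      target' := by simp [hw, hd] }
  rw [A.tr_eq_frame (cover hb hν hi) q p fun τ => Subtype.ext ?_,
    A.frame_add_period _ (cover_period hb hν hi w d), mul_comm (A.frame _ _),
    mul_inv_cancel_right]
  rw [hγ]
  refine congrArg T.proj (Subtype.ext ?_)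
  exact eq_coverLift hb hν hi (by rw [← hγ]; exact (p τ).2) (hx τ) (hσ τ)

/-- The product of the holonomies along the loops `∂β_j` with exponents `l j`, `∑ l j = 0`, is the
holonomy along the orbit loop `β(l)`. -/
theorem prod_hol_bdry (hb : b ∉ T.discriminant e) (β : T.DiscClasses e b)
    (A : FlatClass (T.fibre e b)) {l : Fin m → ℤ} (hl : ∑ j, l j = 0) {z : T.Level}
    {y : T.fibre e b} (p : Path y y) (hp : T.IsOrbitLoop l z p) :
    ∏ j, A.hol (β.bdry j) ^ l j = A.hol p := by
  obtain ⟨A, rfl⟩ := Quotient.exists_rep A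
  show ∏ j, A.tr (β.bdry j) ^ l j = A.tr p
  obtain ⟨ν, hν⟩ := T.exists_rep b
  obtain ⟨i, hi⟩ := T.exists_min ν
  obtain ⟨c, hc⟩ := β.exists_boundary_lifts hν hi
  let w : Fin m → Fin m → ℤ := fun j k => (Pi.single j 1 : Fin m → ℤ) k + c k
  have h1 : ∀ j, A.tr (β.bdry j) = A.frame (cover hb hν hi) (fun k => (w j k : ℝ), ((1 : ℤ) : ℝ)) := by
    intro j
    obtain ⟨x, σ, hx, hxc, hx1, hσ⟩ := hc j
    refine tr_eq_frame_cover hb hν hi A (β.bdry j)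
      (fun θ => ⟨β.cyl j 1 θ, β.cyl_level j 1 (Set.right_mem_Icc.2 zero_le_one) θ⟩)
      (fun τ => rfl) (x := fun θ k => x k θ) (σ := σ) (by fun_prop) hσ.1
      (fun τ k hk => (hx k hk).2.1 τ) hσ.2.1 ?_ ?_
    · funext k
      simpa [w] using hx1 k 0
    · simpa using hσ.2.2 0
  have h2 : A.tr p = A.frame (cover hb hν hi) (fun k => (l k : ℝ), ((0 : ℤ) : ℝ)) := by
    choose x hx using fun k => exists_eq_norm_mul_exp (z.1 k)
    obtain ⟨σ, hσ⟩ := exists_eq_norm_mul_exp (∏ k, z.1 k - e)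
    -- Since `∑ l k = 0`, the function `χ` is constant along the orbit loop, whose period is
    -- therefore `(l, 0)`.
    have hprod : ∀ τ : ℝ, ∏ k, torusAct (fun k => τ * (l k : ℝ)) z.1 k = ∏ k, z.1 k := fun τ => by
      have : (∑ k, (l k : ℝ)) = 0 := by exact_mod_cast hl
      rw [prod_torusAct, ← Finset.mul_sum, this]
      simp
    refine tr_eq_frame_cover hb hν hi A p
      (fun τ => ⟨torusAct (fun k => τ * (l k : ℝ)) z.1, T.torusAct_mem _ z.2⟩)
      hp (x := fun τ k => x k + τ * l k) (σ := fun _ => σ) (by fun_prop) continuous_const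
      (fun τ k _ => ?_) (fun τ => by simpa only [hprod] using hσ) (by funext k; simp) (by simp)
    simp only [norm_torusAct]
    rw [torusAct]
    conv_lhs => rw [hx k]
    rw [mul_left_comm, ← Complex.exp_add]
    congr 2
    push_cast
    ring
  -- The period of `∂β_j` is `(e_j + c, 1)`. The combination with coefficients `l j` is `(l, 0)`,
  -- because `∑ l j = 0` removes both `c` and the circle direction.
  rw [h2, Finset.prod_congr rfl fun j _ => by rw [h1 j],
    ← A.frame_sum_zsmul _ _ _ l fun j _ => cover_period hb hν hi _ _]
  congr 1
  refine Prod.ext ?_ ?_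
  · rw [Prod.fst_sum]
    funext k
    have h3 : ∑ j, l j * w j k = l k := by
      simp only [w, mul_add, Finset.sum_add_distrib, ← Finset.sum_mul, hl, zero_mul, add_zero]
      rw [Finset.sum_eq_single k (fun j _ hj => by simp [hj.symm]) (by simp)]
      simp
    rw [Finset.sum_apply]
    calc _ = ∑ j, ((l j * w j k : ℤ) : ℝ) := Finset.sum_congr rfl fun j _ => by
          simp
      _ = l k := by exact_mod_cast h3
  · rw [Prod.snd_sum]
    calc _ = ∑ j, (l j : ℝ) := Finset.sum_congr rfl fun j _ => by simp
      _ = ((0 : ℤ) : ℝ) := by exact_mod_cast hl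

end ToricCY

/-! ### Symplectic areas -/

section Stokes

theorem hasDerivAt_im_conj_mul {f g : ℝ → ℂ} {f' g' : ℂ} {x : ℝ} (hf : HasDerivAt f f' x)
    (hg : HasDerivAt g g' x) :
    HasDerivAt (fun t => ((starRingEnd ℂ) (f t) * g t).im)
      (((starRingEnd ℂ) f' * g x).im + ((starRingEnd ℂ) (f x) * g').im) x := by
  have h1 : HasDerivAt (fun t => (starRingEnd ℂ) (f t)) ((starRingEnd ℂ) f') x :=
    Complex.conjCLE.toContinuousLinearMap.hasFDerivAt.comp_hasDerivAt x hf
  have h2 := Complex.imCLM.hasFDerivAt.comp_hasDerivAt x (h1.mul hg)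
  have h3 : Complex.imCLM ((starRingEnd ℂ) f' * g x + (starRingEnd ℂ) (f x) * g') =
    ((starRingEnd ℂ) f' * g x).im + ((starRingEnd ℂ) (f x) * g').im := by simp
  rw [← h3]
  exact h2

theorem im_conj_mul_comm (z w : ℂ) :
    ((starRingEnd ℂ) z * w).im = -((starRingEnd ℂ) w * z).im := by
  simp only [Complex.mul_im, Complex.conj_re, Complex.conj_im]
  ring

theorem im_conj_mul_contDiffOn {E : Type*} [NormedAddCommGroup E] [NormedSpace ℝ E] {f g : E → ℂ}
    {S : Set E} (hf : ContDiffOn ℝ ∞ f S) (hg : ContDiffOn ℝ ∞ g S) :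
    ContDiffOn ℝ ∞ (fun p => ((starRingEnd ℂ) (f p) * g p).im) S :=
  Complex.imCLM.contDiff.comp_contDiffOn
    ((Complex.conjCLE.toContinuousLinearMap.contDiff.comp_contDiffOn hf).mul hg)

theorem HasFDerivAt.hasDerivAt_fst {V : Type*} [NormedAddCommGroup V] [NormedSpace ℝ V]
    {G : ℝ × ℝ → V} {G' : ℝ × ℝ →L[ℝ] V} {s θ : ℝ} (h : HasFDerivAt G G' (s, θ)) :
    HasDerivAt (fun s' => G (s', θ)) (G' (1, 0)) s :=
  h.comp_hasDerivAt s ((hasDerivAt_id s).prodMk (hasDerivAt_const s θ))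

theorem HasFDerivAt.hasDerivAt_snd {V : Type*} [NormedAddCommGroup V] [NormedSpace ℝ V]
    {G : ℝ × ℝ → V} {G' : ℝ × ℝ →L[ℝ] V} {s θ : ℝ} (h : HasFDerivAt G G' (s, θ)) :
    HasDerivAt (fun θ' => G (s, θ')) (G' (0, 1)) θ :=
  h.comp_hasDerivAt θ ((hasDerivAt_const θ s).prodMk (hasDerivAt_id θ))

/-- The area swept by a family of loops in `ℂ` is the difference of the areas enclosed by the last
loop and by the first one. -/
theorem integral_area_eq {f : ℝ → ℝ → ℂ}
    (hf : ContDiffOn ℝ ∞ (fun p : ℝ × ℝ => f p.1 p.2) (Set.Icc 0 1 ×ˢ Set.univ))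
    (hp : ∀ s ∈ Set.Icc (0 : ℝ) 1, ∀ θ, f s (θ + 1) = f s θ) :
    (∫ s in (0 : ℝ)..1, ∫ θ in (0 : ℝ)..1,
      ((starRingEnd ℂ) (deriv (fun s' => f s' θ) s) * deriv (f s) θ).im) =
    ((∫ θ in (0 : ℝ)..1, ((starRingEnd ℂ) (f 1 θ) * deriv (f 1) θ).im) -
      ∫ θ in (0 : ℝ)..1, ((starRingEnd ℂ) (f 0 θ) * deriv (f 0) θ).im) / 2 := by
  set S : Set (ℝ × ℝ) := Set.Icc 0 1 ×ˢ Set.univ with hS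
  set F : ℝ × ℝ → ℂ := fun p => f p.1 p.2 with hF
  have hSu : UniqueDiffOn ℝ S := (uniqueDiffOn_Icc zero_lt_one).prod uniqueDiffOn_univ
  let D : ℝ × ℝ → ℝ × ℝ →L[ℝ] ℂ := fderivWithin ℝ F S
  have hD : ContDiffOn ℝ ∞ D S := hf.fderivWithin hSu (by simp)
  -- `P` and `Q` are the `θ` and `s` components of the pulled-back form `Im (conj z dz)`. Its
  -- differential is twice the area form, since the mixed second derivatives cancel (`hsymm`).
  let P : ℝ × ℝ → ℝ := fun p => ((starRingEnd ℂ) (F p) * D p (0, 1)).im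
  let Q : ℝ × ℝ → ℝ := fun p => ((starRingEnd ℂ) (F p) * D p (1, 0)).im
  have hPc : ContDiffOn ℝ ∞ P S := im_conj_mul_contDiffOn hf (hD.clm_apply contDiffOn_const)
  have hQc : ContDiffOn ℝ ∞ Q S := im_conj_mul_contDiffOn hf (hD.clm_apply contDiffOn_const)
  have hsub : ∀ s ∈ Set.Icc (0 : ℝ) 1, ∀ θ : ℝ, (s, θ) ∈ S := fun s hs θ => ⟨hs, Set.mem_univ _⟩
  have hnhds : ∀ s ∈ Set.Ioo (0 : ℝ) 1, ∀ θ : ℝ, S ∈ nhds (s, θ) := fun s hs θ =>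
    prod_mem_nhds (Icc_mem_nhds hs.1 hs.2) Filter.univ_mem
  have hθ : ∀ s ∈ Set.Icc (0 : ℝ) 1, ∀ θ, HasDerivAt (f s) (D (s, θ) (0, 1)) θ := by
    intro s hs θ
    have h1 : HasFDerivWithinAt F (D (s, θ)) S (s, θ) :=
      (hf.differentiableOn (by simp) _ (hsub s hs θ)).hasFDerivWithinAt
    have h2 : HasDerivAt (fun θ' : ℝ => (s, θ')) (0, 1) θ :=
      (hasDerivAt_const θ s).prodMk (hasDerivAt_id θ)
    have h3 := h1.comp_hasDerivWithinAt (s := Set.univ) θ h2.hasDerivWithinAt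
      (fun θ' _ => hsub s hs θ')
    exact hasDerivWithinAt_univ.1 h3
  have hrect : Set.uIcc (0 : ℝ) 1 ×ˢ Set.uIcc (0 : ℝ) 1 ⊆ S := by
    rw [Set.uIcc_of_le zero_le_one]
    exact Set.prod_mono le_rfl (Set.subset_univ _)
  have hsymm : ∀ s ∈ Set.Ioo (0 : ℝ) 1, ∀ θ,
      fderivWithin ℝ P S (s, θ) (1, 0) - fderivWithin ℝ Q S (s, θ) (0, 1) =
      2 * ((starRingEnd ℂ) (deriv (fun s' => f s' θ) s) * deriv (f s) θ).im := by
    intro s hs θ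
    have hn := hnhds s hs θ
    have hFat : ContDiffAt ℝ ∞ F (s, θ) := hf.contDiffAt hn
    have hF1 : HasFDerivAt F (D (s, θ)) (s, θ) :=
      ((hf.differentiableOn (by simp) _ (mem_of_mem_nhds hn)).hasFDerivWithinAt).hasFDerivAt hn
    have hD1 : HasFDerivAt D (fderiv ℝ D (s, θ)) (s, θ) :=
      ((hD.contDiffAt hn).differentiableAt (by simp)).hasFDerivAt
    have hDe : D =ᶠ[nhds (s, θ)] fderiv ℝ F := by
      filter_upwards [eventually_mem_nhds_iff.2 hn] with p hp'
      exact fderivWithin_of_mem_nhds hp'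
    have hs2 : fderiv ℝ D (s, θ) (1, 0) (0, 1) = fderiv ℝ D (s, θ) (0, 1) (1, 0) := by
      rw [hDe.fderiv_eq]
      exact (hFat.isSymmSndFDerivAt (by simpa using WithTop.coe_le_coe.2 (le_top (a := (2 : ℕ∞))))).eq _ _
    have hD2 : ∀ v, HasFDerivAt (fun p => D p v) ((fderiv ℝ D (s, θ)).flip v) (s, θ) := fun v => by
      simpa using hD1.clm_apply (hasFDerivAt_const v (s, θ))
    have hP1 : HasFDerivAt P (fderivWithin ℝ P S (s, θ)) (s, θ) :=
      ((hPc.differentiableOn (by simp) _ (mem_of_mem_nhds hn)).hasFDerivWithinAt).hasFDerivAt hn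
    have hQ1 : HasFDerivAt Q (fderivWithin ℝ Q S (s, θ)) (s, θ) :=
      ((hQc.differentiableOn (by simp) _ (mem_of_mem_nhds hn)).hasFDerivWithinAt).hasFDerivAt hn
    have e1 := hasDerivAt_im_conj_mul (hF1.hasDerivAt_fst) ((hD2 (0, 1)).hasDerivAt_fst)
    have e2 := hasDerivAt_im_conj_mul (hF1.hasDerivAt_snd) ((hD2 (1, 0)).hasDerivAt_snd)
    have e3 : HasDerivAt (fun s' => P (s', θ)) (fderivWithin ℝ P S (s, θ) (1, 0)) s :=
      hP1.hasDerivAt_fst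
    have e4 : HasDerivAt (fun θ' => Q (s, θ')) (fderivWithin ℝ Q S (s, θ) (0, 1)) θ :=
      hQ1.hasDerivAt_snd
    have hds : deriv (fun s' => f s' θ) s = D (s, θ) (1, 0) := (hF1.hasDerivAt_fst).deriv
    rw [e3.unique e1, e4.unique e2, hds, (hθ s (Set.Ioo_subset_Icc_self hs) θ).deriv]
    simp only [ContinuousLinearMap.flip_apply]
    rw [hs2, im_conj_mul_comm (D (s, θ) (0, 1))]
    ring
  have hint : MeasureTheory.IntegrableOn (fun x => fderivWithin ℝ P S x (1, 0) +
      (-fderivWithin ℝ Q S x) (0, 1)) (Set.uIcc (0 : ℝ) 1 ×ˢ Set.uIcc (0 : ℝ) 1) := by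
    refine ContinuousOn.integrableOn_compact (isCompact_uIcc.prod isCompact_uIcc) ?_
    refine ContinuousOn.mono ?_ hrect
    exact ((hPc.continuousOn_fderivWithin hSu (by simp)).clm_apply continuousOn_const).add
      ((hQc.continuousOn_fderivWithin hSu (by simp)).neg.clm_apply continuousOn_const)
  -- Green's theorem on the unit square. The two sides `θ = 0` and `θ = 1` cancel by periodicity
  -- (`hQp`).
  have hmain := MeasureTheory.integral2_divergence_prod_of_hasFDerivAt P (fun p => -Q p)
    (fun x => fderivWithin ℝ P S x) (fun x => -fderivWithin ℝ Q S x) 0 0 1 1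
    (hPc.continuousOn.mono hrect) (hQc.continuousOn.neg.mono hrect)
    (fun x hx => by
      have hx1 : x.1 ∈ Set.Ioo (0 : ℝ) 1 := by simpa using hx.1
      have hn := hnhds x.1 hx1 x.2
      exact ((hPc.differentiableOn (by simp) _ (mem_of_mem_nhds hn)).hasFDerivWithinAt).hasFDerivAt hn)
    (fun x hx => by
      have hx1 : x.1 ∈ Set.Ioo (0 : ℝ) 1 := by simpa using hx.1
      have hn := hnhds x.1 hx1 x.2
      exact (((hQc.differentiableOn (by simp) _ (mem_of_mem_nhds hn)).hasFDerivWithinAt).hasFDerivAt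
        hn).neg)
    hint
  have hQp : ∀ s ∈ Set.Ioo (0 : ℝ) 1, Q (s, 1) = Q (s, 0) := by
    intro s hs
    have hd : ∀ θ, D (s, θ) (1, 0) = deriv (fun s' => f s' θ) s := fun θ =>
      (((hf.differentiableOn (by simp) _ (mem_of_mem_nhds
        (hnhds s hs θ))).hasFDerivWithinAt).hasFDerivAt (hnhds s hs θ)).hasDerivAt_fst.deriv.symm
    have he : (fun s' => f s' 1) =ᶠ[nhds s] fun s' => f s' 0 := by
      filter_upwards [Icc_mem_nhds hs.1 hs.2] with s' hs'
      simpa using hp s' hs' 0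
    simp only [Q, hd, he.deriv_eq, hF]
    rw [he.eq_of_nhds]
  have hcongr : ∀ {g g' : ℝ → ℝ}, (∀ s ∈ Set.Ioo (0 : ℝ) 1, g s = g' s) →
      ∫ s in (0 : ℝ)..1, g s = ∫ s in (0 : ℝ)..1, g' s := fun {g g'} h => by
    simp only [intervalIntegral.integral_of_le zero_le_one,
      MeasureTheory.integral_Ioc_eq_integral_Ioo]
    exact MeasureTheory.setIntegral_congr_fun measurableSet_Ioo h
  have hL : (∫ s in (0 : ℝ)..1, ∫ θ in (0 : ℝ)..1, fderivWithin ℝ P S (s, θ) (1, 0) +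
      (-fderivWithin ℝ Q S (s, θ)) (0, 1)) = 2 * ∫ s in (0 : ℝ)..1, ∫ θ in (0 : ℝ)..1,
      ((starRingEnd ℂ) (deriv (fun s' => f s' θ) s) * deriv (f s) θ).im := by
    rw [← intervalIntegral.integral_const_mul]
    refine hcongr fun s hs => ?_
    rw [← intervalIntegral.integral_const_mul]
    refine intervalIntegral.integral_congr fun θ _ => ?_
    exact (hsymm s hs θ)
  have hQz : (∫ s in (0 : ℝ)..1, -Q (s, 1)) = ∫ s in (0 : ℝ)..1, -Q (s, 0) :=
    hcongr fun s hs => by rw [hQp s hs]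
  have hPe : ∀ s ∈ Set.Icc (0 : ℝ) 1, (∫ θ in (0 : ℝ)..1, P (s, θ)) =
      ∫ θ in (0 : ℝ)..1, ((starRingEnd ℂ) (f s θ) * deriv (f s) θ).im := fun s hs =>
    intervalIntegral.integral_congr fun θ _ => by simp only [P, hF, (hθ s hs θ).deriv]
  rw [hL, hQz, hPe 1 (by simp), hPe 0 (by simp)] at hmain
  linarith

/-- Smoothness is given only on the closed strip, so the two-sided `s`-derivative is not controlled
at `s = 0, 1`. The one-sided derivatives give a globally continuous density equal to it inside,
which supplies integrability for exchanging sum and integral. -/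
theorem exists_continuous_area_density {f : ℝ → ℝ → ℂ}
    (hf : ContDiffOn ℝ ∞ (fun p : ℝ × ℝ => f p.1 p.2) (Set.Icc 0 1 ×ˢ Set.univ)) :
    ∃ A : ℝ → ℝ → ℝ, Continuous (fun p : ℝ × ℝ => A p.1 p.2) ∧ ∀ s ∈ Set.Ioo (0 : ℝ) 1, ∀ θ,
      ((starRingEnd ℂ) (deriv (fun s' => f s' θ) s) * deriv (f s) θ).im = A s θ := by
  set S : Set (ℝ × ℝ) := Set.Icc 0 1 ×ˢ Set.univ with hS
  set F : ℝ × ℝ → ℂ := fun p => f p.1 p.2 with hF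
  have hSu : UniqueDiffOn ℝ S := (uniqueDiffOn_Icc zero_lt_one).prod uniqueDiffOn_univ
  have hD : ContinuousOn (fderivWithin ℝ F S) S := hf.continuousOn_fderivWithin hSu (by simp)
  let B : ℝ × ℝ → ℝ := fun p =>
    ((starRingEnd ℂ) (fderivWithin ℝ F S p (1, 0)) * fderivWithin ℝ F S p (0, 1)).im
  have hB : ContinuousOn B S := Complex.continuous_im.comp_continuousOn
    ((Complex.continuous_conj.comp_continuousOn (hD.clm_apply continuousOn_const)).mul
      (hD.clm_apply continuousOn_const))
  refine ⟨fun s θ => B (Set.projIcc 0 1 zero_le_one s, θ),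
    hB.comp_continuous (f := fun p : ℝ × ℝ => ((Set.projIcc 0 1 zero_le_one p.1 : ℝ), p.2))
      (by fun_prop) fun p => ⟨(Set.projIcc 0 1 zero_le_one p.1).2, Set.mem_univ _⟩, fun s hs θ => ?_⟩
  have hn : S ∈ nhds (s, θ) := prod_mem_nhds (Icc_mem_nhds hs.1 hs.2) Filter.univ_mem
  have hF1 : HasFDerivAt F (fderivWithin ℝ F S (s, θ)) (s, θ) :=
    ((hf.differentiableOn (by simp) _ (mem_of_mem_nhds hn)).hasFDerivWithinAt).hasFDerivAt hn
  beta_reduce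
  rw [hF1.hasDerivAt_fst.deriv, show deriv (f s) θ = _ from hF1.hasDerivAt_snd.deriv,
    Set.projIcc_of_mem zero_le_one (Set.Ioo_subset_Icc_self hs)]

end Stokes

/-! ### The Liouville form on loops in a regular fibre -/

/-- The logarithmic derivative of a product. -/
theorem hasDerivAt_prod_of_ne_zero {ι : Type*} (s : Finset ι) {f : ι → ℝ → ℂ} {f' : ι → ℂ} {x : ℝ}
    (hf : ∀ k ∈ s, HasDerivAt (f k) (f' k) x) (h0 : ∀ k ∈ s, f k x ≠ 0) :
    HasDerivAt (fun t => ∏ k ∈ s, f k t) ((∏ k ∈ s, f k x) * ∑ k ∈ s, f' k / f k x) x := by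
  classical
  induction s using Finset.induction_on with
  | empty => simpa using hasDerivAt_const x (1 : ℂ)
  | insert a s ha ih =>
    have h1 := hf a (Finset.mem_insert_self a s)
    have h2 := h0 a (Finset.mem_insert_self a s)
    have h3 := h1.mul (ih (fun k hk => hf k (Finset.mem_insert_of_mem hk))
      fun k hk => h0 k (Finset.mem_insert_of_mem hk))
    simp only [Finset.prod_insert ha, Finset.sum_insert ha]
    refine HasDerivAt.congr_deriv h3 ?_
    have h4 : f a x * (f' a / f a x) = f' a := mul_div_cancel₀ _ h2
    linear_combination -(∏ k ∈ s, f k x) * h4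

theorem conj_mul_eq_norm_sq (z : ℂ) : (starRingEnd ℂ) z * z = ((‖z‖ ^ 2 : ℝ) : ℂ) := by
  rw [mul_comm, Complex.mul_conj, Complex.normSq_eq_norm_sq]

/-- The derivative of the `i`-th coordinate, which may vanish and have no argument, is traded for
that of the product. On a fibre the differences of square moduli are constant, so the first sum
integrates to winding numbers, and the last term depends only on `χ`. -/
theorem sum_im_conj_mul {m : ℕ} {γ : Fin m → ℂ} {γ' : Fin m → ℂ} {i : Fin m}
    (h0 : ∀ k, k ≠ i → γ k ≠ 0) :
    ∑ k, ((starRingEnd ℂ) (γ k) * γ' k).im =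
      ∑ k ∈ Finset.univ.erase i, (‖γ k‖ ^ 2 - ‖γ i‖ ^ 2) * (γ' k / γ k).im +
      ((starRingEnd ℂ) (∏ k, γ k) * (γ' i * ∏ k ∈ Finset.univ.erase i, γ k +
        γ i * ((∏ k ∈ Finset.univ.erase i, γ k) * ∑ k ∈ Finset.univ.erase i, γ' k / γ k))).im /
        ∏ k ∈ Finset.univ.erase i, ‖γ k‖ ^ 2 := by
  set P := ∏ k ∈ Finset.univ.erase i, γ k with hP
  set L := ∑ k ∈ Finset.univ.erase i, γ' k / γ k with hL
  have hP0 : (∏ k ∈ Finset.univ.erase i, ‖γ k‖ ^ 2) = ‖P‖ ^ 2 := by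
    rw [hP, norm_prod, Finset.prod_pow]
  have hPn : ‖P‖ ^ 2 ≠ 0 := pow_ne_zero 2 (norm_ne_zero_iff.2
    (Finset.prod_ne_zero_iff.2 fun k hk => h0 k (Finset.ne_of_mem_erase hk)))
  have h1 : (starRingEnd ℂ) (∏ k, γ k) * (γ' i * P + γ i * (P * L)) =
      ((‖P‖ ^ 2 : ℝ) : ℂ) * ((starRingEnd ℂ) (γ i) * γ' i + ((‖γ i‖ ^ 2 : ℝ) : ℂ) * L) := by
    rw [← Finset.mul_prod_erase _ _ (Finset.mem_univ i), ← hP, map_mul, ← conj_mul_eq_norm_sq,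
      ← conj_mul_eq_norm_sq]
    ring
  have h2 : ∀ k ∈ Finset.univ.erase i, ((starRingEnd ℂ) (γ k) * γ' k).im =
      ‖γ k‖ ^ 2 * (γ' k / γ k).im := fun k hk => by
    have : (starRingEnd ℂ) (γ k) * γ' k = ((‖γ k‖ ^ 2 : ℝ) : ℂ) * (γ' k / γ k) := by
      rw [← conj_mul_eq_norm_sq, mul_assoc, mul_div_cancel₀ _ (h0 k (Finset.ne_of_mem_erase hk))]
    rw [this, Complex.im_ofReal_mul]
  rw [h1, hP0, Complex.im_ofReal_mul, mul_div_cancel_left₀ _ hPn, Complex.add_im,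
    Complex.im_ofReal_mul, ← Finset.add_sum_erase _ _ (Finset.mem_univ i), Finset.sum_congr rfl h2]
  simp only [sub_mul, Finset.sum_sub_distrib, ← Finset.mul_sum, hL, Complex.im_sum]
  ring

namespace ToricCY

variable {n m : ℕ} {T : ToricCY n m} {e : ℂ} {b : T.Base} {ν : Fin n → ℝ} {i : Fin m}

/-- The part of the Liouville form of a loop in a regular fibre that comes from the circle
`|χ - e|² = b₂`. -/
def liouvilleDensity (T : ToricCY n m) (e : ℂ) (b : T.Base) (ν : Fin n → ℝ) (i : Fin m) (σ : ℝ) : ℝ :=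
  ((starRingEnd ℂ) (T.circ e b σ) * deriv (T.circ e b) σ).im /
    ∏ k ∈ Finset.univ.erase i, (T.ell ν k + height (T.ell ν) (‖T.circ e b σ‖ ^ 2))

theorem circ_periodic : Function.Periodic (T.circ e b) 1 := fun σ => by
  simpa using circ_add_int (e := e) (b := b) σ 1

theorem liouvilleDensity_periodic : Function.Periodic (T.liouvilleDensity e b ν i) 1 := fun σ => by
  have h : deriv (T.circ e b) (σ + 1) = deriv (T.circ e b) σ := by
    rw [← deriv_comp_add_const, funext circ_periodic]
  simp only [liouvilleDensity, circ_periodic σ, h]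

theorem continuous_liouvilleDensity (hb : b ∉ T.discriminant e) (hν : T.uLine.mkQ ν = b.1)
    (hi : ∀ k, T.ell ν i ≤ T.ell ν k) : Continuous (T.liouvilleDensity e b ν i) := by
  have := T.neZero
  have hc : Continuous (T.circ e b) := contDiff_circ.continuous
  have hc' : Continuous (deriv (T.circ e b)) := contDiff_circ.continuous_deriv (by simp)
  have hpos : ∀ σ k, k ≠ i → 0 < T.ell ν k + height (T.ell ν) (‖T.circ e b σ‖ ^ 2) :=
    fun σ k hk => ell_add_height_pos hb hν hi (norm_sq_circ_sub σ) hk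
  have hh : Continuous fun σ => height (T.ell ν) (‖T.circ e b σ‖ ^ 2) :=
    continuous_iff_continuousAt.2 fun σ => (contDiffAt_height_comp contDiffAt_const
      (contDiff_circ.norm_sq ℝ).contDiffAt (fun _ => sq_nonneg _) (hpos σ)).continuousAt
  refine Continuous.div (Complex.continuous_im.comp ((Complex.continuous_conj.comp hc).mul hc')) ?_
    fun σ => (Finset.prod_pos fun k hk => hpos σ k (Finset.ne_of_mem_erase hk)).ne'
  exact continuous_finsetProd _ fun k _ => continuous_const.add hh

/-- Only the winding numbers of the loop enter: each logarithmic derivative integrates to `2π w k`,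
and the rest is the integral of a periodic density over one turn of `χ` around `e`, the same for all
such loops. -/
theorem integral_liouville (hb : b ∉ T.discriminant e) (hν : T.uLine.mkQ ν = b.1)
    (hi : ∀ k, T.ell ν i ≤ T.ell ν k) {γ : ℝ → Fin m → ℂ} (hγ : ContDiff ℝ ∞ γ)
    (hl : ∀ θ, γ θ ∈ T.Level) (hf : ∀ θ, T.proj ⟨γ θ, hl θ⟩ ∈ T.fibre e b)
    {x : Fin m → ℝ → ℝ} {w : Fin m → ℤ} {σ : ℝ → ℝ}
    (hx : ∀ k, k ≠ i → IsArgLift (fun θ => γ θ k) (x k) (w k))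
    (hσ : IsArgLift (fun θ => ∏ k, γ θ k - e) σ 1) :
    ∫ θ in (0 : ℝ)..1, ∑ k, ((starRingEnd ℂ) (γ θ k) * deriv (fun θ' => γ θ' k) θ).im =
      2 * Real.pi * ∑ k ∈ Finset.univ.erase i, (T.ell ν k - T.ell ν i) * w k +
        ∫ σ in (0 : ℝ)..1, T.liouvilleDensity e b ν i σ := by
  have hγk : ∀ k, ContDiff ℝ ∞ fun θ => γ θ k := fun k => contDiff_pi.1 hγ k
  have hd : ∀ k θ, HasDerivAt (fun θ => γ θ k) (deriv (fun θ' => γ θ' k) θ) θ := fun k θ =>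
    ((hγk k).differentiable (by simp) θ).hasDerivAt
  have hdc : ∀ k, Continuous (deriv fun θ' => γ θ' k) := fun k =>
    (hγk k).continuous_deriv (by simp)
  have h0 : ∀ θ k, k ≠ i → γ θ k ≠ 0 := fun θ k hk => coord_ne_zero hb hν hi (hf θ) hk
  have hnorm := fun θ => norm_sq_eq_height hν (hf θ)
  have hχ : ContDiff ℝ ∞ fun θ => ∏ k, γ θ k - e :=
    (contDiff_prod fun k _ => hγk k).sub contDiff_const
  have hχ0 : ∀ θ, ∏ k, γ θ k - e ≠ 0 := fun θ h => by
    have := ((mem_fibre_iff hν _).1 (hf θ)).2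
    rw [h] at this
    exact snd_ne_zero_of_regular hb (by rw [← this]; simp)
  have hσd : ∀ θ, HasDerivAt σ
      ((deriv (fun θ => ∏ k, γ θ k - e) θ / (∏ k, γ θ k - e)).im / (2 * Real.pi)) θ := fun θ =>
    hσ.hasDerivAt ((hχ.differentiable (by simp) θ).hasDerivAt) (hχ0 θ)
  have hσc : Continuous fun θ =>
      ((deriv (fun θ => ∏ k, γ θ k - e) θ / (∏ k, γ θ k - e)).im / (2 * Real.pi)) :=
    (Complex.continuous_im.comp ((hχ.continuous_deriv (by simp)).div hχ.continuous hχ0)).div_const _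
  set σ' : ℝ → ℝ := fun θ =>
      ((deriv (fun θ => ∏ k, γ θ k - e) θ / (∏ k, γ θ k - e)).im / (2 * Real.pi)) with hσ'
  have hcirc : ∀ θ, ∏ k, γ θ k = T.circ e b (σ θ) := fun θ => by
    rw [circ, ← ((mem_fibre_iff hν _).1 (hf θ)).2, Real.sqrt_sq (norm_nonneg _), ← hσ.2.1 θ]
    ring
  have hpt : ∀ θ, ∑ k, ((starRingEnd ℂ) (γ θ k) * deriv (fun θ' => γ θ' k) θ).im =
      ∑ k ∈ Finset.univ.erase i, (T.ell ν k - T.ell ν i) * (deriv (fun θ' => γ θ' k) θ / γ θ k).im +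
        T.liouvilleDensity e b ν i (σ θ) * σ' θ := by
    intro θ
    rw [sum_im_conj_mul (h0 θ)]
    congr 1
    · refine Finset.sum_congr rfl fun k _ => ?_
      rw [hnorm θ k, hnorm θ i]
      ring
    · have e1 := (hd i θ).mul (hasDerivAt_prod_of_ne_zero (Finset.univ.erase i)
        (f := fun k θ => γ θ k) (fun k _ => hd k θ) fun k hk => h0 θ k (Finset.ne_of_mem_erase hk))
      have e2 : HasDerivAt (fun θ => T.circ e b (σ θ)) (σ' θ • deriv (T.circ e b) (σ θ)) θ :=
        HasDerivAt.scomp θ ((contDiff_circ.differentiable (by simp) _).hasDerivAt) (hσd θ)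
      have e3 : (fun θ => T.circ e b (σ θ)) =
          (fun θ => γ θ i) * fun θ => ∏ k ∈ Finset.univ.erase i, γ θ k := by
        funext θ
        rw [← hcirc, Pi.mul_apply, Finset.mul_prod_erase _ _ (Finset.mem_univ i)]
      rw [e3] at e2
      -- The derivative of `χ`, computed once by the product rule and once through its angle `σ` on
      -- the circle.
      have e4 := e1.unique e2
      rw [e4, hcirc, liouvilleDensity, Finset.prod_congr rfl fun k _ => hnorm θ k]
      simp only [hcirc]
      rw [mul_smul_comm, Complex.smul_im, smul_eq_mul]
      ring
  have hg := continuous_liouvilleDensity hb hν hi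
  have hcont : Continuous σ := hσ.1
  simp only [hpt]
  rw [intervalIntegral.integral_add, intervalIntegral.integral_finsetSum]
  · congr 1
    · rw [Finset.mul_sum]
      refine Finset.sum_congr rfl fun k hk => ?_
      have hk' := Finset.ne_of_mem_erase hk
      rw [intervalIntegral.integral_const_mul,
        (hx k hk').integral_im_div (hd k) (hdc k) fun θ => h0 θ k hk']
      ring
    · have h1 := intervalIntegral.integral_comp_mul_deriv (a := 0) (b := 1) (f := σ) (f' := σ')
        (g := T.liouvilleDensity e b ν i) (fun θ _ => hσd θ) hσc.continuousOn hg
      simp only [Function.comp_apply] at h1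
      have h2 := hσ.2.2 0
      rw [zero_add, Int.cast_one] at h2
      rw [h1, h2, liouvilleDensity_periodic.intervalIntegral_add_eq (σ 0) 0, zero_add]
  · intro k hk
    refine Continuous.intervalIntegrable ?_ _ _
    exact continuous_const.mul (Complex.continuous_im.comp ((hdc k).div (hγk k).continuous
      fun θ => h0 θ k (Finset.ne_of_mem_erase hk)))
  · refine Continuous.intervalIntegrable (continuous_finsetSum _ fun k hk => ?_) _ _
    exact continuous_const.mul (Complex.continuous_im.comp ((hdc k).div (hγk k).continuous
      fun θ => h0 θ k (Finset.ne_of_mem_erase hk)))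
  · exact ((hg.comp hcont).mul hσc).intervalIntegrable _ _

end ToricCY

namespace ToricCY

variable {n m : ℕ} {T : ToricCY n m} {e : ℂ} {b : T.Base}

/-! ### The areas of the classes `β_j` -/

theorem _root_.hasDerivAt_exp_two_pi_mul (z : ℂ) (θ : ℝ) :
    HasDerivAt (fun θ' : ℝ => Complex.exp (2 * Real.pi * θ' * Complex.I) * z)
      (2 * Real.pi * Complex.I * (Complex.exp (2 * Real.pi * θ * Complex.I) * z)) θ := by
  have h1 : HasDerivAt (fun θ' : ℝ => (2 * Real.pi * θ' * Complex.I : ℂ))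
      (2 * Real.pi * Complex.I) θ := by
    have := ((Complex.ofRealCLM.hasDerivAt (x := θ)).const_mul
      (2 * Real.pi : ℂ)).mul_const Complex.I
    simpa using this
  exact (h1.cexp.mul_const z).congr_deriv (by ring)

/-- Only the `j`-th coordinate rotates, so the others contribute nothing. As `ν₀` lies on the `j`-th
facet, that coordinate is `s` times the rotated `z j` and sweeps out a round disc. -/
theorem symplecticArea_basicDisc {ν₀ : Fin n → ℝ} {z : Fin m → ℂ} {j : Fin m}
    (h : T.ell ν₀ j = 0) : symplecticArea (T.basicDisc ν₀ z j) = ‖z j‖ ^ 2 := by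
  have hθ : ∀ s θ i, HasDerivAt (fun θ' => T.basicDisc ν₀ z j s θ' i)
      (if i = j then 2 * Real.pi * Complex.I * T.basicDisc ν₀ z j s θ j else 0) θ := by
    intro s θ i
    by_cases hi : i = j
    · subst hi
      simp only [if_true, basicDisc, torusAct, Pi.single_eq_same]
      exact hasDerivAt_exp_two_pi_mul _ θ
    · simp only [if_neg hi, basicDisc, torusAct, Pi.single_eq_of_ne hi]
      exact hasDerivAt_const _ _
  have hj : ∀ s θ, 0 ≤ s → T.basicDisc ν₀ z j s θ j =
      s * (Complex.exp (2 * Real.pi * θ * Complex.I) * z j) := by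
    intro s θ hs
    simp only [basicDisc, torusAct, Pi.single_eq_same, h, mul_zero, zero_div, add_zero,
      Real.sqrt_sq hs]
    ring
  have hs : ∀ s θ, 0 < s → HasDerivAt (fun s' => T.basicDisc ν₀ z j s' θ j)
      (Complex.exp (2 * Real.pi * θ * Complex.I) * z j) s := by
    intro s θ hs
    have h1 : HasDerivAt (fun s' : ℝ => s' * (Complex.exp (2 * Real.pi * θ * Complex.I) * z j))
        (Complex.exp (2 * Real.pi * θ * Complex.I) * z j) s := by
      simpa using (Complex.ofRealCLM.hasDerivAt (x := s)).mul_const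
        (Complex.exp (2 * Real.pi * θ * Complex.I) * z j)
    refine h1.congr_of_eventuallyEq ?_
    filter_upwards [lt_mem_nhds hs] with s' hs' using hj s' θ hs'.le
  have hval : ∀ s ∈ Set.Ioo (0 : ℝ) 1, (∫ θ in (0 : ℝ)..1, (1 / Real.pi) *
      ∑ i, ((starRingEnd ℂ) (deriv (fun s' => T.basicDisc ν₀ z j s' θ i) s) *
        deriv (fun θ' => T.basicDisc ν₀ z j s θ' i) θ).im) = 2 * s * ‖z j‖ ^ 2 := by
    intro s hs0
    have hpt : ∀ θ : ℝ, (1 / Real.pi) *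
      ∑ i, ((starRingEnd ℂ) (deriv (fun s' => T.basicDisc ν₀ z j s' θ i) s) *
        deriv (fun θ' => T.basicDisc ν₀ z j s θ' i) θ).im = 2 * s * ‖z j‖ ^ 2 := by
      intro θ
      rw [Finset.sum_eq_single j (fun i _ hi => by rw [(hθ s θ i).deriv, if_neg hi]; simp) (by simp),
        (hθ s θ j).deriv, if_pos rfl, (hs s θ hs0.1).deriv, hj s θ hs0.1.le]
      have h1 := conj_mul_eq_norm_sq (Complex.exp (2 * Real.pi * θ * Complex.I) * z j)
      rw [norm_mul, norm_exp_two_pi, one_mul] at h1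
      have h2 : ∀ w : ℂ, (starRingEnd ℂ) w * (2 * Real.pi * Complex.I * (s * w)) =
          ((2 * Real.pi * s : ℝ) : ℂ) * (((starRingEnd ℂ) w * w) * Complex.I) := fun w => by
        push_cast; ring
      rw [h2, h1, Complex.im_ofReal_mul, Complex.im_ofReal_mul, Complex.I_im]
      field_simp
    simp only [hpt]
    simp
  rw [symplecticArea, intervalIntegral.integral_congr_Ioo_of_le zero_le_one hval,
    intervalIntegral.integral_mul_const, intervalIntegral.integral_const_mul, integral_id]
  norm_num

namespace DiscClasses

variable (β : T.DiscClasses e b)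

theorem contDiff_cyl {s : ℝ} (hs : s ∈ Set.Icc (0 : ℝ) 1) (j : Fin m) :
    ContDiff ℝ ∞ (β.cyl j s) := by
  have h1 : ContDiffOn ℝ ∞ (fun θ : ℝ => β.cyl j s θ) Set.univ :=
    (β.cyl_smooth j).comp (f := fun θ : ℝ => (s, θ))
      (contDiff_const.prodMk contDiff_id).contDiffOn fun θ _ => ⟨hs, Set.mem_univ _⟩
  exact contDiffOn_univ.1 h1

/-- By Stokes the cylinder contributes the difference of the Liouville integrals at its ends, and
the one at `s = 0` cancels the area `|z₀ j|²` of the basic disc. -/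
theorem area_eq (j : Fin m) : β.area j = (∫ θ in (0 : ℝ)..1,
    ∑ k, ((starRingEnd ℂ) (β.cyl j 1 θ k) * deriv (fun θ' => β.cyl j 1 θ' k) θ).im) /
      (2 * Real.pi) := by
  have hc : ∀ k, ContDiffOn ℝ ∞ (fun p : ℝ × ℝ => β.cyl j p.1 p.2 k) (Set.Icc 0 1 ×ˢ Set.univ) :=
    fun k => contDiffOn_pi.1 (β.cyl_smooth j) k
  have hk := fun k => integral_area_eq (f := fun s θ => β.cyl j s θ k) (hc k) fun s hs θ => by
    rw [β.cyl_periodic j s hs]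
  choose A hAc hA using fun k => exists_continuous_area_density (f := fun s θ => β.cyl j s θ k) (hc k)
  have hcyl : symplecticArea (β.cyl j) = (1 / Real.pi) * ∑ k, ((∫ θ in (0 : ℝ)..1,
      ((starRingEnd ℂ) (β.cyl j 1 θ k) * deriv (fun θ' => β.cyl j 1 θ' k) θ).im) -
      ∫ θ in (0 : ℝ)..1, ((starRingEnd ℂ) (β.cyl j 0 θ k) *
        deriv (fun θ' => β.cyl j 0 θ' k) θ).im) / 2 := by
    simp only [← hk]
    have e1 : ∀ k, (∫ s in (0 : ℝ)..1, ∫ θ in (0 : ℝ)..1,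
        ((starRingEnd ℂ) (deriv (fun s' => β.cyl j s' θ k) s) *
          deriv (fun θ' => β.cyl j s θ' k) θ).im) = ∫ s in (0 : ℝ)..1, ∫ θ in (0 : ℝ)..1, A k s θ :=
      fun k => intervalIntegral.integral_congr_Ioo_of_le zero_le_one fun s hs =>
        intervalIntegral.integral_congr fun θ _ => hA k s hs θ
    have e2 : symplecticArea (β.cyl j) = ∫ s in (0 : ℝ)..1, ∫ θ in (0 : ℝ)..1,
        (1 / Real.pi) * ∑ k, A k s θ :=
      intervalIntegral.integral_congr_Ioo_of_le zero_le_one fun s hs =>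
        intervalIntegral.integral_congr fun θ _ => by
          simp only [hA _ s hs θ]
    have hAθ : ∀ k s, Continuous fun θ => A k s θ := fun k s =>
      (hAc k).comp (continuous_const.prodMk continuous_id)
    rw [e2, Finset.sum_congr rfl fun k _ => e1 k]
    simp only [intervalIntegral.integral_const_mul]
    congr 1
    rw [← intervalIntegral.integral_finsetSum fun k _ => ?_]
    · refine intervalIntegral.integral_congr fun s _ => ?_
      exact intervalIntegral.integral_finsetSum fun k _ => (hAθ k s).intervalIntegrable _ _
    · exact (intervalIntegral.continuous_parametric_intervalIntegral_of_continuous'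
        (hAc k) 0 1).intervalIntegrable _ _
  have h0 : ∀ k, (∫ θ in (0 : ℝ)..1, ((starRingEnd ℂ) (β.cyl j 0 θ k) *
      deriv (fun θ' => β.cyl j 0 θ' k) θ).im) =
        if k = j then 2 * Real.pi * ‖β.z₀ j j‖ ^ 2 else 0 := by
    intro k
    simp only [β.cyl_zero, torusAct]
    by_cases hkj : k = j
    · subst hkj
      simp only [if_true, Pi.single_eq_same]
      have h1 : ∀ θ : ℝ, deriv (fun θ' : ℝ => Complex.exp (2 * Real.pi * θ' * Complex.I) * β.z₀ k k) θ =
          2 * Real.pi * Complex.I * (Complex.exp (2 * Real.pi * θ * Complex.I) * β.z₀ k k) :=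
        fun θ => by rw [(hasDerivAt_exp_two_pi_mul _ θ).deriv]
      have h2 : ∀ w : ℂ, (starRingEnd ℂ) w * (2 * Real.pi * Complex.I * w) =
          ((2 * Real.pi : ℝ) : ℂ) * (((starRingEnd ℂ) w * w) * Complex.I) := fun w => by
        push_cast; ring
      simp only [h1, h2, conj_mul_eq_norm_sq, norm_mul, norm_exp_two_pi, one_mul,
        Complex.im_ofReal_mul, Complex.I_im, mul_one]
      simp
    · simp [hkj]
  rw [area, symplecticArea_basicDisc (β.ν₀_facet j).1, hcyl,
    intervalIntegral.integral_finsetSum fun k _ => ?_]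
  · rw [← Finset.sum_div, Finset.sum_sub_distrib]
    simp only [h0]
    rw [Finset.sum_ite_eq' Finset.univ j]
    simp only [Finset.mem_univ, if_true]
    field_simp
    ring
  · have h1 := contDiff_pi.1 (β.contDiff_cyl (Set.right_mem_Icc.2 zero_le_one) j) k
    exact (Complex.continuous_im.comp ((Complex.continuous_conj.comp h1.continuous).mul
      (h1.continuous_deriv (by simp)))).intervalIntegrable _ _

/-- The areas differ from `ell ν j - ell ν i` by a quantity that does not depend on `j`, and `∑ l j
= 0` removes that quantity and `ell ν i`. -/
theorem sum_area (hb : b ∉ T.discriminant e) {ν : Fin n → ℝ} (hν : T.uLine.mkQ ν = b.1)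
    {l : Fin m → ℤ} (hl : ∑ j, l j = 0) : ∑ j, l j * β.area j = ∑ k, l k * T.ell ν k := by
  obtain ⟨i, hi⟩ := T.exists_min ν
  obtain ⟨c, hc⟩ := β.exists_boundary_lifts hν hi
  have h1 : (1 : ℝ) ∈ Set.Icc (0 : ℝ) 1 := Set.right_mem_Icc.2 zero_le_one
  have hl' : ∑ j, (l j : ℝ) = 0 := by exact_mod_cast hl
  have ha : ∀ j, β.area j = (∑ k ∈ Finset.univ.erase i, (T.ell ν k - T.ell ν i) *
      (((Pi.single j 1 : Fin m → ℤ) k + c k : ℤ) : ℝ)) +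
        (∫ σ in (0 : ℝ)..1, T.liouvilleDensity e b ν i σ) / (2 * Real.pi) := by
    intro j
    obtain ⟨x, σ, hx, -, -, hσ⟩ := hc j
    rw [β.area_eq, integral_liouville hb hν hi (β.contDiff_cyl h1 j) (β.cyl_level j 1 h1)
      (fun θ => (β.bdryPt j θ).2) hx hσ, add_div, mul_div_cancel_left₀ _ (by positivity)]
  simp only [ha, mul_add, Finset.sum_add_distrib, ← Finset.sum_mul, hl', zero_mul, add_zero,
    Finset.mul_sum]
  rw [Finset.sum_comm]
  have h2 : ∀ k, ∑ j, (l j : ℝ) * ((T.ell ν k - T.ell ν i) *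
      (((Pi.single j 1 : Fin m → ℤ) k + c k : ℤ) : ℝ)) = l k * (T.ell ν k - T.ell ν i) := by
    intro k
    have h3 : ∑ j, l j * ((Pi.single j 1 : Fin m → ℤ) k + c k) = l k := by
      simp only [mul_add, Finset.sum_add_distrib, ← Finset.sum_mul, hl, zero_mul, add_zero]
      rw [Finset.sum_eq_single k (fun j _ hj => by simp [hj.symm]) (by simp)]
      simp
    have h4 : ∑ j, (l j : ℝ) * (((Pi.single j 1 : Fin m → ℤ) k + c k : ℤ) : ℝ) = l k := by
      exact_mod_cast h3
    rw [← h4, Finset.sum_mul]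
    exact Finset.sum_congr rfl fun j _ => by ring
  rw [Finset.sum_congr rfl fun k _ => h2 k]
  have h5 := Finset.add_sum_erase Finset.univ (fun k => (l k : ℝ) * (T.ell ν k - T.ell ν i))
    (Finset.mem_univ i)
  simp only [sub_self, mul_zero, zero_add] at h5
  rw [h5]
  simp only [mul_sub, Finset.sum_sub_distrib, ← Finset.sum_mul, hl', zero_mul, sub_zero]

end DiscClasses
end ToricCY

/-! ### Existence of the classes `β_j` -/

theorem stdLift_exp_mul {m : ℕ} (a : Fin m → ℝ) (i : Fin m) (χ : ℂ) (θ : ℝ) :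
    stdLift a i (χ * Complex.exp (2 * Real.pi * θ * Complex.I)) =
      torusAct (Pi.single i θ) (stdLift a i χ) := by
  have hn : ‖χ * Complex.exp (2 * Real.pi * θ * Complex.I)‖ = ‖χ‖ := by
    rw [norm_mul, norm_exp_two_pi, mul_one]
  funext k
  by_cases hk : k = i
  · subst hk
    rw [torusAct, stdLift_self, stdLift_self, hn, Pi.single_eq_same]
    ring
  · rw [torusAct, stdLift_of_ne _ hk, stdLift_of_ne _ hk, hn, Pi.single_eq_of_ne hk]
    simp

theorem shear_single {m : ℕ} (i j : Fin m) (θ : ℝ) :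
    shear i (Pi.single j θ) = Pi.single j θ - Pi.single i θ := by
  rw [shear_apply, Finset.sum_pi_single']
  simp

namespace ToricCY

variable {n m : ℕ} {T : ToricCY n m} {e : ℂ} {b : T.Base}

/-- Along the segment from `ν + d` to `ν` the fibres over the wall have `i` as the only index of a
coordinate that vanishes somewhere. -/
def IsWallIndex (e : ℂ) (b : T.Base) (ν d : Fin n → ℝ) (i : Fin m) : Prop :=
  ∀ s ∈ Set.Icc (0 : ℝ) 1, (b.2 : ℝ) = ‖(s * e : ℂ)‖ ^ 2 →
    ∀ k, k ≠ i → T.ell (ν + (1 - s) • d) i < T.ell (ν + (1 - s) • d) k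

/-- If `b₂ < |e|²`, the wall is met exactly at `s = √b₂ / |e| < 1`, and `d` is scaled so that the
segment then passes through a point lying on the `i`-th facet and no other. If `b₂ = |e|²`, the
constant segment works, since a tie for the minimum would put `b` in the discriminant. If `b₂ >
|e|²`, the wall is never met. -/
theorem exists_isWallIndex (he : e ≠ 0) (hb : b ∉ T.discriminant e) {ν : Fin n → ℝ}
    (hν : T.uLine.mkQ ν = b.1) : ∃ d i, T.IsWallIndex e b ν d i := by
  obtain ⟨i, hi⟩ := T.exists_min ν
  have he' : 0 < ‖e‖ := norm_pos_iff.2 he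
  have hn : ∀ s ∈ Set.Icc (0 : ℝ) 1, ‖(s * e : ℂ)‖ = s * ‖e‖ := fun s hs => by
    rw [norm_mul, Complex.norm_real, Real.norm_of_nonneg hs.1]
  rcases lt_trichotomy (b.2 : ℝ) (‖e‖ ^ 2) with h | h | h
  · obtain ⟨ν', hν', hν''⟩ := T.facet i
    have hr : Real.sqrt b.2 / ‖e‖ < 1 := by
      rw [div_lt_one he', ← Real.sqrt_sq he'.le]
      exact Real.sqrt_lt_sqrt b.2.coe_nonneg h
    refine ⟨(1 - Real.sqrt b.2 / ‖e‖)⁻¹ • (ν' - ν), i, fun s hs hse k hk => ?_⟩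
    have hs' : s = Real.sqrt b.2 / ‖e‖ := by
      rw [hse, Real.sqrt_sq (norm_nonneg _), hn s hs, mul_div_cancel_right₀ _ he'.ne']
    rw [hs', smul_smul, mul_inv_cancel₀ (by linarith), one_smul, add_sub_cancel]
    exact hν'.trans_lt (hν'' k hk)
  · refine ⟨0, i, fun s hs hse k hk => lt_of_le_of_ne ?_ fun hik => hb (Or.inr ⟨?_, ?_⟩)⟩
    · simpa using hi k
    · rw [← NNReal.coe_inj, h]; simp
    · simp only [smul_zero, add_zero] at hik
      refine ⟨ν + (-T.ell ν i) • fun a => (T.u a : ℝ), fun j => ?_, i, k, hk.symm, ?_, ?_, ?_⟩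
      · rw [ell_add_smul_u]; linarith [hi j]
      · rw [ell_add_smul_u]; ring
      · rw [ell_add_smul_u, hik]; ring
      · rw [← hν, mkQ_eq_iff]; exact ⟨_, rfl⟩
  · refine ⟨0, i, fun s hs hse => absurd hse (ne_of_gt (lt_of_le_of_lt ?_ h))⟩
    rw [hn s hs]
    exact pow_le_pow_left₀ (mul_nonneg hs.1 he'.le) (mul_le_of_le_one_left he'.le hs.2) 2

theorem IsWallIndex.pos {ν d : Fin n → ℝ} {i : Fin m} (h : T.IsWallIndex e b ν d i) {s : ℝ}
    (hs : s ∈ Set.Icc (0 : ℝ) 1) {χ : ℂ} (hχ : ‖χ - s * e‖ ^ 2 = b.2) {k : Fin m} (hk : k ≠ i) :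
    0 < T.ell (ν + (1 - s) • d) k + height (T.ell (ν + (1 - s) • d)) (‖χ‖ ^ 2) := by
  have := T.neZero
  have h1 := height_nonneg (T.ell (ν + (1 - s) • d)) (sq_nonneg ‖χ‖)
  refine lt_of_le_of_ne (h1 k) fun h0 => ?_
  have h2 := prod_height (T.ell (ν + (1 - s) • d)) (sq_nonneg ‖χ‖)
  rw [Finset.prod_eq_zero (Finset.mem_univ k) h0.symm, eq_comm, sq_eq_zero_iff, norm_eq_zero] at h2
  rw [h2, zero_sub, norm_neg] at hχ
  have h3 := h s hs hχ.symm k hk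
  linarith [h1 i]

theorem IsWallIndex.regular (hb : (b.2 : ℝ) ≠ 0) {ν d : Fin n → ℝ} {i : Fin m}
    (h : T.IsWallIndex e b ν d i) {s : ℝ} (hs : s ∈ Set.Icc (0 : ℝ) 1) :
    ((T.uLine.mkQ (ν + (1 - s) • d), b.2) : T.Base) ∉ T.discriminant (s * e) := by
  rintro (h0 | ⟨h0, ν', hΔ, p, q, hpq, hp, hq, hν'⟩)
  · exact hb (NNReal.coe_eq_zero.2 h0)
  have h1 := h s hs (by rw [show b.2 = _ from h0]; simp)
  obtain ⟨c, rfl⟩ := T.mkQ_eq_iff.1 hν'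
  rw [ell_add_smul_u] at hp hq
  have hi := hΔ i
  rw [ell_add_smul_u] at hi
  by_cases hpi : p = i
  · have := h1 q (fun hqi => hpq (hpi.trans hqi.symm))
    linarith
  · have := h1 p hpi
    linarith

theorem nonempty_discClasses (he : e ≠ 0) (hb : b ∉ T.discriminant e) :
    Nonempty (T.DiscClasses e b) := by
  have := T.neZero
  obtain ⟨ν, hν⟩ := T.exists_rep b
  obtain ⟨d, i, h⟩ := exists_isWallIndex he hb hν
  choose ν₀ hν₀ using T.facet
  let N : ℝ → Fin n → ℝ := fun s => ν + (1 - s) • d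
  -- Over `s` the function `χ` turns once around `s e` on the circle of radius `√b₂`. At `s = 0`
  -- this turn rotates the `i`-th coordinate of `stdLift` (`stdLift_exp_mul`); together with the
  -- sheared rotation in `cyl` it gives exactly the `j`-th circle orbit.
  let χ : ℝ → ℝ → ℂ := fun s θ =>
    s * e + Real.sqrt b.2 * Complex.exp (2 * Real.pi * θ * Complex.I)
  have hχ : ∀ s θ, ‖χ s θ - s * e‖ ^ 2 = b.2 := fun s θ => by
    simp only [χ]
    rw [add_sub_cancel_left, norm_mul, norm_exp_two_pi, mul_one, Complex.norm_real,
      Real.norm_eq_abs, sq_abs, Real.sq_sqrt b.2.coe_nonneg]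
  have hpos : ∀ s ∈ Set.Icc (0 : ℝ) 1, ∀ θ k, k ≠ i →
      0 < T.ell (N s) k + height (T.ell (N s)) (‖χ s θ‖ ^ 2) :=
    fun s hs θ k hk => h.pos hs (hχ s θ) hk
  let cyl : Fin m → ℝ → ℝ → Fin m → ℂ := fun j s θ =>
    torusAct (shear i (Pi.single j θ)) (stdLift (T.ell (N s)) i (χ s θ))
  have hnorm : ∀ j, ∀ s ∈ Set.Icc (0 : ℝ) 1, ∀ θ k,
      ‖cyl j s θ k‖ ^ 2 = T.ell (N s) k + height (T.ell (N s)) (‖χ s θ‖ ^ 2) := fun j s hs θ k => by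
    rw [norm_torusAct, norm_sq_stdLift (hpos s hs θ)]
  have hprod : ∀ j, ∀ s ∈ Set.Icc (0 : ℝ) 1, ∀ θ, ∏ k, cyl j s θ k = χ s θ := fun j s hs θ => by
    rw [prod_torusAct, sum_shear, prod_stdLift (hpos s hs θ)]
    simp
  have hlevel : ∀ j, ∀ s ∈ Set.Icc (0 : ℝ) 1, ∀ θ, cyl j s θ ∈ T.Level := fun j s hs θ =>
    mem_level_of_norm (hnorm j s hs θ)
  have hN : ContDiff ℝ ∞ fun p : ℝ × ℝ => T.ell (N p.1) := by
    refine contDiff_pi.2 fun k => ?_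
    simp only [N, ell, facetFun, Pi.add_apply, Pi.smul_apply, smul_eq_mul]
    fun_prop
  have hofReal : ∀ {g : ℝ × ℝ → ℝ}, ContDiff ℝ ∞ g → ContDiff ℝ ∞ fun p => (g p : ℂ) :=
    fun hg => Complex.ofRealCLM.contDiff.comp hg
  have hχc : ContDiff ℝ ∞ fun p : ℝ × ℝ => χ p.1 p.2 := by
    refine ((hofReal contDiff_fst).mul contDiff_const).add (contDiff_const.mul (ContDiff.cexp ?_))
    exact (contDiff_const.mul (hofReal contDiff_snd)).mul contDiff_const
  refine ⟨{ t := id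
            path := fun s => (T.uLine.mkQ (N s), b.2)
            t_cont := continuousOn_id
            path_cont := ?_
            t_mem := fun s hs => hs
            t_zero := rfl
            t_one := rfl
            path_one := ?_
            regular := fun s hs => h.regular (snd_ne_zero_of_regular hb) hs
            ν₀ := ν₀
            ν₀_facet := hν₀
            z₀ := fun _ => stdLift (T.ell (N 0)) i (Real.sqrt b.2)
            cyl := cyl
            cyl_smooth := fun j => ?_
            cyl_periodic := fun j s hs θ => ?_
            cyl_zero := fun j θ => ?_
            cyl_level := hlevel
            cyl_fibre := fun j s hs θ => (mem_fibre_iff rfl _).2 ⟨⟨_, hnorm j s hs θ⟩, ?_⟩ }⟩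
  · refine Continuous.continuousOn (Continuous.prodMk ?_ continuous_const)
    have hNc : Continuous N := by fun_prop
    exact T.uLine.continuous_mkQ.comp hNc
  · simp [N, hν]
  · rintro ⟨s, θ⟩ hp
    refine ContDiffAt.contDiffWithinAt (contDiffAt_pi.2 fun k => ?_)
    have h1 := contDiffAt_pi.1 (contDiffAt_stdLift (i := i)
      (a := fun p : ℝ × ℝ => T.ell (N p.1)) (χ := fun p : ℝ × ℝ => χ p.1 p.2) (y := (s, θ)) hN.contDiffAt hχc.contDiffAt
      (hpos s hp.1 θ)) k
    have h2 : ContDiff ℝ ∞ fun p : ℝ × ℝ => shear i (Pi.single j p.2) k := by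
      have : ∀ p : ℝ × ℝ, shear i (Pi.single j p.2) k = p.2 * shear i (Pi.single j 1) k := fun p => by
        rw [← smul_eq_mul, ← Pi.smul_apply, ← map_smul, ← Pi.single_smul, smul_eq_mul, mul_one]
      simp only [this]
      fun_prop
    have h3 : ContDiff ℝ ∞ fun p : ℝ × ℝ =>
        (2 * Real.pi * (shear i (Pi.single j p.2) k : ℝ) * Complex.I : ℂ) :=
      (contDiff_const.mul (hofReal h2)).mul contDiff_const
    exact h3.cexp.contDiffAt.mul h1
  · have h1 : χ s (θ + 1) = χ s θ := by
      simp only [χ]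
      congr 2
      rw [Complex.exp_eq_exp_iff_exists_int]
      exact ⟨1, by push_cast; ring⟩
    obtain ⟨w, hw⟩ := shear_int i (Pi.single j 1)
    have h2 : (fun k => ((Pi.single j (1 : ℤ) : Fin m → ℤ) k : ℝ)) = Pi.single j 1 := by
      funext k
      by_cases hk : k = j
      · subst hk; simp
      · simp [hk]
    simp only [cyl]
    rw [h1, Pi.single_add, map_add, torusAct_add, ← h2, hw, torusAct_int]
  · simp only [cyl, χ]
    rw [Complex.ofReal_zero, zero_mul, zero_add, stdLift_exp_mul, ← torusAct_add, shear_single,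
      sub_add_cancel]
  · simp only [hprod j s hs, id, hχ]

end ToricCY

/-! ### Linear algebra of the charges -/

namespace Charges

variable {m k k' : ℕ} (C : Charges m k k')

/-- The direction `∑ τ_a l_a`. -/
def dir : (Fin k → ℝ) →ₗ[ℝ] Fin m → ℝ := Fintype.linearCombination ℝ fun a j => (C.l a j : ℝ)

theorem dir_apply (τ : Fin k → ℝ) (j : Fin m) : C.dir τ j = ∑ a, τ a * (C.l a j : ℝ) := by
  simp [dir, Fintype.linearCombination_apply]

theorem dir_single (a : Fin k) (t : ℝ) : C.dir (Pi.single a t) = fun j => t * (C.l a j : ℝ) := by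
  funext j
  rw [dir_apply, Finset.sum_eq_single a (fun b _ hb => by simp [hb]) (by simp)]
  simp

theorem sum_l (a : Fin k) : ∑ j, (C.l a j : ℝ) = 0 := by exact_mod_cast C.special a

theorem sum_dir (τ : Fin k → ℝ) : ∑ j, C.dir τ j = 0 := by
  simp only [dir_apply]
  rw [Finset.sum_comm]
  simp [← Finset.mul_sum, C.sum_l]

theorem sum_lperp_dir (τ : Fin k → ℝ) (b : Fin k') : ∑ j, (C.lperp b j : ℝ) * C.dir τ j = 0 := by
  simp only [dir_apply, Finset.mul_sum]
  rw [Finset.sum_comm]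
  refine Finset.sum_eq_zero fun a _ => ?_
  have h : ∑ j, (C.l a j : ℝ) * (C.lperp b j : ℝ) = 0 := by exact_mod_cast C.orth a b
  calc _ = τ a * ∑ j, (C.l a j : ℝ) * (C.lperp b j : ℝ) := by
        rw [Finset.mul_sum]; exact Finset.sum_congr rfl fun j _ => by ring
    _ = 0 := by rw [h, mul_zero]

theorem linearIndependent_real {ι : Type*} {m : ℕ} {v : ι → Fin m → ℤ}
    (h : LinearIndependent ℤ v) : LinearIndependent ℝ fun i j => (v i j : ℝ) := by
  have := (linearIndependent_algebraMap_comp_iff (R := ℤ) (S := ℝ) (v := v)).2 h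
  exact this

/-- Dimension count: the span of the `l a` lies in the orthogonal complement of the `lperp b`, and
both have dimension `k = m - k'`. -/
theorem exists_dir_eq {y : Fin m → ℝ} (hy : ∀ b, ∑ j, (C.lperp b j : ℝ) * y j = 0) :
    ∃ τ, C.dir τ = y := by
  let M : Matrix (Fin k') (Fin m) ℝ := fun b j => (C.lperp b j : ℝ)
  have hM : M.rank = k' := by
    have := (linearIndependent_real C.indep_perp).rank_matrix (M := M)
    simpa using this
  have hle : LinearMap.range C.dir ≤ LinearMap.ker M.mulVecLin := by
    rintro _ ⟨τ, rfl⟩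
    refine funext fun b => ?_
    exact C.sum_lperp_dir τ b
  have h1 : Module.finrank ℝ (LinearMap.range C.dir) = k := by
    have := LinearMap.finrank_range_of_inj (f := C.dir)
      ((linearIndependent_real C.indep).fintypeLinearCombination_injective)
    simpa using this
  have h2 : Module.finrank ℝ (LinearMap.ker M.mulVecLin) = k := by
    have h3 := LinearMap.finrank_range_add_finrank_ker M.mulVecLin
    rw [show Module.finrank ℝ (LinearMap.range M.mulVecLin) = k' from hM] at h3
    have := C.card_eq
    simp only [Module.finrank_fintype_fun_eq_card, Fintype.card_fin] at h3
    omega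
  have h4 := Submodule.eq_of_le_of_finrank_eq hle (h1.trans h2.symm)
  have h5 : y ∈ LinearMap.ker M.mulVecLin := funext fun b => hy b
  rw [← h4] at h5
  exact h5

theorem torusAct_mem_lagTilde {z : Fin m → ℂ} (hz : z ∈ C.lagTilde) (τ : Fin k → ℝ) :
    torusAct (C.dir τ) z ∈ C.lagTilde := by
  obtain ⟨h1, θ, hθ, h2⟩ := hz
  refine ⟨fun a => by simpa only [norm_torusAct] using h1 a,
    θ + (2 * Real.pi) • C.dir τ, fun b => ?_, fun j => ?_⟩
  · simp only [Pi.add_apply, Pi.smul_apply, smul_eq_mul, mul_add, Finset.sum_add_distrib]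
    rw [hθ b]
    have := C.sum_lperp_dir τ b
    have h3 : ∑ j, (C.lperp b j : ℝ) * (2 * Real.pi * C.dir τ j) = 0 := by
      calc _ = 2 * Real.pi * ∑ j, (C.lperp b j : ℝ) * C.dir τ j := by
            rw [Finset.mul_sum]; exact Finset.sum_congr rfl fun j _ => by ring
        _ = 0 := by rw [this, mul_zero]
    rw [h3, add_zero]
  · rw [norm_torusAct, torusAct]
    conv_lhs => rw [h2 j]
    rw [mul_left_comm, ← Complex.exp_add]
    congr 2
    simp only [Pi.add_apply, Pi.smul_apply, smul_eq_mul]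
    push_cast
    ring

/-- Two points of the Lagrangian with the same moduli are in one orbit of the torus of the
directions `l_a`. -/
theorem exists_torusAct_eq {z w : Fin m → ℂ} (hz : z ∈ C.lagTilde) (hw : w ∈ C.lagTilde)
    (h : ∀ j, ‖w j‖ = ‖z j‖) : ∃ τ, torusAct (C.dir τ) z = w := by
  obtain ⟨-, θ, hθ, hz⟩ := hz
  obtain ⟨-, θ', hθ', hw⟩ := hw
  obtain ⟨τ, hτ⟩ := C.exists_dir_eq (y := (2 * Real.pi)⁻¹ • (θ' - θ)) fun b => by
    calc ∑ j, (C.lperp b j : ℝ) * ((2 * Real.pi)⁻¹ • (θ' - θ)) j =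
        (2 * Real.pi)⁻¹ * (∑ j, (C.lperp b j : ℝ) * θ' j - ∑ j, (C.lperp b j : ℝ) * θ j) := by
          rw [← Finset.sum_sub_distrib, Finset.mul_sum]
          refine Finset.sum_congr rfl fun j _ => ?_
          simp only [Pi.smul_apply, Pi.sub_apply, smul_eq_mul]
          ring
      _ = 0 := by rw [hθ b, hθ' b, sub_self, mul_zero]
  refine ⟨τ, funext fun j => ?_⟩
  rw [torusAct, hτ, hw j, h j]
  conv_lhs => rw [hz j]
  rw [mul_left_comm, ← Complex.exp_add]
  congr 2
  simp only [Pi.smul_apply, Pi.sub_apply, smul_eq_mul]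
  push_cast
  field_simp
  ring

/-- The product of the coordinates has constant phase on the Lagrangian. -/
theorem prod_eq_norm_mul {z : Fin m → ℂ} (hz : z ∈ C.lagTilde) {θ : Fin m → ℝ} (hθ : θ ∈ C.angles) :
    ∏ j, z j = ‖∏ j, z j‖ * Complex.exp ((∑ j, θ j : ℝ) * Complex.I) := by
  obtain ⟨-, θ', hθ', hz⟩ := hz
  obtain ⟨τ, hτ⟩ := C.exists_dir_eq (y := θ' - θ) fun b => by
    simp only [Pi.sub_apply, mul_sub, Finset.sum_sub_distrib, hθ b, hθ' b, sub_self]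
  have h1 : ∑ j, θ' j = ∑ j, θ j := by
    have := C.sum_dir τ
    rw [hτ] at this
    simpa [sub_eq_zero] using this
  conv_lhs => rw [Finset.prod_congr rfl fun j _ => hz j]
  rw [Finset.prod_mul_distrib, ← Complex.exp_sum, ← Finset.sum_mul, norm_prod, ← h1]
  push_cast
  rfl

end Charges

/-! ### Characters on `X` and lifts of paths in torus orbits -/

/-- `z ^ d` for `d ≥ 0`, and `conj z ^ (-d)` for `d < 0`. -/
def conjPow (d : ℤ) (z : ℂ) : ℂ :=
  if 0 ≤ d then z ^ d.toNat else (starRingEnd ℂ) z ^ (-d).toNat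

theorem continuous_conjPow (d : ℤ) : Continuous (conjPow d) := by
  unfold conjPow
  split_ifs
  · fun_prop
  · exact Complex.continuous_conj.pow _

theorem conjPow_ne_zero (d : ℤ) {z : ℂ} (hz : z ≠ 0) : conjPow d z ≠ 0 := by
  unfold conjPow
  split_ifs
  · exact pow_ne_zero _ hz
  · exact pow_ne_zero _ ((map_ne_zero _).2 hz)

theorem conjPow_zero (z : ℂ) : conjPow 0 z = 1 := by simp [conjPow]

theorem conjPow_exp_mul (d : ℤ) (x : ℝ) (z : ℂ) :
    conjPow d (Complex.exp (2 * Real.pi * x * Complex.I) * z) =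
      Complex.exp (2 * Real.pi * (d * x : ℝ) * Complex.I) * conjPow d z := by
  unfold conjPow
  split_ifs with h
  · rw [mul_pow, ← Complex.exp_nat_mul]
    congr 2
    have : ((d.toNat : ℤ) : ℂ) = (d : ℂ) := by rw [Int.toNat_of_nonneg h]
    rw [Int.cast_natCast] at this
    rw [this]
    push_cast; ring
  · rw [map_mul, mul_pow, ← Complex.exp_conj, ← Complex.exp_nat_mul]
    congr 2
    have : (((-d).toNat : ℤ) : ℂ) = ((-d : ℤ) : ℂ) := by rw [Int.toNat_of_nonneg (by omega)]
    rw [Int.cast_natCast] at this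
    rw [this]
    simp only [map_mul, Complex.conj_I, Complex.conj_ofReal, map_ofNat]
    push_cast; ring

theorem exp_two_pi_eq_iff {x y : ℝ} : Complex.exp (2 * Real.pi * x * Complex.I) =
    Complex.exp (2 * Real.pi * y * Complex.I) ↔ ∃ d : ℤ, x = y + d := by
  rw [Complex.exp_eq_exp_iff_exists_int]
  refine exists_congr fun d => ?_
  have hpi : (2 * Real.pi * Complex.I : ℂ) ≠ 0 := Complex.two_pi_I_ne_zero
  constructor
  · intro h
    have h1 : (2 * Real.pi * Complex.I : ℂ) * x = (2 * Real.pi * Complex.I) * ((y + d : ℝ) : ℂ) := by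
      push_cast
      linear_combination h
    exact_mod_cast mul_left_cancel₀ hpi h1
  · rintro rfl
    push_cast; ring

/-- A continuous function on an interval with values in a countable set is constant. -/
theorem eq_of_countable_range {S Z : Type*} [TopologicalSpace S] [PreconnectedSpace S] [MetricSpace Z]
    {f : S → Z} (hf : Continuous f) {c : Set Z} (hc : c.Countable) (h : ∀ s, f s ∈ c) (s s' : S) :
    f s = f s' :=
  hc.isTotallyDisconnected _ (Set.range_subset_iff.2 h)
    (isPreconnected_range hf) ⟨s, rfl⟩ ⟨s', rfl⟩

/-- A continuous path in `ℝⁿ` with values in the union of the integral translates of a subspace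
stays in the subspace. -/
theorem mem_of_mem_add_int {n : ℕ} (V : Submodule ℝ (Fin n → ℝ)) {ξ : unitInterval → Fin n → ℝ}
    (hξ : Continuous ξ) (h0 : ξ 0 = 0)
    (h : ∀ t, ∃ d : Fin n → ℤ, ξ t - (fun a => (d a : ℝ)) ∈ V) (t : unitInterval) : ξ t ∈ V := by
  by_contra hn
  obtain ⟨f, hf, hV⟩ := Submodule.exists_le_ker_of_notMem hn
  refine hf ?_
  have hc : Continuous f := f.continuous_of_finiteDimensional
  have h1 := eq_of_countable_range (hc.comp hξ)
    (Set.countable_range fun d : Fin n → ℤ => f fun a => (d a : ℝ)) (fun t => by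
      obtain ⟨d, hd⟩ := h t
      refine ⟨d, ?_⟩
      have := hV hd
      rw [LinearMap.mem_ker, map_sub, sub_eq_zero] at this
      exact this.symm) t 0
  simpa [h0] using h1

namespace ToricCY

variable {n m k k' : ℕ} (T : ToricCY n m) (C : Charges m k k')

theorem proj_torusAct {g : Fin m → ℝ} (hg : ∀ a, ∑ j, g j * (T.v j a : ℝ) = 0) (z : T.Level) :
    T.proj ⟨torusAct g z.1, T.torusAct_mem g z.2⟩ = T.proj z :=
  (Quotient.sound (s := T.orbitSetoid) ⟨g, hg, rfl⟩).symm

theorem sum_eq_zero_of_beta {g : Fin m → ℝ} (hg : ∀ a, ∑ j, g j * (T.v j a : ℝ) = 0) :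
    ∑ j, g j = 0 := by
  have h1 : ∀ j, g j = ∑ a, (T.u a : ℝ) * (g j * (T.v j a : ℝ)) := fun j => by
    calc g j = g j * ∑ a, (T.u a : ℝ) * (T.v j a : ℝ) := by rw [T.sum_u_mul_v, mul_one]
      _ = _ := by rw [Finset.mul_sum]; exact Finset.sum_congr rfl fun a _ => by ring
  rw [Finset.sum_congr rfl fun j _ => h1 j, Finset.sum_comm]
  simp only [← Finset.mul_sum, hg, mul_zero, Finset.sum_const_zero]

/-- The character of weight `e_a - (v i)_a u`, in which the coordinates of negative weight are
replaced by their conjugates. -/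
def character (i : Fin m) (a : Fin n) (z : Fin m → ℂ) : ℂ :=
  ∏ j, conjPow (T.v j a - T.v i a) (z j)

/-- The twist by `(v i)_a u` is invisible to directions of sum zero, while it gives `z i` weight
`0`, so that the character does not vanish where only `z i` does (`character_ne_zero`). Conjugation
replaces negative powers and keeps it continuous everywhere. -/
theorem character_torusAct (i : Fin m) (a : Fin n) {g : Fin m → ℝ} (hg : ∑ j, g j = 0)
    (z : Fin m → ℂ) : T.character i a (torusAct g z) =
      Complex.exp (2 * Real.pi * (∑ j, g j * (T.v j a : ℝ) : ℝ) * Complex.I) *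
        T.character i a z := by
  have h1 : ∑ j, g j * (T.v j a : ℝ) = ∑ j, ((T.v j a - T.v i a : ℤ) : ℝ) * g j := by
    push_cast
    simp only [sub_mul, Finset.sum_sub_distrib, ← Finset.mul_sum, hg, mul_zero, sub_zero]
    exact Finset.sum_congr rfl fun j _ => mul_comm _ _
  simp only [character, torusAct, conjPow_exp_mul, Finset.prod_mul_distrib, ← Complex.exp_sum]
  rw [h1]
  congr 2
  push_cast
  rw [Finset.mul_sum, Finset.sum_mul]

theorem character_ne_zero {i : Fin m} (a : Fin n) {z : Fin m → ℂ} (hz : ∀ j, j ≠ i → z j ≠ 0) :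
    T.character i a z ≠ 0 :=
  Finset.prod_ne_zero_iff.2 fun j _ => by
    by_cases hj : j = i
    · subst hj
      rw [sub_self, conjPow_zero]
      exact one_ne_zero
    · exact conjPow_ne_zero _ (hz j hj)

/-- The function on `X` induced by a character. -/
def characterX (i : Fin m) (a : Fin n) : T.X → ℂ :=
  Quotient.lift (fun z : T.Level => T.character i a z.1) (by
    rintro z w ⟨g, hg, h⟩
    show T.character i a z.1 = T.character i a w.1
    rw [← h, T.character_torusAct i a (T.sum_eq_zero_of_beta hg), hg]
    simp)

theorem continuous_characterX (i : Fin m) (a : Fin n) : Continuous (T.characterX i a) :=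
  Continuous.quotient_lift (continuous_finsetProd _ fun j _ =>
    (continuous_conjPow _).comp ((continuous_apply j).comp continuous_subtype_val)) _

/-- The map `τ ↦ ∑ τ_a β(l_a)`. -/
def betaMap : (Fin k → ℝ) →ₗ[ℝ] Fin n → ℝ :=
  (Fintype.linearCombination ℝ fun j a => (T.v j a : ℝ)) ∘ₗ C.dir

theorem betaMap_apply (τ : Fin k → ℝ) (a : Fin n) :
    T.betaMap C τ a = ∑ j, C.dir τ j * (T.v j a : ℝ) := by
  simp [betaMap, Fintype.linearCombination_apply]

theorem betaMap_eq_sum (τ : Fin k → ℝ) (i : Fin n) :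
    T.betaMap C τ i = ∑ a, τ a * (T.beta (C.l a) i : ℝ) := by
  simp only [betaMap_apply, Charges.dir_apply, beta, Finset.sum_mul]
  rw [Finset.sum_comm]
  refine Finset.sum_congr rfl fun a _ => ?_
  push_cast
  rw [Finset.mul_sum]
  exact Finset.sum_congr rfl fun j _ => by ring

/-- The orbit of a point of the Lagrangian under the torus of the directions `l_a`. -/
def orbitPt (z : T.Level) (τ : Fin k → ℝ) : T.X :=
  T.proj ⟨torusAct (C.dir τ) z.1, T.torusAct_mem _ z.2⟩

variable {T C}

theorem orbitPt_add_of_betaMap {z : T.Level} {τ : Fin k → ℝ} (h : T.betaMap C τ = 0)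
    (τ' : Fin k → ℝ) : T.orbitPt C z (τ' + τ) = T.orbitPt C z τ' := by
  have h1 := T.proj_torusAct (g := C.dir τ) (fun a => by rw [← betaMap_apply, h]; rfl)
    ⟨torusAct (C.dir τ') z.1, T.torusAct_mem _ z.2⟩
  unfold orbitPt
  rw [← h1]
  congr 1
  refine Subtype.ext ?_
  show torusAct (C.dir (τ' + τ)) z.1 = torusAct (C.dir τ) (torusAct (C.dir τ') z.1)
  rw [add_comm, map_add, torusAct_add]

theorem orbitPt_add_int {z : T.Level} (d : Fin k → ℤ) (τ : Fin k → ℝ) :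
    T.orbitPt C z (τ + fun a => (d a : ℝ)) = T.orbitPt C z τ := by
  unfold orbitPt
  congr 1
  have : C.dir (fun a => (d a : ℝ)) = fun j => ((∑ a, d a * C.l a j : ℤ) : ℝ) := by
    funext j
    rw [Charges.dir_apply]
    push_cast
    rfl
  refine Subtype.ext ?_
  show torusAct (C.dir (τ + fun a => (d a : ℝ))) z.1 = torusAct (C.dir τ) z.1
  rw [add_comm, map_add, torusAct_add, this, torusAct_int]

theorem continuous_orbitPt (z : T.Level) : Continuous (T.orbitPt C z) := by
  have h1 : Continuous C.dir := C.dir.continuous_of_finiteDimensional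
  have h2 := (continuous_torusAct (m := m)).comp (h1.prodMk (continuous_const (y := z.1)))
  exact T.continuous_proj.comp (h2.subtype_mk _)

theorem characterX_orbitPt (i : Fin m) (a : Fin n) (z : T.Level) (τ : Fin k → ℝ) :
    T.characterX i a (T.orbitPt C z τ) =
      Complex.exp (2 * Real.pi * (T.betaMap C τ a : ℝ) * Complex.I) * T.character i a z.1 := by
  rw [betaMap_apply, ← character_torusAct T i a (C.sum_dir τ)]
  rfl

theorem orbitPt_mem_fibre {e : ℂ} {b : T.Base} {z : T.Level} (hz : T.proj z ∈ T.fibre e b)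
    (τ : Fin k → ℝ) : T.orbitPt C z τ ∈ T.fibre e b := by
  obtain ⟨ν, hν⟩ := T.exists_rep b
  obtain ⟨⟨h, h1⟩, h2⟩ := (mem_fibre_iff hν z).1 hz
  refine (mem_fibre_iff hν _).2 ⟨⟨h, fun j => by simpa only [norm_torusAct] using h1 j⟩, ?_⟩
  rw [prod_torusAct, C.sum_dir]
  simpa using h2

/-- The primitivity of the lattice generated by the `β(l_a)`. -/
def IsPrimitive (T : ToricCY n m) (C : Charges m k k') : Prop :=
  ∀ x : Fin n → ℤ, (∃ r : Fin k → ℝ, ∀ i, (x i : ℝ) = ∑ a, r a * (T.beta (C.l a) i : ℝ)) →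
    ∃ d : Fin k → ℤ, x = ∑ a, d a • T.beta (C.l a)

theorem IsPrimitive.exists_int (h : IsPrimitive T C) {τ : Fin k → ℝ} {x : Fin n → ℤ}
    (hx : T.betaMap C τ = fun a => (x a : ℝ)) :
    ∃ d : Fin k → ℤ, T.betaMap C (τ - fun a => (d a : ℝ)) = 0 := by
  obtain ⟨d, hd⟩ := h x ⟨τ, fun i => by rw [← betaMap_eq_sum, hx]⟩
  refine ⟨d, ?_⟩
  rw [map_sub, hx, sub_eq_zero]
  funext i
  rw [betaMap_eq_sum, hd]
  simp

/-- By primitivity `τ - τ'` is an integral vector plus an element of the kernel of `betaMap`. The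
first acts trivially on `ℂᵐ`, and the second moves points only inside orbits of `G_ℝ`. -/
theorem IsPrimitive.orbitPt_eq (h : IsPrimitive T C) {τ τ' : Fin k → ℝ} {x : Fin n → ℤ}
    (hx : T.betaMap C (τ - τ') = fun a => (x a : ℝ)) (z : T.Level) :
    T.orbitPt C z τ = T.orbitPt C z τ' := by
  obtain ⟨d, hd⟩ := h.exists_int hx
  calc T.orbitPt C z τ = T.orbitPt C z ((τ' + fun a => (d a : ℝ)) +
        (τ - τ' - fun a => (d a : ℝ))) := by congr 1; abel
    _ = T.orbitPt C z τ' := by rw [orbitPt_add_of_betaMap hd, orbitPt_add_int]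

/-- Paths in an orbit lift to `ℝᵏ`. -/
theorem exists_orbit_lift (h : IsPrimitive T C) {z : T.Level} {i : Fin m}
    (hz : ∀ j, j ≠ i → z.1 j ≠ 0) {p : unitInterval → T.X} (hp : Continuous p)
    (h0 : p 0 = T.proj z) (ho : ∀ t, ∃ τ, p t = T.orbitPt C z τ) :
    ∃ τ : unitInterval → Fin k → ℝ, Continuous τ ∧ τ 0 = 0 ∧ ∀ t, p t = T.orbitPt C z (τ t) := by
  choose τ' hτ' using ho
  -- The chosen parameters `τ'` need not be continuous, but the characters show that `betaMap (τ'
  -- t)` is continuous modulo `ℤⁿ`; the covering `ℝ → Circle` lifts it.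
  have hlift : ∀ a, ∃ ξ : C(unitInterval, ℝ), ξ 0 = 0 ∧
      ∀ t, ∃ d : ℤ, ξ t = T.betaMap C (τ' t) a + d := by
    intro a
    have hc0 := T.character_ne_zero a hz
    have hval : ∀ t, (Circle.exp (2 * Real.pi * T.betaMap C (τ' t) a) : ℂ) =
        T.characterX i a (p t) / T.character i a z.1 := fun t => by
      rw [hτ', characterX_orbitPt, mul_div_cancel_right₀ _ hc0, Circle.coe_exp]
      push_cast
      rfl
    have hcont : Continuous fun t => Circle.exp (2 * Real.pi * T.betaMap C (τ' t) a) := by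
      refine continuous_induced_rng.2 ?_
      have : Continuous fun t => T.characterX i a (p t) / T.character i a z.1 :=
        ((T.continuous_characterX i a).comp hp).div_const _
      exact this.congr fun t => (hval t).symm
    have h1 : Circle.exp (2 * Real.pi * T.betaMap C (τ' 0) a) = Circle.exp 0 := by
      refine Circle.ext ?_
      rw [hval, h0, show T.characterX i a (T.proj z) = T.character i a z.1 from rfl, div_self hc0]
      simp
    obtain ⟨Γ, hΓ, hΓ0⟩ := Circle.isCoveringMap_exp.exists_path_lifts ⟨_, hcont⟩ 0 h1
    refine ⟨⟨fun t => Γ t / (2 * Real.pi), by fun_prop⟩, by simp [hΓ0], fun t => ?_⟩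
    have h2 : Circle.exp (Γ t) = Circle.exp (2 * Real.pi * T.betaMap C (τ' t) a) :=
      congrFun hΓ t
    obtain ⟨d, hd⟩ := Circle.exp_eq_exp.1 h2
    refine ⟨d, ?_⟩
    show Γ t / (2 * Real.pi) = _
    rw [hd]
    field_simp
  choose ξ hξ0 hξ using hlift
  choose d hd using hξ
  have hmem := mem_of_mem_add_int (LinearMap.range (T.betaMap C)) (ξ := fun t a => ξ a t)
    (by fun_prop) (funext fun a => hξ0 a) fun t => ⟨fun a => d a t, τ' t, funext fun a => by
      simp [hd]⟩
  -- The lift starts at `0` and stays in the range of `betaMap` up to integers, hence in the range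
  -- itself. A linear section of `betaMap` then brings it back to `ℝᵏ`.
  obtain ⟨s, hs⟩ := (T.betaMap C).rangeRestrict.exists_rightInverse_of_surjective
    (T.betaMap C).range_rangeRestrict
  obtain ⟨s', hs'⟩ := s.exists_extend
  have hs'c : Continuous s' := s'.continuous_of_finiteDimensional
  have hB : ∀ t, T.betaMap C (s' fun a => ξ a t) = fun a => ξ a t := fun t => by
    have h1 := LinearMap.congr_fun hs ⟨_, hmem t⟩
    have h2 := LinearMap.congr_fun hs' ⟨_, hmem t⟩
    simp only [LinearMap.comp_apply, Submodule.subtype_apply] at h2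
    rw [h2]
    exact congrArg Subtype.val h1
  refine ⟨fun t => s' fun a => ξ a t, hs'c.comp (by fun_prop), ?_, fun t => ?_⟩
  · have : (fun a => ξ a 0) = (0 : Fin n → ℝ) := funext hξ0
    simp only [this, map_zero]
  · rw [hτ']
    refine h.orbitPt_eq (x := fun a => -d a t) ?_ z
    rw [map_sub, hB]
    funext a
    simp [hd]

end ToricCY

namespace ToricCY

variable {n m k k' : ℕ} {T : ToricCY n m} {C : Charges m k k'} {e : ℂ} {b : T.Base}

/-! ### The intersection of the Lagrangian with a regular fibre -/

/-- The orbit of a point as a map to the intersection of the Lagrangian with a fibre. -/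
def orbitMap (z : T.Level) (hz : z.1 ∈ C.lagTilde) (hf : T.proj z ∈ T.fibre e b) :
    C(Fin k → ℝ, ↥(T.lag C ∩ T.fibre e b)) where
  toFun τ := ⟨T.orbitPt C z τ,
    ⟨⟨torusAct (C.dir τ) z.1, T.torusAct_mem _ z.2⟩, C.torusAct_mem_lagTilde hz τ, rfl⟩,
    orbitPt_mem_fibre hf τ⟩
  continuous_toFun := (continuous_orbitPt z).subtype_mk _

theorem single_one_eq_cast (a : Fin k) :
    (Pi.single a 1 : Fin k → ℝ) = fun c => ((Pi.single a 1 : Fin k → ℤ) c : ℝ) := by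
  funext c
  by_cases hc : c = a
  · subst hc; simp
  · simp [hc]

theorem orbitMap_add_single (z : T.Level) (hz : z.1 ∈ C.lagTilde) (hf : T.proj z ∈ T.fibre e b)
    (a : Fin k) (y : Fin k → ℝ) :
    orbitMap z hz hf (y + Pi.single a 1) = orbitMap z hz hf y := by
  rw [single_one_eq_cast]
  exact Subtype.ext (orbitPt_add_int (Pi.single a 1) y)

/-- The orbit loop of direction `l_a` through a point. -/
def orbitLoop (z : T.Level) (hz : z.1 ∈ C.lagTilde) (hf : T.proj z ∈ T.fibre e b) (a : Fin k) :
    Path (orbitMap z hz hf 0) (orbitMap z hz hf 0) where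
  toFun τ := orbitMap z hz hf (Pi.single a (τ : ℝ))
  continuous_toFun := (orbitMap z hz hf).continuous.comp
    ((continuous_single a).comp continuous_subtype_val)
  source' := by rw [Set.Icc.coe_zero, Pi.single_zero]
  target' := by
    have h := orbitMap_add_single z hz hf a 0
    rwa [zero_add] at h

theorem orbitPt_single (z : T.Level) (a : Fin k) (t : ℝ) : T.orbitPt C z (Pi.single a t) =
    T.proj ⟨torusAct (fun j => t * (C.l a j : ℝ)) z.1, T.torusAct_mem _ z.2⟩ := by
  have h := C.dir_single a t
  exact congrArg T.proj (Subtype.ext (congrArg (fun g => torusAct g z.1) h))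

theorem isOrbitLoop_orbitLoop (z : T.Level) (hz : z.1 ∈ C.lagTilde) (hf : T.proj z ∈ T.fibre e b)
    (a : Fin k) : T.IsOrbitLoop (C.l a) z (orbitLoop z hz hf a) :=
  fun τ => orbitPt_single z a τ

/-- Inside a fibre the value of `χ` determines all the moduli, and points of the Lagrangian with
equal moduli differ by a direction `∑ τ_a l_a`. -/
theorem exists_torusAct_eq_of_chi {z w : T.Level}
    (hz : z.1 ∈ C.lagTilde) (hw : w.1 ∈ C.lagTilde) (hzf : T.proj z ∈ T.fibre e b)
    (hwf : T.proj w ∈ T.fibre e b) (h : T.chi (T.proj w) = T.chi (T.proj z)) :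
    ∃ τ, T.proj w = T.orbitPt C z τ := by
  obtain ⟨ν, hν⟩ := T.exists_rep b
  rw [chi_proj, chi_proj] at h
  obtain ⟨τ, hτ⟩ := C.exists_torusAct_eq hz hw fun j => by
    rw [← sq_eq_sq₀ (norm_nonneg _) (norm_nonneg _), norm_sq_eq_height hν hzf,
      norm_sq_eq_height hν hwf, h]
  exact ⟨τ, congrArg T.proj (Subtype.ext hτ.symm)⟩

/-- On the intersection of the Lagrangian with a fibre the function `χ` has at most two values. -/
theorem chi_mem_of_mem_lag {θ : Fin m → ℝ} (hθ : θ ∈ C.angles)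
    (he : e = ‖e‖ * Complex.exp ((∑ j, θ j : ℝ) * Complex.I)) {x : T.X}
    (hx : x ∈ T.lag C ∩ T.fibre e b) :
    T.chi x ∈ ({((‖e‖ + Real.sqrt b.2 : ℝ) : ℂ) * Complex.exp ((∑ j, θ j : ℝ) * Complex.I),
      ((‖e‖ - Real.sqrt b.2 : ℝ) : ℂ) * Complex.exp ((∑ j, θ j : ℝ) * Complex.I)} : Set ℂ) := by
  obtain ⟨⟨z, hz, rfl⟩, hf⟩ := hx
  obtain ⟨ν, hν⟩ := T.exists_rep b
  have h1 := C.prod_eq_norm_mul hz hθ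
  have h2 := ((mem_fibre_iff hν z).1 hf).2
  rw [chi_proj]
  set r := ‖∏ j, z.1 j‖ with hr
  have h3 : ‖∏ j, z.1 j - e‖ = |r - ‖e‖| := by
    rw [h1]
    nth_rewrite 1 [he]
    rw [← sub_mul, norm_mul, Complex.norm_exp_ofReal_mul_I, mul_one, ← Complex.ofReal_sub,
      Complex.norm_real, Real.norm_eq_abs]
  have h4 : |r - ‖e‖| = Real.sqrt b.2 := by
    rw [← h2, Real.sqrt_sq (norm_nonneg _), h3]
  rw [h1]
  rcases abs_choice (r - ‖e‖) with h | h
  · left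
    rw [← h4, h]
    congr 2
    ring
  · right
    rw [← h4, h]
    show _ = _
    congr 2
    ring

theorem frame_orbitMap_single (D : FlatU1 ↥(T.lag C ∩ T.fibre e b)) (z : T.Level)
    (hz : z.1 ∈ C.lagTilde) (hf : T.proj z ∈ T.fibre e b) (a : Fin k) :
    D.frame (orbitMap z hz hf) (Pi.single a 1) = D.tr (orbitLoop z hz hf a) := by
  have h : ∀ t : unitInterval,
      FlatU1.segPath (0 : Fin k → ℝ) (Pi.single a 1) t = Pi.single a (t : ℝ) := fun t => by
    rw [FlatU1.segPath_apply, zero_add, sub_zero, ← Pi.single_smul, smul_eq_mul, mul_one]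
  exact D.tr_congr _ _ fun t => congrArg (orbitMap z hz hf) (h t)

theorem frame_orbitMap_int (D : FlatU1 ↥(T.lag C ∩ T.fibre e b)) (z : T.Level)
    (hz : z.1 ∈ C.lagTilde) (hf : T.proj z ∈ T.fibre e b)
    (hD : ∀ a, D.tr (orbitLoop z hz hf a) = 1) (d : Fin k → ℤ) :
    D.frame (orbitMap z hz hf) (fun a => (d a : ℝ)) = 1 := by
  have hsum : (fun a => (d a : ℝ)) = ∑ a, d a • (Pi.single a 1 : Fin k → ℝ) := by
    funext c
    rw [Finset.sum_apply, Finset.sum_eq_single c (fun a _ ha => by simp [ha.symm]) (by simp)]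
    simp
  rw [hsum, D.frame_sum_zsmul _ _ _ _ fun a _ y => orbitMap_add_single z hz hf a y]
  refine Finset.prod_eq_one fun a _ => ?_
  rw [frame_orbitMap_single, hD, one_zpow]

/-- A flat connection on the intersection of the Lagrangian with a regular fibre is trivial if its
holonomies along the orbit loops of the directions `l_a` are. -/
theorem tr_eq_one_of_orbitLoop (hprim : IsPrimitive T C) (hb : b ∉ T.discriminant e)
    {θ : Fin m → ℝ} (hθ : θ ∈ C.angles)
    (he : e = ‖e‖ * Complex.exp ((∑ j, θ j : ℝ) * Complex.I))
    (D : FlatU1 ↥(T.lag C ∩ T.fibre e b))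
    (hD : ∀ a (z : T.Level) (hz : z.1 ∈ C.lagTilde) (hf : T.proj z ∈ T.fibre e b),
      D.tr (orbitLoop z hz hf a) = 1)
    (x : ↥(T.lag C ∩ T.fibre e b)) (p : Path x x) : D.tr p = 1 := by
  obtain ⟨x, ⟨z, hz, rfl⟩, hf⟩ := x
  obtain ⟨ν, hν⟩ := T.exists_rep b
  obtain ⟨i, hi⟩ := T.exists_min ν
  have h0 : ∀ j, j ≠ i → z.1 j ≠ 0 := fun j hj => coord_ne_zero hb hν hi hf hj
  have hpc : Continuous fun t => (p t : T.X) := continuous_subtype_val.comp p.continuous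
  have hp0 : (p 0 : T.X) = T.proj z := by rw [p.source]
  -- `χ` takes at most two values on the intersection, so it is constant along the path, which
  -- therefore stays in one torus orbit.
  have hchi : ∀ t, T.chi (p t) = T.chi (T.proj z) := fun t =>
    (eq_of_countable_range (T.continuous_chi.comp hpc) (Set.toFinite _).countable
      (fun t => chi_mem_of_mem_lag hθ he (p t).2) t 0).trans (congrArg T.chi hp0)
  obtain ⟨τ, hτc, hτ0, hτ⟩ := exists_orbit_lift hprim h0 hpc hp0 fun t => by
    obtain ⟨⟨w, hw, hwp⟩, hwf⟩ := (p t).2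
    have h1 := hchi t
    rw [← hwp] at h1 hwf ⊢
    exact exists_torusAct_eq_of_chi hz hw hf hwf h1
  let q : Path 0 (τ 1) := { toFun := τ, continuous_toFun := hτc, source' := hτ0, target' := rfl }
  let f := orbitMap z hz hf
  rw [D.tr_eq_frame f q p fun t => Subtype.ext (hτ t), D.frame_zero, inv_one, mul_one]
  have hτ1 : T.orbitPt C z (τ 1) = T.proj z := by rw [← hτ, p.target]
  have hint : ∀ a, ∃ d : ℤ, T.betaMap C (τ 1) a = d := fun a => by
    have h1 := congrArg (T.characterX i a) hτ1
    rw [characterX_orbitPt, show T.characterX i a (T.proj z) = T.character i a z.1 from rfl] at h1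
    have h2 := mul_right_cancel₀ (T.character_ne_zero a h0) (h1.trans (one_mul _).symm)
    obtain ⟨d, hd⟩ := (exp_two_pi_eq_iff (y := 0)).1 (h2.trans (by simp))
    exact ⟨d, by rw [hd, zero_add]⟩
  choose x hx using hint
  -- The lift ends at `d` plus an element of the kernel of `betaMap`. The kernel part gives a
  -- constant path, and the integral part gives a product of powers of holonomies along orbit loops.
  obtain ⟨d, hd⟩ := hprim.exists_int (funext hx)
  have hper : (τ 1 - fun a => (d a : ℝ)) ∈ FlatU1.periods f := fun y =>
    Subtype.ext (orbitPt_add_of_betaMap hd y)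
  have hone : D.frame f (τ 1 - fun a => (d a : ℝ)) = 1 := D.tr_const _ fun t => by
    refine Subtype.ext ?_
    show T.orbitPt C z (0 + (t : ℝ) • (_ - 0)) = T.orbitPt C z 0
    rw [sub_zero]
    exact orbitPt_add_of_betaMap (by rw [map_smul, hd, smul_zero]) 0
  have hframe := frame_orbitMap_int D z hz hf (fun a => hD a z hz hf) d
  have := D.frame_add_period f hper (fun a => (d a : ℝ))
  rw [hone, hframe, mul_one, add_sub_cancel] at this
  exact this

/-- The Lagrangian meets a fibre if the defining equations of the Lagrangian that involve the moduli
hold over the fibre. -/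
theorem exists_mem_lag {θ : Fin m → ℝ} (hθ : θ ∈ C.angles)
    (he : e = ‖e‖ * Complex.exp ((∑ j, θ j : ℝ) * Complex.I)) {ν : Fin n → ℝ}
    (hν : T.uLine.mkQ ν = b.1) (hc : ∀ a, ∑ j, (C.l a j : ℝ) * T.ell ν j = C.c a) :
    ∃ x ∈ T.lag C, T.gross e x = b := by
  have := T.neZero
  -- The point is chosen with `|χ| = |e| + √b₂` and the phase of `e`, so `|χ - e|² = b₂`. The other
  -- candidate `|e| - √b₂` could be negative.
  let q := (‖e‖ + Real.sqrt b.2) ^ 2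
  have hq : 0 ≤ q := sq_nonneg _
  let z : Fin m → ℂ := fun j =>
    (Real.sqrt (T.ell ν j + height (T.ell ν) q) : ℂ) * Complex.exp (θ j * Complex.I)
  have hn : ∀ j, ‖z j‖ = Real.sqrt (T.ell ν j + height (T.ell ν) q) := fun j => by
    rw [norm_mul, Complex.norm_exp_ofReal_mul_I, mul_one, Complex.norm_real,
      Real.norm_of_nonneg (Real.sqrt_nonneg _)]
  have hn2 : ∀ j, ‖z j‖ ^ 2 = T.ell ν j + height (T.ell ν) q := fun j => by
    rw [hn, Real.sq_sqrt (height_nonneg _ hq j)]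
  have hl : z ∈ T.Level := mem_level_of_norm hn2
  have hz : z ∈ C.lagTilde := by
    refine ⟨fun a => ?_, θ, hθ, fun j => by rw [hn]⟩
    simp only [hn2, mul_add, Finset.sum_add_distrib, hc, ← Finset.sum_mul, C.sum_l, zero_mul,
      add_zero]
  have hprod : ∏ j, z j = ((‖e‖ + Real.sqrt b.2 : ℝ) : ℂ) *
      Complex.exp ((∑ j, θ j : ℝ) * Complex.I) := by
    rw [C.prod_eq_norm_mul hz hθ]
    congr 2
    rw [← sq_eq_sq₀ (norm_nonneg _) (by positivity), norm_prod, ← Finset.prod_pow]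
    simp only [hn2]
    exact prod_height _ hq
  refine ⟨T.proj ⟨z, hl⟩, ⟨⟨z, hl⟩, hz, rfl⟩, ?_⟩
  refine (mem_fibre_iff (e := e) hν ⟨z, hl⟩).2 ⟨⟨_, hn2⟩, ?_⟩
  show ‖∏ j, z j - e‖ ^ 2 = b.2
  rw [hprod]
  nth_rewrite 2 [he]
  rw [← sub_mul, norm_mul, Complex.norm_exp_ofReal_mul_I, mul_one, ← Complex.ofReal_sub,
    Complex.norm_real, Real.norm_eq_abs, sq_abs, add_sub_cancel_left, Real.sq_sqrt b.2.coe_nonneg]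

/-- The square moduli differ from `ell ν` by a common shift, which `∑ l j = 0` makes invisible. So
the moment equations of the Lagrangian descend to the base of the fibration. -/
theorem sum_ell_of_mem_lag {ν : Fin n → ℝ} (hν : T.uLine.mkQ ν = b.1) {z : T.Level}
    (hz : z.1 ∈ C.lagTilde) (hf : T.proj z ∈ T.fibre e b) (a : Fin k) :
    ∑ j, (C.l a j : ℝ) * T.ell ν j = C.c a := by
  obtain ⟨⟨h, hh⟩, -⟩ := (mem_fibre_iff hν z).1 hf
  rw [← hz.1 a]
  simp only [hh, mul_add, Finset.sum_add_distrib, ← Finset.sum_mul, C.sum_l, zero_mul, add_zero]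

theorem DiscClasses.prod_Z_zpow (β : T.DiscClasses e b) (A : FlatClass (T.fibre e b))
    (l : Fin m → ℤ) : ∏ j, β.Z j A ^ (-l j) =
      (Real.exp (∑ j, l j * β.area j) : ℂ) * ((∏ j, A.hol (β.bdry j) ^ l j)⁻¹ : Circle) := by
  have h1 : ∀ j, β.Z j A ^ (-l j) =
      (Real.exp (l j * β.area j) : ℂ) * (((A.hol (β.bdry j) ^ l j)⁻¹ : Circle) : ℂ) := fun j => by
    rw [DiscClasses.Z, mul_zpow, ← zpow_neg, Circle.coe_zpow, Complex.ofReal_exp,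
      Complex.ofReal_exp, ← Complex.exp_int_mul]
    congr 2
    push_cast
    ring
  simp only [h1, Finset.prod_mul_distrib]
  rw [Real.exp_sum, ← Finset.prod_inv_distrib, Complex.ofReal_prod]
  exact congrArg _ (map_prod Circle.coeHom (fun j => (A.hol (β.bdry j) ^ l j)⁻¹) _).symm

theorem real_mul_circle_eq_iff {x y φ : ℝ} {w : Circle} :
    (Real.exp x : ℂ) * ((w⁻¹ : Circle) : ℂ) = Complex.exp (y + φ * Complex.I) ↔
      x = y ∧ w * Circle.exp φ = 1 := by
  have h1 : Complex.exp (y + φ * Complex.I) = (Real.exp y : ℂ) * (Circle.exp φ : ℂ) := by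
    rw [Complex.exp_add, Circle.coe_exp, Complex.ofReal_exp]
  rw [h1, mul_eq_one_iff_inv_eq]
  constructor
  · intro h
    have h2 := congrArg norm h
    rw [norm_mul, norm_mul, Circle.norm_coe, Circle.norm_coe, mul_one, mul_one, Complex.norm_real,
      Complex.norm_real, Real.norm_of_nonneg (Real.exp_pos _).le,
      Real.norm_of_nonneg (Real.exp_pos _).le] at h2
    refine ⟨Real.exp_injective h2, Circle.ext ?_⟩
    rw [h2] at h
    exact mul_left_cancel₀ (Complex.ofReal_ne_zero.2 (Real.exp_pos y).ne') h
  · rintro ⟨rfl, h⟩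
    rw [h]

end ToricCY
end

/-! ### The theorem -/

theorem mainTheorem4 {n m k k' : ℕ} (T : ToricCY n m) (C : Charges m k k')
    (hprim : ∀ x : Fin n → ℤ,
      (∃ r : Fin k → ℝ, ∀ i, (x i : ℝ) = ∑ a, r a * (T.beta (C.l a) i : ℝ)) →
      ∃ d : Fin k → ℤ, x = ∑ a, d a • T.beta (C.l a))
    (ε : ℂ) (hε : ε ≠ 0)
    (hray : ∃ θ ∈ C.angles, ε = ‖ε‖ * Complex.exp ((∑ j, θ j : ℝ) * Complex.I))
    (A : FlatClass (T.lag C)) (φ : Fin k → ℝ)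
    (hA : ∀ (a : Fin k) (z : T.Level), z.1 ∈ C.lagTilde → ∀ (x : T.lag C) (p : Path x x),
      T.IsOrbitLoop (C.l a) z p → A.hol p = Circle.exp (φ a)) :
    (∀ b : T.Base₀ ε, Nonempty (T.DiscClasses ε b.1)) ∧
    ∀ β : ∀ b : T.Base₀ ε, T.DiscClasses ε b.1,
      T.semiFlatBrane ε (T.lag C) A =
        {P | ∀ a, ∏ j, (β P.1).Z j P.2 ^ (-C.l a j) =
          Complex.exp (C.c a + φ a * Complex.I)} := by
  refine ⟨fun b => ToricCY.nonempty_discClasses hε b.2, fun β => ?_⟩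
  obtain ⟨θ, hθ, he⟩ := hray
  ext ⟨⟨b, hb⟩, D⟩
  obtain ⟨A, rfl⟩ := Quotient.exists_rep A
  obtain ⟨D, rfl⟩ := Quotient.exists_rep D
  obtain ⟨ν, hν⟩ := T.exists_rep b
  set β' := β ⟨b, hb⟩ with hβ'
  let ι := ContinuousMap.inclusion (Set.inter_subset_right : T.lag C ∩ T.fibre ε b ⊆ T.fibre ε b)
  let ι' := ContinuousMap.inclusion (Set.inter_subset_left : T.lag C ∩ T.fibre ε b ⊆ T.lag C)
  let E : FlatU1 ↥(T.lag C ∩ T.fibre ε b) := (D.pullback ι).twist (A.pullback ι')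
  -- The same loop is viewed in the fibre, where its holonomy is the product over the `∂β_j`, and in
  -- `L`, where it is prescribed by `φ`.
  have hE : ∀ a (z : T.Level) (hz : z.1 ∈ C.lagTilde) (hf : T.proj z ∈ T.fibre ε b),
      E.tr (ToricCY.orbitLoop z hz hf a) =
        (∏ j, (FlatClass.hol (Quotient.mk _ D) (β'.bdry j)) ^ C.l a j) * Circle.exp (φ a) := by
    intro a z hz hf
    have hloop := ToricCY.isOrbitLoop_orbitLoop z hz hf a
    rw [ToricCY.prod_hol_bdry hb β' (Quotient.mk _ D) (C.special a)
      ((ToricCY.orbitLoop z hz hf a).map ι.continuous) hloop,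
      ← hA a z hz _ ((ToricCY.orbitLoop z hz hf a).map ι'.continuous) hloop]
    rfl
  -- Polar decomposition of the mirror equations: the modulus is the moment equation over `b`, the
  -- phase the triviality of the twisted holonomy.
  have hR : (⟨⟨b, hb⟩, Quotient.mk _ D⟩ : T.Mirror₀ ε) ∈
      {P : T.Mirror₀ ε | ∀ a, ∏ j, (β P.1).Z j P.2 ^ (-C.l a j) =
        Complex.exp (C.c a + φ a * Complex.I)} ↔
      ∀ a, ∑ j, (C.l a j : ℝ) * T.ell ν j = C.c a ∧
        (∏ j, (FlatClass.hol (Quotient.mk _ D) (β'.bdry j)) ^ C.l a j) * Circle.exp (φ a) = 1 := by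
    refine forall_congr' fun a => ?_
    have h := β'.prod_Z_zpow (Quotient.mk _ D) (C.l a)
    rw [← β'.sum_area hb hν (C.special a), ← ToricCY.real_mul_circle_eq_iff]
    exact Eq.congr_left h
  have hL : (⟨⟨b, hb⟩, Quotient.mk _ D⟩ : T.Mirror₀ ε) ∈ T.semiFlatBrane ε (T.lag C)
      (Quotient.mk _ A) ↔ b ∈ T.gross ε '' T.lag C ∧
        ∀ (x : ↥(T.lag C ∩ T.fibre ε b)) (p : Path x x), E.tr p = 1 := by
    refine Set.mem_iUnion₂.trans ⟨?_, ?_⟩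
    · rintro ⟨b', hb', rfl, h⟩
      exact ⟨hb', (FlatU1.mk_eq_triv_iff E).1 h⟩
    · rintro ⟨hb', h⟩
      exact ⟨b, hb', rfl, (FlatU1.mk_eq_triv_iff E).2 h⟩
  rw [hR, hL]
  constructor
  -- The point of `L` over `b` is also needed for the phase: the orbit loop on which triviality is
  -- tested passes through it.
  · rintro ⟨⟨x, ⟨z, hz, rfl⟩, hx⟩, h⟩ a
    exact ⟨ToricCY.sum_ell_of_mem_lag hν hz hx a, by rw [← hE a z hz hx, h]⟩
  · intro h
    exact ⟨ToricCY.exists_mem_lag hθ he hν fun a => (h a).1,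
      ToricCY.tr_eq_one_of_orbitLoop hprim hb hθ he E fun a z hz hf => by rw [hE, (h a).2]⟩
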